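/- **Setting.** Let $q\in\mathbb C^{*}$ and let $\mathbb C_q$ be the quantum torus with basis $x^{a}y^{b}$, $(a,b)\in\mathbb Z^2$, and $yx=q\,xy$. For $m=(m_1,m_2)\in\mathbb Z^2$ and $k\in\mathbb Z^2\setminus\{0\}$ put $e_m=E_{12}x^{m_1}y^{m_2}$, $f_m=E_{21}x^{m_1}y^{m_2}$, $d=E_{11}-E_{22}$, $g_k=E_{11}x^{k_1}y^{k_2}$, $h_k=E_{22}x^{k_1}y^{k_2}$, and $g_0=h_0=0$. These elements (with $k\neq0$) form a basis of a Lie algebra $L$ of $2\times2$ matrices over $\mathbb C_q$ under the commutator. Let $\widehat{\mathfrak{sl}}_2(\mathbb C_q)=L\oplus\mathbb C d_1\oplus\mathbb C d_2$, where $[d_i,z]=m_iz$ for $z\in L$ of degree $m=(m_1,m_2)$ and $[d_1,d_2]=0$, and let $U$ be its universal enveloping algebra. A Hopf algebra structure on $U[[t]]$ over $\mathbb C[[t]]$ is understood in the topological sense: the coproduct $\Delta$ is a homomorphism of $\mathbb C[[t]]$-algebras from $U[[t]]$ to the $t$-adically completed tensor square $U[[t]]\,\widehat\otimes\,U[[t]]=(U\otimes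 U)[[t]]$, the counit is a homomorphism of $\mathbb C[[t]]$-algebras $U[[t]]\to\mathbb C[[t]]$, the antipode $S$ is $\mathbb C[[t]]$-linear, and the usual axioms hold in the completed tensor powers. For $j\ge0$, $a\in\mathbb C$ put $T_a^{<j>}=(T+a)(T+a+1)\cdots(T+a+j-1)$ (equal to $1$ for $j=0$), $T^{<j>}=T_0^{<j>}$, $T_1=T_1^{<1>}=T+1$, and $(1-Et)^r=\sum_{j\ge0}\binom rj(-E)^jt^j$ for $r\in\mathbb C$. For fixed $n=(n_1,n_2)\in\mathbb Z^2$ put $\eta^y_{0,m}=1$ and, for $j\geq1$, $$\eta^g_{j,m}=0,\quad \eta^h_{j,m}=(-1)^j\prod_{p=1}^{j}\bigl(q^{n_2(m_1+(p-1)n_1)}-q^{n_1(m_2+(p-1)n_2)}\bigr),\quad \eta^e_{j,m}=\prod_{p=1}^{j}q^{n_1(m_2+(p-1)n_2)},\quad \eta^f_{j,m}=(-1)^j\prod_{p=1}^{j}q^{n_2(m_1+(p-1)n_1)};$$ $\beta_{f_m}=0$, $\beta_{g_m}=-q^{m_1n_2}$, $\beta_{h_m}=q^{m_2n_1}$; $s_m=q^{n_2m_1+n_1m_2+n_1n_2}$;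 $\delta_{f,f}=1$ and $\delta_{g,f}=\delta_{h,f}=0$. In $y_m$ the index $m$ runs over $\mathbb Z^2$ if $y\in\{e,f\}$ and over $\mathbb Z^2\setminus\{0\}$ if $y\in\{g,h\}$. **Statement.** In each of the following three cases there is a noncommutative and noncocommutative Hopf algebra structure on $U[[t]]$ over $\mathbb C[[t]]$, with the product, unit and counit of $U[[t]]$ unchanged, whose coproduct $\Delta$ and antipode $S$ satisfy the following formulas, for $i=1,2$ and all $m$ as above. (1) $T=x_1d_1+x_2d_2$ with $x_1,x_2\in\mathbb C$, $E=h_n$ with $n\ne0$, $[T,E]=E$, $r=x_1m_1+x_2m_2$, $y\in\{e,f,g,h\}$: $$\Delta(y_m)=y_m\otimes(1-Et)^r+\sum_{j\ge0}\frac{\eta^y_{j,m}}{j!}T^{<j>}\otimes(1-Et)^{-j}y_{m+jn}t^j,$$ $$S(y_m)=\sum_{j\ge0}\frac{(-1)^{j+1}\eta^y_{j,m}}{j!}(1-Et)^{-r}y_{m+jn}T_1^{<j>}t^j,$$ $$\Delta(d_i)=d_i\otimes1+1\otimes d_i-n_iT\otimes1+n_iT\otimes(1-Et)^{-1},\qquad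 S(d_i)=-d_i+n_iTEt,$$ $$\Delta(d)=d\otimes1+1\otimes d,\qquad S(d)=-d.$$ (2) $T=x_1d_1+x_2d_2$ with $x_1,x_2\in\mathbb C$, $E=f_n$, $[T,E]=E$, $r=x_1m_1+x_2m_2$, $y\in\{f,g,h\}$: $$\Delta(y_m)=y_m\otimes(1-Et)^r+1\otimes y_m+\beta_{y_m}T\otimes(1-Et)^{-1}f_{m+n}t,$$ $$S(y_m)=-(1-Et)^{-r}y_m+\beta_{y_m}(1-Et)^{-r}f_{m+n}T_1t;$$ for $m+n\ne0$ $$\Delta(e_m)=q^{m_2n_1}T\otimes(1-Et)^{-1}g_{m+n}t-q^{m_1n_2}T\otimes(1-Et)^{-1}h_{m+n}t+e_m\otimes(1-Et)^r+1\otimes e_m-s_mT^{<2>}\otimes(1-Et)^{-2}f_{m+2n}t^2,$$ $$S(e_m)=q^{m_2n_1}(1-Et)^{-r}g_{m+n}T_1t-q^{m_1n_2}(1-Et)^{-r}h_{m+n}T_1t-(1-Et)^{-r}e_m+s_m(1-Et)^{-r}f_{m+2n}T_1^{<2>}t^2;$$ $$\Delta(e_{-n})=e_{-n}\otimes(1-Et)^{-1}+1\otimes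 e_{-n}+q^{-n_1n_2}T\otimes(1-Et)^{-1}dt-q^{-n_1n_2}T^{<2>}\otimes(1-Et)^{-2}Et^2,$$ $$S(e_{-n})=q^{-n_1n_2}(1-Et)ET_1^{<2>}t^2-(1-Et)e_{-n}+q^{-n_1n_2}(1-Et)dT_1t;$$ $$\Delta(d)=d\otimes1+1\otimes d-2T\otimes(1-Et)^{-1}Et,\qquad S(d)=-d-2ET_1t,$$ $$\Delta(d_i)=d_i\otimes1+1\otimes d_i-n_iT\otimes1+n_iT\otimes(1-Et)^{-1},\qquad S(d_i)=-d_i+n_iTEt.$$ (3) $T=-\tfrac12d$, $E=f_n$ with $n\in\mathbb Z^2$ arbitrary, $y\in\{f,g,h\}$: $$\Delta(y_m)=y_m\otimes(1-Et)^{\delta_{y,f}}+1\otimes y_m+\beta_{y_m}T\otimes(1-Et)^{-1}f_{m+n}t,$$ $$S(y_m)=-(1-Et)^{-\delta_{y,f}}y_m+\beta_{y_m}f_{m+n}T_1t;$$ for $m+n\ne0$ $$\Delta(e_m)=q^{m_2n_1}T\otimes(1-Et)^{-1}g_{m+n}t-q^{m_1n_2}T\otimes(1-Et)^{-1}h_{m+n}t+e_m\otimes(1-Et)^{-1}+1\otimes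 e_m-s_mT^{<2>}\otimes(1-Et)^{-2}f_{m+2n}t^2,$$ $$S(e_m)=q^{m_2n_1}(1-Et)g_{m+n}T_1t-q^{m_1n_2}(1-Et)T_1h_{m+n}t-(1-Et)e_m+s_m(1-Et)f_{m+2n}T_1^{<2>}t^2;$$ $$\Delta(e_{-n})=e_{-n}\otimes(1-Et)^{-1}+q^{-n_1n_2}T\otimes(1-Et)^{-1}dt+1\otimes e_{-n}-q^{-n_1n_2}T^{<2>}\otimes(1-Et)^{-2}Et^2,$$ $$S(e_{-n})=q^{-n_1n_2}(1-Et)ET_1^{<2>}t^2-(1-Et)e_{-n}+q^{-n_1n_2}(1-Et)dT_1t;$$ $$\Delta(d)=d\otimes1+1\otimes d-2T\otimes(1-Et)^{-1}Et,\qquad S(d)=-d-2ET_1t,$$ $$\Delta(d_i)=d_i\otimes1+1\otimes d_i+n_iT\otimes(1-Et)^{-1}-n_iT\otimes1,\qquad S(d_i)=-d_i+n_iTEt.$$ -/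

import Mathlib

open PowerSeries TensorProduct

noncomputable section

namespace EALA

/-! ### The quantum torus -/

/-- The quantum torus `ℂ_q = ℂ_q[x^{±1}, y^{±1}]`, `y x = q x y`, as the vector space on the monomials
`x^{m 0} y^{m 1}`, `m ∈ ℤ²`. -/
def QTorus (_q : ℂˣ) : Type := (Fin 2 → ℤ) →₀ ℂ

namespace QTorus

variable (q : ℂˣ)

instance : AddCommGroup (QTorus q) := inferInstanceAs (AddCommGroup ((Fin 2 → ℤ) →₀ ℂ))

instance : Module ℂ (QTorus q) := inferInstanceAs (Module ℂ ((Fin 2 → ℤ) →₀ ℂ))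

/-- The monomial `x^{m 0} y^{m 1}`. -/
def mono (m : Fin 2 → ℤ) : QTorus q := Finsupp.single m (1 : ℂ)

/-- The linear map on the quantum torus with given values on the monomials. -/
def lin {M : Type*} [AddCommGroup M] [Module ℂ M] (v : (Fin 2 → ℤ) → M) : QTorus q →ₗ[ℂ] M :=
  Finsupp.linearCombination ℂ v

/-- The coefficient at the monomial `1`. -/
def coeffZero : QTorus q →ₗ[ℂ] ℂ := lin q (fun m => if m = 0 then 1 else 0)

/-- The product, `(x^{m 0} y^{m 1}) (x^{m' 0} y^{m' 1}) = q^{m 1 * m' 0} x^{m 0 + m' 0} y^{m 1 + m' 1}`. -/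
def mulLin : QTorus q →ₗ[ℂ] QTorus q →ₗ[ℂ] QTorus q :=
  lin q (fun m => lin q (fun m' => ((q ^ (m 1 * m' 0) : ℂˣ) : ℂ) • mono q (m + m')))

variable {q}

theorem lin_mono {M : Type*} [AddCommGroup M] [Module ℂ M] (v : (Fin 2 → ℤ) → M)
    (m : Fin 2 → ℤ) : lin q v (mono q m) = v m := by
  unfold lin mono
  exact (Finsupp.linearCombination_single ℂ (1 : ℂ) m).trans (one_smul ℂ _)

theorem lin_ext {M : Type*} [AddCommGroup M] [Module ℂ M] {f g : QTorus q →ₗ[ℂ] M}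
    (h : ∀ m, f (mono q m) = g (mono q m)) : f = g :=
  Finsupp.lhom_ext' (M := ℂ) (N := M) fun m => LinearMap.ext_ring (h m)

theorem mulLin_mono (m m' : Fin 2 → ℤ) :
    mulLin q (mono q m) (mono q m') = ((q ^ (m 1 * m' 0) : ℂˣ) : ℂ) • mono q (m + m') := by
  rw [mulLin, lin_mono, lin_mono]

theorem mulLin_assoc (a b c : QTorus q) :
    mulLin q (mulLin q a b) c = mulLin q a (mulLin q b c) := by
  have h : (mulLin q).compr₂ (mulLin q) =
      ((LinearMap.llcomp ℂ (QTorus q) (QTorus q) (QTorus q)).flip ∘ₗ (mulLin q)).flip ∘ₗ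
        (mulLin q) := by
    refine lin_ext fun m => lin_ext fun m' => lin_ext fun m'' => ?_
    simp only [LinearMap.compr₂_apply, LinearMap.comp_apply, LinearMap.flip_apply,
      LinearMap.llcomp_apply, mulLin_mono, map_smul, LinearMap.smul_apply, smul_smul, add_assoc]
    congr 1
    rw [← Units.val_mul, ← Units.val_mul, ← zpow_add, ← zpow_add]
    congr 2
    simp only [Pi.add_apply]
    ring
  exact LinearMap.congr_fun (LinearMap.congr_fun (LinearMap.congr_fun h a) b) c

theorem mulLin_one_left (a : QTorus q) : mulLin q (mono q 0) a = a := by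
  have h : mulLin q (mono q 0) = LinearMap.id := by
    refine lin_ext fun m => ?_
    simp [mulLin_mono]
  exact LinearMap.congr_fun h a

theorem mulLin_one_right (a : QTorus q) : mulLin q a (mono q 0) = a := by
  have h : (mulLin q).flip (mono q 0) = LinearMap.id := by
    refine lin_ext fun m => ?_
    simp [mulLin_mono]
  exact LinearMap.congr_fun h a

instance : Ring (QTorus q) where
  __ := (inferInstance : AddCommGroup (QTorus q))
  mul a b := mulLin q a b
  one := mono q 0
  left_distrib a b c := map_add (mulLin q a) b c
  right_distrib a b c := LinearMap.map_add₂ (mulLin q) a b c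
  zero_mul a := LinearMap.map_zero₂ (mulLin q) a
  mul_zero a := map_zero (mulLin q a)
  mul_assoc := mulLin_assoc
  one_mul := mulLin_one_left
  mul_one := mulLin_one_right

theorem mul_def (a b : QTorus q) : a * b = mulLin q a b := rfl

theorem one_def : (1 : QTorus q) = mono q 0 := rfl

instance : Algebra ℂ (QTorus q) :=
  Algebra.ofModule (fun r a b => LinearMap.map_smul₂ (mulLin q) r a b)
    (fun r a b => map_smul (mulLin q a) r b)

theorem coeffZero_mul_comm (a b : QTorus q) : coeffZero q (a * b) = coeffZero q (b * a) := by
  have h : (mulLin q).compr₂ (coeffZero q) = ((mulLin q).compr₂ (coeffZero q)).flip := by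
    refine lin_ext fun m => lin_ext fun m' => ?_
    simp only [LinearMap.compr₂_apply, LinearMap.flip_apply, mulLin_mono, map_smul, coeffZero,
      lin_mono, add_comm m' m]
    by_cases hm : m + m' = 0
    · have h0 := congrFun hm 0
      have h1 := congrFun hm 1
      simp only [Pi.add_apply, Pi.zero_apply] at h0 h1
      have e : m 1 * m' 0 = m' 1 * m 0 := by
        rw [eq_neg_of_add_eq_zero_left h1, eq_neg_of_add_eq_zero_right h0]; ring
      rw [e]
    · simp [hm]
  exact LinearMap.congr_fun (LinearMap.congr_fun h a) b

variable (q) in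
/-- The degree derivation `x^{m 0} y^{m 1} ↦ (a 0 * m 0 + a 1 * m 1) x^{m 0} y^{m 1}`. -/
def deg (a : Fin 2 → ℂ) : QTorus q →ₗ[ℂ] QTorus q :=
  lin q (fun m => (∑ i, a i * (m i : ℂ)) • mono q m)

theorem deg_mul (a : Fin 2 → ℂ) (u v : QTorus q) :
    deg q a (u * v) = deg q a u * v + u * deg q a v := by
  have h : (mulLin q).compr₂ (deg q a) =
      (mulLin q) ∘ₗ (deg q a) + ((mulLin q).flip ∘ₗ (deg q a)).flip := by
    refine lin_ext fun m => lin_ext fun m' => ?_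
    simp only [LinearMap.compr₂_apply, LinearMap.add_apply, LinearMap.comp_apply,
      LinearMap.flip_apply, deg, lin_mono, map_smul, LinearMap.smul_apply, mulLin_mono, smul_smul,
      ← add_smul]
    congr 1
    simp only [Fin.sum_univ_two, Pi.add_apply]
    push_cast
    ring
  exact LinearMap.congr_fun (LinearMap.congr_fun h u) v

theorem coeffZero_deg (a : Fin 2 → ℂ) (u : QTorus q) : coeffZero q (deg q a u) = 0 := by
  have h : coeffZero q ∘ₗ deg q a = 0 := by
    refine lin_ext fun m => ?_
    by_cases hm : m = 0 <;> simp [coeffZero, deg, lin_mono, hm]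
  exact LinearMap.congr_fun h u

theorem deg_comm (a b : Fin 2 → ℂ) (u : QTorus q) :
    deg q a (deg q b u) = deg q b (deg q a u) := by
  have h : deg q a ∘ₗ deg q b = deg q b ∘ₗ deg q a := by
    refine lin_ext fun m => ?_
    simp only [LinearMap.comp_apply, deg, lin_mono, map_smul, smul_smul]
    rw [mul_comm]
  exact LinearMap.congr_fun h u

theorem deg_add (a b : Fin 2 → ℂ) : deg q (a + b) = deg q a + deg q b := by
  refine lin_ext fun m => ?_
  simp [deg, lin_mono, ← add_smul, add_mul, Finset.sum_add_distrib]

theorem deg_smul (c : ℂ) (a : Fin 2 → ℂ) : deg q (c • a) = c • deg q a := by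
  refine lin_ext fun m => ?_
  simp only [deg, lin_mono, LinearMap.smul_apply, smul_smul, Finset.mul_sum, Pi.smul_apply,
    smul_eq_mul, mul_assoc]

end QTorus

/-! ### The extended affine Lie algebra -/

section Lie

attribute [local instance 100] LieRing.ofAssociativeRing

open QTorus

/-- The Lie algebra `sl₂(ℂ_q)`: the `2 × 2` matrices over `ℂ_q` whose trace has no constant term.
It has the basis `E₁₂ x^a y^b`, `E₂₁ x^a y^b`, `E₁₁ - E₂₂` and `E₁₁ x^a y^b`, `E₂₂ x^a y^b` with
`(a, b) ≠ (0, 0)`; the bracket is the commutator. -/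
def sl2 (q : ℂˣ) : LieSubalgebra ℂ (Matrix (Fin 2) (Fin 2) (QTorus q)) where
  carrier := {A | coeffZero q A.trace = 0}
  add_mem' := by
    intro A B hA hB
    simp only [Set.mem_ofPred_eq, Matrix.trace_add, map_add] at *
    rw [hA, hB, add_zero]
  zero_mem' := by simp
  smul_mem' := by
    intro c A hA
    simp only [Set.mem_ofPred_eq, Matrix.trace_smul, map_smul] at *
    rw [hA, smul_zero]
  lie_mem' := by
    intro A B _ _
    have e : coeffZero q (A * B).trace = coeffZero q (B * A).trace := by
      simp only [Matrix.trace, Matrix.diag, Matrix.mul_apply, Fin.sum_univ_two, map_add]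
      rw [coeffZero_mul_comm (A 0 0), coeffZero_mul_comm (A 0 1), coeffZero_mul_comm (A 1 0),
        coeffZero_mul_comm (A 1 1)]
      ring
    show coeffZero q (A * B - B * A).trace = 0
    rw [Matrix.trace_sub, map_sub, e, sub_self]

/-- The degree derivation `a 0 • d₁ + a 1 • d₂` of `sl₂(ℂ_q)`, acting on the entries. -/
def degDer (q : ℂˣ) (a : Fin 2 → ℂ) : LieDerivation ℂ (sl2 q) (sl2 q) where
  toFun A := ⟨A.1.map (deg q a), by
    show coeffZero q (A.1.map (deg q a)).trace = 0
    simp [Matrix.trace, coeffZero_deg]⟩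
  map_add' A B := by
    apply Subtype.ext; ext i j : 2
    exact map_add (deg q a) _ _
  map_smul' c A := by
    apply Subtype.ext; ext i j : 2
    exact map_smul (deg q a) c _
  leibniz' A B := by
    apply Subtype.ext; ext i j : 2
    show deg q a ((A.1 * B.1 - B.1 * A.1) i j) =
      (A.1 * B.1.map (deg q a) - B.1.map (deg q a) * A.1) i j -
        (B.1 * A.1.map (deg q a) - A.1.map (deg q a) * B.1) i j
    simp only [Matrix.sub_apply, Matrix.mul_apply, Matrix.map_apply, map_sub, map_sum, deg_mul,
      Finset.sum_add_distrib]
    abel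

/-- The action of the abelian Lie algebra `ℂ d₁ ⊕ ℂ d₂` on `sl₂(ℂ_q)`. -/
def degAction (q : ℂˣ) : (Fin 2 → ℂ) →ₗ⁅ℂ⁆ LieDerivation ℂ (sl2 q) (sl2 q) where
  toFun := degDer q
  map_add' a b := by
    refine LieDerivation.ext fun A => Subtype.ext ?_
    ext i j : 2
    exact LinearMap.congr_fun (deg_add a b) (A.1 i j)
  map_smul' c a := by
    refine LieDerivation.ext fun A => Subtype.ext ?_
    ext i j : 2
    exact LinearMap.congr_fun (deg_smul c a) (A.1 i j)
  map_lie' := by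
    intro a b
    refine LieDerivation.ext fun A => Subtype.ext ?_
    rw [LieDerivation.lie_apply]
    ext i j : 2
    have h0 : ⁅a, b⁆ = (0 : ℂ) • a := by
      rw [zero_smul]; funext i; exact sub_eq_zero.mpr (mul_comm _ _)
    rw [h0]
    show deg q ((0 : ℂ) • a) (A.1 i j) =
      deg q a (deg q b (A.1 i j)) - deg q b (deg q a (A.1 i j))
    rw [deg_comm a b, sub_self, deg_smul, zero_smul, LinearMap.zero_apply]

/-- The extended affine Lie algebra `sl₂(ℂ_q) ⊕ ℂ d₁ ⊕ ℂ d₂`. -/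
abbrev ESL (q : ℂˣ) : Type := LieAlgebra.SemiDirectSum (sl2 q) (Fin 2 → ℂ) (degAction q)

/-- The element of the extended affine Lie algebra given by a matrix in `sl₂(ℂ_q)`. -/
def ofMatrix (q : ℂˣ) (A : Matrix (Fin 2) (Fin 2) (QTorus q)) (hA : coeffZero q A.trace = 0) :
    ESL q := ⟨⟨A, hA⟩, 0⟩

/-- `e_m = E₁₂ x^{m 0} y^{m 1}`. -/
def e (q : ℂˣ) (m : Fin 2 → ℤ) : ESL q :=
  ofMatrix q !![0, mono q m; 0, 0] (by simp [Matrix.trace])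

/-- `f_m = E₂₁ x^{m 0} y^{m 1}`. -/
def f (q : ℂˣ) (m : Fin 2 → ℤ) : ESL q :=
  ofMatrix q !![0, 0; mono q m, 0] (by simp [Matrix.trace])

/-- `g_m = E₁₁ x^{m 0} y^{m 1}` for `m ≠ 0`, and `g_0 = 0`. -/
def g (q : ℂˣ) (m : Fin 2 → ℤ) : ESL q :=
  if hm : m = 0 then 0 else
    ofMatrix q !![mono q m, 0; 0, 0] (by simp [Matrix.trace, coeffZero, lin_mono, hm])

/-- `h_m = E₂₂ x^{m 0} y^{m 1}` for `m ≠ 0`, and `h_0 = 0`. -/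
def h (q : ℂˣ) (m : Fin 2 → ℤ) : ESL q :=
  if hm : m = 0 then 0 else
    ofMatrix q !![0, 0; 0, mono q m] (by simp [Matrix.trace, coeffZero, lin_mono, hm])

/-- `d = E₁₁ - E₂₂`. -/
def d (q : ℂˣ) : ESL q := ofMatrix q !![1, 0; 0, -1] (by simp [Matrix.trace])

/-- The degree derivations `d₁ = dd q 0` and `d₂ = dd q 1`. -/
def dd (q : ℂˣ) (i : Fin 2) : ESL q := ⟨0, Pi.single i 1⟩

/-- The universal enveloping algebra. -/
abbrev U (q : ℂˣ) : Type := UniversalEnvelopingAlgebra ℂ (ESL q)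

/-- The canonical map from the Lie algebra to its universal enveloping algebra. -/
def toU {q : ℂˣ} (z : ESL q) : U q := UniversalEnvelopingAlgebra.ι ℂ z

/-- The counit of the universal enveloping algebra: it kills the Lie algebra. -/
def counitU (q : ℂˣ) : U q →ₐ[ℂ] ℂ := UniversalEnvelopingAlgebra.lift ℂ (0 : ESL q →ₗ⁅ℂ⁆ ℂ)

end Lie

/-! ### Formal (`t`-adically completed) Hopf algebras

For a `k`-algebra `A`, the completed tensor powers over `k⟦t⟧` of `A⟦t⟧` are `(A ⊗ A)⟦t⟧`,
`(A ⊗ (A ⊗ A))⟦t⟧`, and so on. The formal variable `t` is `PowerSeries.X`. -/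

section Formal

variable (k : Type*) [CommRing k]

/-- The structure map `k⟦t⟧ → A⟦t⟧` of the `k⟦t⟧`-algebra `A⟦t⟧`. -/
def scalar (A : Type*) [Ring A] [Algebra k A] : k⟦X⟧ →+* A⟦X⟧ := PowerSeries.map (algebraMap k A)

variable {k}
variable {A B : Type*} [Ring A] [Algebra k A] [Ring B] [Algebra k B]

/-- The coefficientwise extension of a linear map `A → B` to `A⟦t⟧ → B⟦t⟧`. -/
def mapCoeff (φ : A →ₗ[k] B) (z : A⟦X⟧) : B⟦X⟧ := PowerSeries.mk fun N => φ (coeff N z)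

/-- The components `F_i : A → B` of a map `F : A⟦t⟧ → B⟦t⟧`, so that `F a = ∑ i, F_i a t^i` for
`a ∈ A`. A `k⟦t⟧`-linear `F` is determined by them. -/
def component (F : A⟦X⟧ →ₗ[k] B⟦X⟧) (i : ℕ) : A →ₗ[k] B where
  toFun a := coeff i (F (C a))
  map_add' a b := by simp
  map_smul' c a := by
    have e : (C (c • a) : A⟦X⟧) = c • C a := by
      ext N; rw [PowerSeries.coeff_C]; change _ = c • coeff N (C a)
      rw [PowerSeries.coeff_C]; split_ifs <;> simp
    rw [e, map_smul]; rfl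

/-- The completed tensor product `F ⊗̂ id : (A ⊗ D)⟦t⟧ → (B ⊗ D)⟦t⟧` of a `k⟦t⟧`-linear map
`F : A⟦t⟧ → B⟦t⟧` with the identity of `D⟦t⟧`. -/
def rTens (D : Type*) [Ring D] [Algebra k D] (F : A⟦X⟧ →ₗ[k] B⟦X⟧) (z : (A ⊗[k] D)⟦X⟧) :
    (B ⊗[k] D)⟦X⟧ :=
  PowerSeries.mk fun N =>
    ∑ p ∈ Finset.HasAntidiagonal.antidiagonal N, (component F p.1).rTensor D (coeff p.2 z)

/-- The completed tensor product `id ⊗̂ F : (D ⊗ A)⟦t⟧ → (D ⊗ B)⟦t⟧` of the identity of `D⟦t⟧` with a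
`k⟦t⟧`-linear map `F : A⟦t⟧ → B⟦t⟧`. -/
def lTens (D : Type*) [Ring D] [Algebra k D] (F : A⟦X⟧ →ₗ[k] B⟦X⟧) (z : (D ⊗[k] A)⟦X⟧) :
    (D ⊗[k] B)⟦X⟧ :=
  PowerSeries.mk fun N =>
    ∑ p ∈ Finset.HasAntidiagonal.antidiagonal N, (component F p.1).lTensor D (coeff p.2 z)

variable (k A) in
/-- A (topological) Hopf algebra structure over `k⟦t⟧` on the `k⟦t⟧`-algebra `A⟦t⟧`, with its usual
product and unit. The comultiplication takes values in the completed tensor square `(A ⊗ A)⟦t⟧`;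
comultiplication and counit are homomorphisms of `k⟦t⟧`-algebras, the antipode is `k⟦t⟧`-linear. -/
structure FormalHopf where
  comul : A⟦X⟧ →ₐ[k] (A ⊗[k] A)⟦X⟧
  counit : A⟦X⟧ →ₐ[k] k⟦X⟧
  antipode : A⟦X⟧ →ₗ[k] A⟦X⟧
  comul_scalar : ∀ c : k⟦X⟧, comul (scalar k A c) = scalar k (A ⊗[k] A) c
  counit_scalar : ∀ c : k⟦X⟧, counit (scalar k A c) = c
  antipode_scalar : ∀ (c : k⟦X⟧) (a : A⟦X⟧), antipode (scalar k A c * a) = scalar k A c * antipode a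
  coassoc : ∀ a : A⟦X⟧,
    mapCoeff (TensorProduct.assoc k A A A).toLinearMap (rTens A comul.toLinearMap (comul a)) =
      lTens A comul.toLinearMap (comul a)
  counit_left : ∀ a : A⟦X⟧,
    mapCoeff (TensorProduct.lid k A).toLinearMap (rTens A counit.toLinearMap (comul a)) = a
  counit_right : ∀ a : A⟦X⟧,
    mapCoeff (TensorProduct.rid k A).toLinearMap (lTens A counit.toLinearMap (comul a)) = a
  antipode_left : ∀ a : A⟦X⟧,
    mapCoeff (LinearMap.mul' k A) (rTens A antipode (comul a)) = scalar k A (counit a)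
  antipode_right : ∀ a : A⟦X⟧,
    mapCoeff (LinearMap.mul' k A) (lTens A antipode (comul a)) = scalar k A (counit a)

/-- The product of `A⟦t⟧` is not commutative. -/
def FormalHopf.Noncommutative (_H : FormalHopf k A) : Prop := ∃ a b : A⟦X⟧, a * b ≠ b * a

/-- The coproduct is not invariant under the flip of the two tensor factors. -/
def FormalHopf.Noncocommutative (H : FormalHopf k A) : Prop :=
  ∃ a : A⟦X⟧, mapCoeff (TensorProduct.comm k A A).toLinearMap (H.comul a) ≠ H.comul a

variable (k) in
/-- The completed tensor `u ⊗̂ v = (u ⊗̂ 1) (1 ⊗̂ v)` of two power series, with coefficients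
`∑_{i + j = N} u_i ⊗ v_j`. -/
def tens (u v : A⟦X⟧) : (A ⊗[k] A)⟦X⟧ :=
  PowerSeries.map (Algebra.TensorProduct.includeLeft : A →ₐ[k] A ⊗[k] A).toRingHom u *
    PowerSeries.map (Algebra.TensorProduct.includeRight : A →ₐ[k] A ⊗[k] A).toRingHom v

/-- The `t`-adically convergent sum `∑_j F_j t^j` of a sequence of power series `F_j`. -/
def tSum (F : ℕ → A⟦X⟧) : A⟦X⟧ :=
  PowerSeries.mk fun N => ∑ p ∈ Finset.HasAntidiagonal.antidiagonal N, coeff p.2 (F p.1)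

end Formal

section Expressions

variable {A : Type*} [Ring A] [Algebra ℂ A]

/-- The binomial series `(1 - E t)^r = ∑_j r (r - 1) ⋯ (r - j + 1) / j! (-E)^j t^j`, `r ∈ ℂ`. -/
def oneSubPow (E : A) (r : ℂ) : A⟦X⟧ :=
  PowerSeries.mk fun j => ((∏ i ∈ Finset.range j, (r - (i : ℂ))) / (j.factorial : ℂ)) • (-E) ^ j

/-- The rising factorial `T_a^{<j>} = (T + a) (T + a + 1) ⋯ (T + a + j - 1)`. -/
def rise (T : A) (a : ℂ) : ℕ → A
  | 0 => 1
  | j + 1 => rise T a j * (T + algebraMap ℂ A (a + (j : ℂ)))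

variable {q : ℂˣ}

/-- An element of the Lie algebra as a constant power series over the enveloping algebra. -/
def emb (z : ESL q) : (U q)⟦X⟧ := C (toU z)

/-- The series `(1 - E t)^r` for an element `E` of the Lie algebra. -/
def pw (E : ESL q) (r : ℂ) : (U q)⟦X⟧ := oneSubPow (toU E) r

/-- The completed tensor of two elements of `U⟦t⟧`. -/
def ot (u v : (U q)⟦X⟧) : (U q ⊗[ℂ] U q)⟦X⟧ := tens ℂ u v

end Expressions

/-- The four families of root and imaginary vectors. -/
inductive Letter
  | e | f | g | h

/-- `y_m` for `y = e, f, g, h`. -/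
def Letter.elt (q : ℂˣ) : Letter → (Fin 2 → ℤ) → ESL q
  | .e => EALA.e q
  | .f => EALA.f q
  | .g => EALA.g q
  | .h => EALA.h q

/-- The indices `m` of the basis vectors `y_m`: all of `ℤ²` for `y = e, f`, and `m ≠ 0` for
`y = g, h`. -/
def Letter.Index : Letter → (Fin 2 → ℤ) → Prop
  | .e, _ => True
  | .f, _ => True
  | .g, m => m ≠ 0
  | .h, m => m ≠ 0

/-- The power `q^a`, as a complex number. -/
def qp (q : ℂˣ) (a : ℤ) : ℂ := ((q ^ a : ℂˣ) : ℂ)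

/-- The coefficients `η_{j,m}^y` (for a fixed `n`); the index `p` runs from `0` to `j - 1`. -/
def eta (q : ℂˣ) (n m : Fin 2 → ℤ) : Letter → ℕ → ℂ
  | .g, 0 => 1
  | .g, _ + 1 => 0
  | .h, j => (-1) ^ j * ∏ p ∈ Finset.range j,
      (qp q (n 1 * (m 0 + p * n 0)) - qp q (n 0 * (m 1 + p * n 1)))
  | .e, j => ∏ p ∈ Finset.range j, qp q (n 0 * (m 1 + p * n 1))
  | .f, j => (-1) ^ j * ∏ p ∈ Finset.range j, qp q (n 1 * (m 0 + p * n 0))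

/-- The coefficients `β_{y_m}` for `y = f, g, h` (for a fixed `n`); not used for `y = e`. -/
def beta (q : ℂˣ) (n m : Fin 2 → ℤ) : Letter → ℂ
  | .e => 0
  | .f => 0
  | .g => -qp q (m 0 * n 1)
  | .h => qp q (m 1 * n 0)

/-- The exponent `δ_{y,f}`. -/
def deltaF : Letter → ℂ
  | .f => 1
  | _ => 0

/-- `s_m = q^{n₂ m₁ + n₁ m₂ + n₁ n₂}` (for a fixed `n`). -/
def sCoef (q : ℂˣ) (n m : Fin 2 → ℤ) : ℂ := qp q (n 1 * m 0 + n 0 * m 1 + n 0 * n 1)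

end EALA

end

infix:68 " ⊠ " => EALA.ot

open EALA

noncomputable section

namespace EALA

/-! ### Rising factorials -/

section Rise

variable {B : Type*} [Ring B] [Algebra ℂ B]

/-! The enveloping algebra `U` is a Hopf algebra in which Lie algebra elements are primitive. A pair
with `[T, E] = E` yields the Jordanian Drinfeld twist `F = (1 - 1 ⊗ E t)^{T ⊗ 1}` with inverse `G`.
Conjugating the coproduct by `F`, and replacing the antipode `S` by `z ↦ u S(z) v` with `u = m (id ⊗
S) F` and `v = m (S ⊗ id) G`, gives a new Hopf structure with the same product and counit
(`IsTwist.formalHopf`). Coassociativity is the cocycle equation for `G`. It holds because, after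
Taylor expansion in the middle leg, `E₂^l` has weight `l` under `T₂` and so shifts the exponent by
exactly the amount required (`negPow_cocycle`, `isTwist_jordanian`).

All three cases are instances of this one construction. If `[T, y] = r y`, conjugation by `F` turns
`y ⊗ 1` into `y ⊗ (1 - E t)^r`, because `y` shifts the exponent `T` by `r` (`jordanian_conj_left`).
It turns `1 ⊗ y` into the sum of `(-1)^l / l! T^{<l>} ⊗ (1 - E t)^{-l} (ad E)^l(y) t^l`, because
moving `y` through powers of `E` produces iterated commutators (`jordanian_conj_right`). The
antipode `-u y v` becomes minus the sum of `1 / l! (1 - E t)^{-r} (ad E)^l(y) T_1^{<l>} t^l`; this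
rests on a Vandermonde identity for rising factorials (`egf_mul_egf_eq_negPow`,
`C_mul_egf_eq_tSum`).

Only the iterated brackets `(ad E)^l(y)` then depend on the case. For `E = h_n` they shift the index
by `n` and multiply by the scalars behind `η` (`pow_ad_h`). For `E = f_n` the third bracket
vanishes, so each series has at most three terms. The adjoint representation of `U` shows that `E`
is nonzero in `U` and that `T ⊗ E` differs from `E ⊗ T`, whence noncommutativity and
noncocommutativity (`exists_formalHopf`). -/

theorem rise_add (τ : B) (a : ℂ) (l i : ℕ) :
    rise τ a (l + i) = rise τ a l * rise τ (a + l) i := by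
  induction i with
  | zero => simp [rise]
  | succ i ih =>
    rw [← add_assoc, rise, ih, rise, mul_assoc]
    push_cast
    rw [add_assoc]

theorem rise_one (τ : B) (a : ℂ) : rise τ a 1 = τ + algebraMap ℂ B a := by
  simp [rise]

theorem rise_add_algebraMap (τ : B) (a c : ℂ) (j : ℕ) :
    rise (τ + algebraMap ℂ B c) a j = rise τ (a + c) j := by
  induction j with
  | zero => rfl
  | succ j ih =>
    rw [rise, ih, rise]
    congr 1
    simp only [map_add]
    abel

theorem commute_rise {τ z : B} (hz : Commute τ z) (a : ℂ) (j : ℕ) : Commute (rise τ a j) z := by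
  induction j with
  | zero => exact Commute.one_left z
  | succ j ih => exact ih.mul_left (hz.add_left (Algebra.commutes _ z))

theorem commute_rise_rise {σ τ : B} (hc : Commute σ τ) (a b : ℂ) (i j : ℕ) :
    Commute (rise σ a i) (rise τ b j) :=
  commute_rise (commute_rise hc.symm b j).symm a i

/-- Passing an element of weight `r` replaces `τ` by `τ + r` in every factor. This shift is the
basic reordering rule for the twist. -/
theorem rise_mul_of_weight {τ y : B} {r : ℂ} (hy : τ * y = y * τ + r • y) (a : ℂ) (j : ℕ) :
    rise τ a j * y = y * rise τ (a + r) j := by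
  induction j with
  | zero => simp [rise]
  | succ j ih =>
    have e : (τ + algebraMap ℂ B (a + j)) * y = y * (τ + algebraMap ℂ B (a + r + j)) := by
      rw [add_mul, mul_add, hy, ← Algebra.commutes (a + r + (j : ℂ)) y, ← Algebra.smul_def,
        ← Algebra.smul_def, add_assoc, ← add_smul]
      congr 2
      ring
    rw [rise, mul_assoc, e, ← mul_assoc, ih, rise, mul_assoc]

/-- Read backwards, the factors on the left are the negatives of those on the right. The induction
therefore removes the last factor on one side and the first on the other. -/
theorem rise_neg (τ : B) (a : ℂ) (j : ℕ) :
    rise (-τ) (1 - a - j) j = (-1) ^ j * rise τ a j := by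
  induction j generalizing a with
  | zero => simp [rise]
  | succ j ih =>
    have e1 : (1 - a - ((j + 1 : ℕ) : ℂ)) = 1 - (a + 1) - j := by push_cast; ring
    have e2 : rise τ a (j + 1) = (τ + algebraMap ℂ B a) * rise τ (a + 1) j := by
      rw [add_comm j 1, rise_add, rise_one, Nat.cast_one]
    have e3 : -τ + algebraMap ℂ B (1 - (a + 1) - j + j) = -(τ + algebraMap ℂ B a) := by
      rw [show 1 - (a + 1) - (j : ℂ) + j = -a by ring, map_neg]; abel
    have hc : Commute (rise τ (a + 1) j) (τ + algebraMap ℂ B a) :=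
      commute_rise ((Commute.refl τ).add_right (Algebra.commutes a τ).symm) _ _
    rw [e1, rise, ih, e2, e3, mul_neg, mul_assoc, hc.eq, pow_succ]
    noncomm_ring

/-- Vandermonde's identity. The new factor of the left side is the sum of the next factors of the
two rising factorials, which is Pascal's rule on the right. -/
theorem rise_add_add {σ τ : B} (hc : Commute σ τ) (a b : ℂ) (n : ℕ) :
    rise (σ + τ) (a + b) n =
      ∑ p ∈ Finset.HasAntidiagonal.antidiagonal n, n.choose p.1 • (rise σ a p.1 * rise τ b p.2) := by
  induction n with
  | zero => simp [rise]
  | succ n ih =>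
    rw [Finset.sum_antidiagonal_choose_succ_nsmul (fun i j => rise σ a i * rise τ b j), rise, ih,
      Finset.sum_mul, ← Finset.sum_add_distrib]
    refine Finset.sum_congr rfl fun p hp => ?_
    have hn := Finset.HasAntidiagonal.mem_antidiagonal.mp hp
    rw [Nat.choose_symm_of_eq_add hn.symm, ← smul_add, smul_mul_assoc]
    congr 1
    have e : σ + τ + algebraMap ℂ B (a + b + n) =
        (τ + algebraMap ℂ B (b + p.2)) + (σ + algebraMap ℂ B (a + p.1)) := by
      simp only [← hn, Nat.cast_add, map_add]; abel
    have hs : Commute (rise τ b p.2) (σ + algebraMap ℂ B (a + p.1)) :=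
      commute_rise (hc.symm.add_right (Algebra.commutes _ τ).symm) _ _
    rw [e, mul_add, rise, rise, mul_assoc, mul_assoc, mul_assoc, hs.eq]

theorem map_rise {B' : Type*} [Ring B'] [Algebra ℂ B'] (φ : B →ₐ[ℂ] B') (τ : B) (a : ℂ) (j : ℕ) :
    φ (rise τ a j) = rise (φ τ) a j := by
  induction j with
  | zero => exact map_one φ
  | succ j ih => rw [rise, map_mul, ih, map_add, AlgHom.commutes, rise]

theorem rise_algebraMap (c a : ℂ) (j : ℕ) :
    rise (algebraMap ℂ B c) a j = algebraMap ℂ B (rise c a j) :=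
  (map_rise (Algebra.ofId ℂ B) c a j).symm

theorem rise_zero_zero_succ (j : ℕ) : rise (0 : B) 0 (j + 1) = 0 := by
  rw [add_comm j 1, rise_add, rise_one, map_zero, add_zero, zero_mul]

/-- Rewrites the numerators of binomial coefficients as rising factorials, so that `oneSubPow`
becomes `negPow` with a scalar exponent. -/
theorem prod_range_sub_eq_rise (r : ℂ) (j : ℕ) :
    ∏ i ∈ Finset.range j, (r - (i : ℂ)) = (-1) ^ j * rise (-r) 0 j := by
  induction j with
  | zero => simp [rise]
  | succ j ih =>
    rw [Finset.prod_range_succ, ih, rise, pow_succ]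
    simp only [Algebra.algebraMap_self, RingHom.id_apply]
    ring

end Rise

/-! ### Convergent sums -/

section ConvergentSum

variable {B : Type*} [Ring B]

theorem tSum_eq (F : ℕ → B⟦X⟧) : tSum F = F 0 + tSum (fun j => F (j + 1)) * X := by
  ext N
  cases N with
  | zero => simp [tSum]
  | succ N =>
    rw [map_add, coeff_succ_mul_X, tSum, coeff_mk, Finset.Nat.sum_antidiagonal_succ, tSum, coeff_mk]

theorem tSum_mul (F : ℕ → B⟦X⟧) (Z : B⟦X⟧) : tSum F * Z = tSum fun j => F j * Z := by
  ext N
  -- The sequence must vary: splitting off its first term lowers the degree by one but leaves the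
  -- shifted sequence.
  induction N generalizing F with
  | zero =>
    rw [tSum_eq, tSum_eq (fun j => F j * Z), add_mul, mul_assoc, (commute_X Z).symm.eq, ← mul_assoc]
    simp
  | succ N ih =>
    rw [tSum_eq, tSum_eq (fun j => F j * Z), add_mul, mul_assoc, (commute_X Z).symm.eq, ← mul_assoc,
      map_add, map_add, coeff_succ_mul_X, coeff_succ_mul_X, ih]

theorem mul_tSum (F : ℕ → B⟦X⟧) (Z : B⟦X⟧) : Z * tSum F = tSum fun j => Z * F j := by
  ext N
  induction N generalizing F with
  | zero =>
    rw [tSum_eq, tSum_eq (fun j => Z * F j), mul_add, ← mul_assoc]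
    simp
  | succ N ih =>
    rw [tSum_eq, tSum_eq (fun j => Z * F j), mul_add, ← mul_assoc,
      map_add, map_add, coeff_succ_mul_X, coeff_succ_mul_X, ih]

end ConvergentSum

/-! ### Exponential generating series -/

section Egf

variable {B : Type*} [Ring B] [Algebra ℂ B]

/-- The exponential generating series `∑_j p_j / j! t^j`. -/
def egf (p : ℕ → B) : B⟦X⟧ := PowerSeries.mk fun j => ((j.factorial : ℂ)⁻¹) • p j

theorem coeff_egf (p : ℕ → B) (j : ℕ) : coeff j (egf p) = ((j.factorial : ℂ)⁻¹) • p j :=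
  coeff_mk _ _

theorem inv_factorial_mul_inv_factorial {N : ℕ} {p : ℕ × ℕ}
    (hp : p ∈ Finset.HasAntidiagonal.antidiagonal N) :
    ((p.1.factorial : ℂ)⁻¹) * ((p.2.factorial : ℂ)⁻¹) =
      ((N.factorial : ℂ)⁻¹) * (N.choose p.1 : ℂ) := by
  have hN := Finset.HasAntidiagonal.mem_antidiagonal.mp hp
  have e : ((N.choose p.1 : ℂ)) * p.1.factorial * p.2.factorial = N.factorial := by
    rw [← hN, Nat.choose_symm_add]; exact_mod_cast Nat.add_choose_mul_factorial_mul_factorial p.1 p.2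
  have h1 : (p.1.factorial : ℂ) ≠ 0 := by exact_mod_cast p.1.factorial_ne_zero
  have h2 : (p.2.factorial : ℂ) ≠ 0 := by exact_mod_cast p.2.factorial_ne_zero
  have h3 : (N.factorial : ℂ) ≠ 0 := by exact_mod_cast N.factorial_ne_zero
  field_simp
  linear_combination -e

theorem egf_mul_egf (p p' : ℕ → B) :
    egf p * egf p' = egf fun N => ∑ x ∈ Finset.HasAntidiagonal.antidiagonal N,
      N.choose x.1 • (p x.1 * p' x.2) := by
  ext N
  rw [coeff_mul, coeff_egf, Finset.smul_sum]
  refine Finset.sum_congr rfl fun x hx => ?_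
  rw [coeff_egf, coeff_egf, smul_mul_smul_comm, inv_factorial_mul_inv_factorial hx, mul_smul,
    Nat.cast_smul_eq_nsmul]

/-- A double series regrouped by total degree, using `1/(l! i!) = (N choose l)/N!`. The inner series
may depend on `l`, as Taylor expansions require. -/
theorem tSum_egf (a : ℕ → B) (b : ℕ → ℕ → B) :
    tSum (fun l => ((l.factorial : ℂ)⁻¹) • (C (a l) * egf (b l))) =
      egf fun N => ∑ x ∈ Finset.HasAntidiagonal.antidiagonal N,
        N.choose x.1 • (a x.1 * b x.1 x.2) := by
  ext N
  rw [tSum, coeff_mk, coeff_egf, Finset.smul_sum]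
  refine Finset.sum_congr rfl fun x hx => ?_
  change ((x.1.factorial : ℂ)⁻¹) • coeff x.2 (C (a x.1) * egf (b x.1)) = _
  rw [coeff_C_mul, coeff_egf, mul_smul_comm, smul_smul, inv_factorial_mul_inv_factorial hx,
    mul_smul, Nat.cast_smul_eq_nsmul]

theorem C_mul_egf (z : B) (p : ℕ → B) : C z * egf p = egf fun j => z * p j := by
  ext N; rw [coeff_C_mul, coeff_egf, coeff_egf, mul_smul_comm]

theorem egf_mul_C (z : B) (p : ℕ → B) : egf p * C z = egf fun j => p j * z := by
  ext N; rw [coeff_mul_C, coeff_egf, coeff_egf, smul_mul_assoc]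

theorem map_egf {B' : Type*} [Ring B'] [Algebra ℂ B'] (φ : B →ₐ[ℂ] B') (p : ℕ → B) :
    PowerSeries.map φ.toRingHom (egf p) = egf fun j => φ (p j) := by
  ext N; rw [coeff_map, coeff_egf, coeff_egf]; exact map_smul φ _ _

theorem egf_eq_one {p : ℕ → B} (h0 : p 0 = 1) (hs : ∀ j, p (j + 1) = 0) : egf p = 1 := by
  ext N
  rw [coeff_egf, coeff_one]
  cases N with
  | zero => simp [h0]
  | succ N => simp [hs]

/-- The series `(1 - ε t)^{-τ} = ∑_j τ (τ + 1) ⋯ (τ + j - 1) ε^j / j! t^j`, with the powers of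
`ε` on the right. -/
def negPow (τ ε : B) : B⟦X⟧ := egf fun j => rise τ 0 j * ε ^ j

theorem negPow_zero (ε : B) : negPow 0 ε = 1 :=
  egf_eq_one (by simp [rise]) fun j => by rw [rise_zero_zero_succ, zero_mul]

theorem negPow_zero_right (τ : B) : negPow τ 0 = 1 :=
  egf_eq_one (by simp [rise]) fun j => by rw [pow_succ, mul_zero, mul_zero]

theorem map_negPow {B' : Type*} [Ring B'] [Algebra ℂ B'] (φ : B →ₐ[ℂ] B') (τ ε : B) :
    PowerSeries.map φ.toRingHom (negPow τ ε) = negPow (φ τ) (φ ε) := by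
  rw [negPow, map_egf, negPow]
  congr 1; funext j
  rw [map_mul, map_rise, map_pow]

/-- Vandermonde's identity coefficient by coefficient. `σ` need not commute with `ε`, since only the
rising factorials of `τ` have to pass powers of `ε`. -/
theorem negPow_add {σ τ ε : B} (hστ : Commute σ τ) (hτ : Commute τ ε) :
    negPow (σ + τ) ε = negPow σ ε * negPow τ ε := by
  rw [negPow, negPow, negPow, egf_mul_egf]
  congr 1; funext N
  have e := rise_add_add hστ 0 0 N
  rw [add_zero] at e
  rw [e, Finset.sum_mul]
  refine Finset.sum_congr rfl fun x hx => ?_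
  have hx := Finset.HasAntidiagonal.mem_antidiagonal.mp hx
  rw [smul_mul_assoc, ← hx, pow_add]
  congr 1
  rw [mul_assoc, mul_assoc, ← mul_assoc _ (ε ^ x.1), ((commute_rise hτ 0 x.2).pow_right x.1).eq,
    mul_assoc]

theorem negPow_mul_C_of_weight {τ ε y : B} {r : ℂ} (hy : τ * y = y * τ + r • y)
    (hε : Commute ε y) : negPow τ ε * C y = C y * negPow (τ + algebraMap ℂ B r) ε := by
  rw [negPow, negPow, egf_mul_C, C_mul_egf]
  congr 1; funext j
  rw [rise_add_algebraMap, zero_add, mul_assoc, (hε.pow_left j).eq, ← mul_assoc,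
    rise_mul_of_weight hy, mul_assoc, zero_add]

theorem neg_one_smul_pow_mul (z : B) (j : ℕ) : ((-1 : ℂ) ^ j) • z = (-1) ^ j * z := by
  rw [Algebra.smul_def, map_pow, map_neg, map_one]

theorem oneSubPow_eq_negPow (ε : B) (r : ℂ) :
    oneSubPow ε r = negPow (algebraMap ℂ B (-r)) ε := by
  ext j
  rw [oneSubPow, coeff_mk, negPow, coeff_egf, prod_range_sub_eq_rise, rise_algebraMap,
    ← Algebra.smul_def, smul_smul, neg_pow ε j, ← neg_one_smul_pow_mul (ε ^ j), smul_smul]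
  congr 1
  have e : ((-1 : ℂ) ^ j) * (-1) ^ j = 1 := by rw [← mul_pow]; simp
  linear_combination ((j.factorial : ℂ)⁻¹ * rise (-r) 0 j) * e

/-- Taylor expansion of `(1 - (α + ε) t)^{-τ}` around `ε`. -/
theorem negPow_add_right {τ α ε : B} (hτ : Commute τ α) (hα : Commute α ε) :
    negPow τ (α + ε) = tSum fun l => ((l.factorial : ℂ)⁻¹) •
      (C (rise τ 0 l * α ^ l) * negPow (τ + algebraMap ℂ B (l : ℂ)) ε) := by
  unfold negPow
  rw [tSum_egf]
  congr 1; funext N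
  -- After the binomial theorem, `τ^{<l+i>} = τ^{<l>} (τ + l)^{<i>}` splits each term into its
  -- Taylor coefficient and a term of the series with exponent `τ + l`.
  rw [hα.add_pow', Finset.mul_sum]
  refine Finset.sum_congr rfl fun x hx => ?_
  have hx := Finset.HasAntidiagonal.mem_antidiagonal.mp hx
  rw [mul_smul_comm]
  congr 1
  rw [rise_add_algebraMap, zero_add, ← hx, rise_add, zero_add, mul_assoc, mul_assoc,
    ← mul_assoc _ (α ^ _), ((commute_rise hτ _ x.2).pow_right x.1).eq, mul_assoc]

end Egf

/-! ### Maps of power series that commute with `t` -/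

section XLinear

/-- Additive maps of power series that commute with multiplication by the variable. -/
structure IsXLinear {A B : Type*} [Ring A] [Ring B] (Φ : A⟦X⟧ → B⟦X⟧) : Prop where
  add : ∀ u v, Φ (u + v) = Φ u + Φ v
  mul_X : ∀ u, Φ (u * X) = Φ u * X

namespace IsXLinear

variable {A B D : Type*} [Ring A] [Ring B] [Ring D]

/-- A map that commutes with the variable is determined by its values on the constants. -/
theorem ext {Φ Ψ : A⟦X⟧ → B⟦X⟧} (hΦ : IsXLinear Φ) (hΨ : IsXLinear Ψ)
    (hC : ∀ a, Φ (C a) = Ψ (C a)) (z : A⟦X⟧) : Φ z = Ψ z := by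
  ext N
  induction N generalizing z with
  | zero =>
    rw [PowerSeries.eq_shift_mul_X_add_const z, hΦ.add, hΨ.add, hΦ.mul_X, hΨ.mul_X, hC]
    simp
  | succ N ih =>
    rw [PowerSeries.eq_shift_mul_X_add_const z, hΦ.add, hΨ.add, hΦ.mul_X, hΨ.mul_X, hC,
      map_add, map_add, coeff_succ_mul_X, coeff_succ_mul_X, ih]

theorem comp {Φ : B⟦X⟧ → D⟦X⟧} {Ψ : A⟦X⟧ → B⟦X⟧} (hΦ : IsXLinear Φ) (hΨ : IsXLinear Ψ) :
    IsXLinear fun z => Φ (Ψ z) where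
  add u v := by rw [hΨ.add, hΦ.add]
  mul_X u := by rw [hΨ.mul_X, hΦ.mul_X]

theorem mul_left {Φ : A⟦X⟧ → B⟦X⟧} (hΦ : IsXLinear Φ) (K : B⟦X⟧) :
    IsXLinear fun z => K * Φ z where
  add u v := by rw [hΦ.add, mul_add]
  mul_X u := by rw [hΦ.mul_X, mul_assoc]

theorem mul_right {Φ : A⟦X⟧ → B⟦X⟧} (hΦ : IsXLinear Φ) (K : B⟦X⟧) :
    IsXLinear fun z => Φ z * K where
  add u v := by rw [hΦ.add, add_mul]
  mul_X u := by rw [hΦ.mul_X, mul_assoc, (commute_X K).symm.eq, ← mul_assoc]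

theorem id : IsXLinear fun z : A⟦X⟧ => z := ⟨fun _ _ => rfl, fun _ => rfl⟩

theorem map (φ : A →+* B) : IsXLinear fun z => PowerSeries.map φ z where
  add u v := map_add _ u v
  mul_X u := by rw [map_mul, map_X]

end IsXLinear

variable {k : Type*} [CommRing k] {A B D : Type*} [Ring A] [Algebra k A] [Ring B] [Algebra k B]
  [Ring D] [Algebra k D]

theorem mapCoeff_C (φ : A →ₗ[k] B) (a : A) : mapCoeff φ (C a) = C (φ a) := by
  ext N
  rw [mapCoeff, coeff_mk, coeff_C, coeff_C]
  split_ifs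
  · rfl
  · exact map_zero φ

theorem isXLinear_mapCoeff (φ : A →ₗ[k] B) : IsXLinear (mapCoeff φ) where
  add u v := by ext N; simp [mapCoeff]
  mul_X u := by
    ext N
    cases N with
    | zero => simp [mapCoeff]
    | succ N => rw [mapCoeff, coeff_mk, coeff_succ_mul_X, coeff_succ_mul_X, mapCoeff, coeff_mk]

/-- The power series version of a bilinear map. -/
def bilin (β : A →ₗ[k] B →ₗ[k] D) (u : A⟦X⟧) (v : B⟦X⟧) : D⟦X⟧ :=
  PowerSeries.mk fun N =>
    ∑ p ∈ Finset.HasAntidiagonal.antidiagonal N, β (coeff p.1 u) (coeff p.2 v)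

theorem coeff_bilin_C (β : A →ₗ[k] B →ₗ[k] D) (u : A⟦X⟧) (b : B) (N : ℕ) :
    coeff N (bilin β u (C b)) = β (coeff N u) b := by
  rw [bilin, coeff_mk, Finset.sum_eq_single (N, 0)]
  · simp
  · intro p hp hne
    have : p.2 ≠ 0 := fun h0 => hne (by
      have := Finset.HasAntidiagonal.mem_antidiagonal.mp hp
      ext <;> simp_all)
    rw [coeff_C, if_neg this, map_zero]
  · simp

theorem isXLinear_bilin_right (β : A →ₗ[k] B →ₗ[k] D) (u : A⟦X⟧) : IsXLinear (bilin β u) where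
  add v w := by ext N; simp [bilin, Finset.sum_add_distrib]
  mul_X v := by
    ext N
    cases N with
    | zero => simp [bilin]
    | succ N =>
      rw [coeff_succ_mul_X, bilin, coeff_mk, Finset.Nat.sum_antidiagonal_succ', bilin, coeff_mk]
      simp [coeff_succ_mul_X]

theorem isXLinear_bilin_left (β : A →ₗ[k] B →ₗ[k] D) (v : B⟦X⟧) :
    IsXLinear fun u => bilin β u v where
  add u w := by ext N; simp [bilin, Finset.sum_add_distrib]
  mul_X u := by
    ext N
    cases N with
    | zero => simp [bilin]
    | succ N =>
      rw [coeff_succ_mul_X, bilin, coeff_mk, Finset.Nat.sum_antidiagonal_succ, bilin, coeff_mk]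
      simp [coeff_succ_mul_X]

theorem coeff_rTens_C (F : A⟦X⟧ →ₗ[k] B⟦X⟧) (w : A ⊗[k] D) (N : ℕ) :
    coeff N (rTens D F (C w)) = (component F N).rTensor D w := by
  rw [rTens, coeff_mk, Finset.sum_eq_single (N, 0)]
  · simp
  · intro p hp hne
    have : p.2 ≠ 0 := fun h0 => hne (by
      have := Finset.HasAntidiagonal.mem_antidiagonal.mp hp
      ext <;> simp_all)
    rw [coeff_C, if_neg this, map_zero]
  · simp

theorem coeff_lTens_C (F : A⟦X⟧ →ₗ[k] B⟦X⟧) (w : D ⊗[k] A) (N : ℕ) :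
    coeff N (lTens D F (C w)) = (component F N).lTensor D w := by
  rw [lTens, coeff_mk, Finset.sum_eq_single (N, 0)]
  · simp
  · intro p hp hne
    have : p.2 ≠ 0 := fun h0 => hne (by
      have := Finset.HasAntidiagonal.mem_antidiagonal.mp hp
      ext <;> simp_all)
    rw [coeff_C, if_neg this, map_zero]
  · simp

theorem isXLinear_rTens (F : A⟦X⟧ →ₗ[k] B⟦X⟧) : IsXLinear (rTens D F) where
  add v w := by ext N; simp [rTens, Finset.sum_add_distrib]
  mul_X v := by
    ext N
    cases N with
    | zero => simp [rTens]
    | succ N =>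
      rw [coeff_succ_mul_X, rTens, coeff_mk, Finset.Nat.sum_antidiagonal_succ', rTens, coeff_mk]
      simp [coeff_succ_mul_X]

theorem isXLinear_lTens (F : A⟦X⟧ →ₗ[k] B⟦X⟧) : IsXLinear (lTens D F) where
  add v w := by ext N; simp [lTens, Finset.sum_add_distrib]
  mul_X v := by
    ext N
    cases N with
    | zero => simp [lTens]
    | succ N =>
      rw [coeff_succ_mul_X, lTens, coeff_mk, Finset.Nat.sum_antidiagonal_succ', lTens, coeff_mk]
      simp [coeff_succ_mul_X]

/-- Two maps on series over a tensor product that commute with the variable agree if they agree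
on constant pure tensors. -/
theorem IsXLinear.ext_tmul {R : Type*} [Ring R] {Φ Ψ : (A ⊗[k] B)⟦X⟧ → R⟦X⟧} (hΦ : IsXLinear Φ) (hΨ : IsXLinear Ψ)
    (hC : ∀ a b, Φ (C (a ⊗ₜ b)) = Ψ (C (a ⊗ₜ b))) (z : (A ⊗[k] B)⟦X⟧) : Φ z = Ψ z := by
  refine hΦ.ext hΨ (fun w => ?_) z
  induction w using TensorProduct.induction_on with
  | zero =>
    have h1 := hΦ.add 0 0
    have h2 := hΨ.add 0 0
    rw [add_zero, left_eq_add] at h1 h2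
    rw [map_zero, h1, h2]
  | tmul a b => exact hC a b
  | add u v hu hv => rw [map_add, hΦ.add, hΨ.add, hu, hv]

theorem scalar_mul_comm (c : k⟦X⟧) (z : A⟦X⟧) : scalar k A c * z = z * scalar k A c := by
  revert c
  refine (((IsXLinear.map _).mul_right z).ext ((IsXLinear.map _).mul_left z)) fun r => ?_
  rw [PowerSeries.map_C]
  refine (IsXLinear.id.mul_left _).ext (IsXLinear.id.mul_right _) (fun a => ?_) z
  rw [← map_mul, ← map_mul, Algebra.commutes]

theorem map_scalar (φ : A →ₐ[k] B) (c : k⟦X⟧) :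
    PowerSeries.map φ.toRingHom (scalar k A c) = scalar k B c := by
  ext N
  simp [scalar]

/-- The coefficientwise extension of an algebra homomorphism. -/
def mapAlg (φ : A →ₐ[k] B) : A⟦X⟧ →ₐ[k] B⟦X⟧ where
  __ := PowerSeries.map φ.toRingHom
  commutes' r := by
    rw [PowerSeries.algebraMap_apply, PowerSeries.algebraMap_apply]
    refine (PowerSeries.map_C φ.toRingHom _).trans ?_
    exact congrArg C (φ.commutes r)

theorem mapAlg_C (φ : A →ₐ[k] B) (a : A) : mapAlg φ (C a) = C (φ a) := PowerSeries.map_C _ a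

theorem isXLinear_mapAlg (φ : A →ₐ[k] B) : IsXLinear (mapAlg φ) := IsXLinear.map φ.toRingHom

theorem mapAlg_comp (φ : B →ₐ[k] D) (ψ : A →ₐ[k] B) (z : A⟦X⟧) :
    mapAlg φ (mapAlg ψ z) = mapAlg (φ.comp ψ) z := by
  ext N; rfl

theorem mapAlg_scalar (φ : A →ₐ[k] B) (c : k⟦X⟧) : mapAlg φ (scalar k A c) = scalar k B c :=
  map_scalar φ c

/-- The coefficientwise extension of an algebra homomorphism, conjugated by a series. -/
def conjAlg (φ : A →ₐ[k] B) (F G : B⟦X⟧) (hFG : F * G = 1) (hGF : G * F = 1) :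
    A⟦X⟧ →ₐ[k] B⟦X⟧ where
  toFun z := F * mapAlg φ z * G
  map_one' := by rw [map_one, mul_one, hFG]
  map_mul' u v := by
    rw [map_mul]
    calc F * (mapAlg φ u * mapAlg φ v) * G = F * mapAlg φ u * 1 * mapAlg φ v * G := by
          noncomm_ring
      _ = F * mapAlg φ u * (G * F) * mapAlg φ v * G := by rw [hGF]
      _ = _ := by noncomm_ring
  map_zero' := by simp
  map_add' u v := by rw [map_add, mul_add, add_mul]
  commutes' r := by
    rw [AlgHom.commutes, ← Algebra.commutes, mul_assoc, hFG, mul_one]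

end XLinear

/-! ### Twisting a Hopf algebra -/

section Twist

variable {k : Type*} [CommRing k] {A : Type*} [Ring A] [HopfAlgebra k A]

variable (k A) in
/-- `a ⊗ b ↦ a ⊗ b ⊗ 1`. -/
def legs12 : A ⊗[k] A →ₐ[k] A ⊗[k] (A ⊗[k] A) :=
  Algebra.TensorProduct.map (AlgHom.id k A) Algebra.TensorProduct.includeLeft

variable (k A) in
/-- `a ⊗ b ↦ 1 ⊗ a ⊗ b`. -/
def legs23 : A ⊗[k] A →ₐ[k] A ⊗[k] (A ⊗[k] A) := Algebra.TensorProduct.includeRight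

variable (k A) in
/-- The coproduct of the first tensor factor. -/
def comulFst : A ⊗[k] A →ₐ[k] A ⊗[k] (A ⊗[k] A) :=
  (Algebra.TensorProduct.assoc k k k A A A).toAlgHom.comp
    (Algebra.TensorProduct.map (Bialgebra.comulAlgHom k A) (AlgHom.id k A))

variable (k A) in
/-- The coproduct of the second tensor factor. -/
def comulSnd : A ⊗[k] A →ₐ[k] A ⊗[k] (A ⊗[k] A) :=
  Algebra.TensorProduct.map (AlgHom.id k A) (Bialgebra.comulAlgHom k A)

variable (k A) in
/-- The counit of the first tensor factor. -/
def counitFst : A ⊗[k] A →ₐ[k] A :=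
  (Algebra.TensorProduct.lid k A).toAlgHom.comp
    (Algebra.TensorProduct.map (Bialgebra.counitAlgHom k A) (AlgHom.id k A))

variable (k A) in
/-- The counit of the second tensor factor. -/
def counitSnd : A ⊗[k] A →ₐ[k] A :=
  (Algebra.TensorProduct.rid k k A).toAlgHom.comp
    (Algebra.TensorProduct.map (AlgHom.id k A) (Bialgebra.counitAlgHom k A))

variable (k A) in
/-- The bilinear map `c, a ⊗ b ↦ S(a) c b`. -/
def antipodeActLeft : A →ₗ[k] A ⊗[k] A →ₗ[k] A :=
  (TensorProduct.lift.equiv (RingHom.id k) A A A).toLinearMap ∘ₗ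
    (((LinearMap.llcomp k A A (A →ₗ[k] A)).flip (HopfAlgebra.antipode k)) ∘ₗ
      ((LinearMap.mul k A).compr₂ (LinearMap.mul k A)).flip)

theorem antipodeActLeft_tmul (c a b : A) :
    antipodeActLeft k A c (a ⊗ₜ b) = HopfAlgebra.antipode k a * c * b := by
  simp [antipodeActLeft]

variable (k A) in
/-- The bilinear map `c, a ⊗ b ↦ a c S(b)`. -/
def antipodeActRight : A →ₗ[k] A ⊗[k] A →ₗ[k] A :=
  (TensorProduct.lift.equiv (RingHom.id k) A A A).toLinearMap ∘ₗ
    (((LinearMap.llcomp k A (A →ₗ[k] A) (A →ₗ[k] A))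
      ((LinearMap.llcomp k A A A).flip (HopfAlgebra.antipode k))) ∘ₗ
      ((LinearMap.mul k A).compr₂ (LinearMap.mul k A)).flip)

theorem antipodeActRight_tmul (c a b : A) :
    antipodeActRight k A c (a ⊗ₜ b) = a * c * HopfAlgebra.antipode k b := by
  simp [antipodeActRight]

theorem bilin_antipodeActLeft_tmul (K : A⟦X⟧) (a b : A) :
    bilin (antipodeActLeft k A) K (C (a ⊗ₜ b)) = C (HopfAlgebra.antipode k a) * K * C b := by
  ext N
  rw [coeff_bilin_C, antipodeActLeft_tmul, coeff_mul_C, coeff_C_mul]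

theorem bilin_antipodeActRight_tmul (K : A⟦X⟧) (a b : A) :
    bilin (antipodeActRight k A) K (C (a ⊗ₜ b)) = C a * K * C (HopfAlgebra.antipode k b) := by
  ext N
  rw [coeff_bilin_C, antipodeActRight_tmul, coeff_mul_C, coeff_C_mul]

/-- Since `S` reverses products, `c ↦ S(a) c b` is a right action of `A ⊗ A` on `A`. A product `F
Δ(a) G` can thus act one factor at a time. -/
theorem bilin_antipodeActLeft_mul (K : A⟦X⟧) (z w : (A ⊗[k] A)⟦X⟧) :
    bilin (antipodeActLeft k A) K (z * w) =
      bilin (antipodeActLeft k A) (bilin (antipodeActLeft k A) K z) w := by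
  refine ((isXLinear_bilin_right _ K).comp (IsXLinear.id.mul_left z)).ext_tmul
    (isXLinear_bilin_right _ _) (fun x y => ?_) w
  refine ((isXLinear_bilin_right _ K).comp (IsXLinear.id.mul_right _)).ext_tmul
    ((isXLinear_bilin_left _ _).comp (isXLinear_bilin_right _ K)) (fun a b => ?_) z
  rw [← map_mul, Algebra.TensorProduct.tmul_mul_tmul, bilin_antipodeActLeft_tmul,
    bilin_antipodeActLeft_tmul, bilin_antipodeActLeft_tmul, HopfAlgebra.antipode_mul_antidistrib,
    map_mul, map_mul]
  noncomm_ring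

/-- Here `c ↦ a c S(b)` is a left action, so the rightmost factor acts first. -/
theorem bilin_antipodeActRight_mul (K : A⟦X⟧) (z w : (A ⊗[k] A)⟦X⟧) :
    bilin (antipodeActRight k A) K (z * w) =
      bilin (antipodeActRight k A) (bilin (antipodeActRight k A) K w) z := by
  refine ((isXLinear_bilin_right _ K).comp (IsXLinear.id.mul_left z)).ext_tmul
    ((isXLinear_bilin_left _ _).comp (isXLinear_bilin_right _ K)) (fun x y => ?_) w
  refine ((isXLinear_bilin_right _ K).comp (IsXLinear.id.mul_right _)).ext_tmul
    (isXLinear_bilin_right _ _) (fun a b => ?_) z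
  rw [← map_mul, Algebra.TensorProduct.tmul_mul_tmul, bilin_antipodeActRight_tmul,
    bilin_antipodeActRight_tmul, bilin_antipodeActRight_tmul, HopfAlgebra.antipode_mul_antidistrib,
    map_mul, map_mul]
  noncomm_ring

theorem bilin_antipodeActLeft_one_right (K : A⟦X⟧) :
    bilin (antipodeActLeft k A) K 1 = K := by
  have e : (1 : (A ⊗[k] A)⟦X⟧) = C ((1 : A) ⊗ₜ[k] (1 : A)) := (map_one C).symm
  rw [e, bilin_antipodeActLeft_tmul, HopfAlgebra.antipode_one, map_one, one_mul, mul_one]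

theorem bilin_antipodeActRight_one_right (K : A⟦X⟧) :
    bilin (antipodeActRight k A) K 1 = K := by
  have e : (1 : (A ⊗[k] A)⟦X⟧) = C ((1 : A) ⊗ₜ[k] (1 : A)) := (map_one C).symm
  rw [e, bilin_antipodeActRight_tmul, HopfAlgebra.antipode_one, map_one, one_mul, mul_one]

/-- The untwisted antipode axiom in the language of the action. -/
theorem bilin_antipodeActLeft_comul (a : A⟦X⟧) :
    bilin (antipodeActLeft k A) 1 (mapAlg (Bialgebra.comulAlgHom k A) a) =
      scalar k A (mapAlg (Bialgebra.counitAlgHom k A) a) := by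
  refine ((isXLinear_bilin_right _ 1).comp (isXLinear_mapAlg _)).ext
    ((IsXLinear.map _).comp (isXLinear_mapAlg _)) (fun x => ?_) a
  rw [mapAlg_C, mapAlg_C, PowerSeries.map_C]
  have e : ∀ w : A ⊗[k] A, bilin (antipodeActLeft k A) 1 (C w) =
      C (LinearMap.mul' k A ((HopfAlgebra.antipode k).rTensor A w)) := by
    intro w
    rw [← mapCoeff_C, ← mapCoeff_C]
    refine (isXLinear_bilin_right _ 1).ext_tmul
      ((isXLinear_mapCoeff _).comp (isXLinear_mapCoeff _)) (fun a b => ?_) _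
    rw [bilin_antipodeActLeft_tmul, mapCoeff_C, mapCoeff_C, mul_one, ← map_mul]
    rfl
  rw [e]
  exact congrArg C (HopfAlgebra.mul_antipode_rTensor_comul_apply x)

theorem bilin_antipodeActRight_comul (a : A⟦X⟧) :
    bilin (antipodeActRight k A) 1 (mapAlg (Bialgebra.comulAlgHom k A) a) =
      scalar k A (mapAlg (Bialgebra.counitAlgHom k A) a) := by
  refine ((isXLinear_bilin_right _ 1).comp (isXLinear_mapAlg _)).ext
    ((IsXLinear.map _).comp (isXLinear_mapAlg _)) (fun x => ?_) a
  rw [mapAlg_C, mapAlg_C, PowerSeries.map_C]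
  have e : ∀ w : A ⊗[k] A, bilin (antipodeActRight k A) 1 (C w) =
      C (LinearMap.mul' k A ((HopfAlgebra.antipode k).lTensor A w)) := by
    intro w
    rw [← mapCoeff_C, ← mapCoeff_C]
    refine (isXLinear_bilin_right _ 1).ext_tmul
      ((isXLinear_mapCoeff _).comp (isXLinear_mapCoeff _)) (fun a b => ?_) _
    rw [bilin_antipodeActRight_tmul, mapCoeff_C, mapCoeff_C, mul_one, ← map_mul]
    rfl
  rw [e]
  exact congrArg C (HopfAlgebra.mul_antipode_lTensor_comul_apply x)

theorem bilin_antipodeActLeft_scalar (c : k⟦X⟧) (z : (A ⊗[k] A)⟦X⟧) :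
    bilin (antipodeActLeft k A) (scalar k A c) z =
      scalar k A c * bilin (antipodeActLeft k A) 1 z := by
  refine (isXLinear_bilin_right _ _).ext_tmul ((isXLinear_bilin_right _ _).mul_left _)
    (fun a b => ?_) z
  rw [bilin_antipodeActLeft_tmul, bilin_antipodeActLeft_tmul, mul_one, ← scalar_mul_comm, mul_assoc]

theorem bilin_antipodeActRight_scalar (c : k⟦X⟧) (z : (A ⊗[k] A)⟦X⟧) :
    bilin (antipodeActRight k A) (scalar k A c) z =
      scalar k A c * bilin (antipodeActRight k A) 1 z := by
  refine (isXLinear_bilin_right _ _).ext_tmul ((isXLinear_bilin_right _ _).mul_left _)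
    (fun a b => ?_) z
  rw [bilin_antipodeActRight_tmul, bilin_antipodeActRight_tmul, mul_one, ← scalar_mul_comm,
    mul_assoc]

variable (k A) in
/-- The extended antipode conjugated by the series `u` with inverse `v`. -/
def conjAntipode (u v : A⟦X⟧) : A⟦X⟧ →ₗ[k] A⟦X⟧ where
  toFun z := u * mapCoeff (HopfAlgebra.antipode k) z * v
  map_add' x y := by rw [(isXLinear_mapCoeff _).add, mul_add, add_mul]
  map_smul' c x := by
    have e : mapCoeff (HopfAlgebra.antipode k) (c • x) =
        c • mapCoeff (HopfAlgebra.antipode k) x := by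
      ext N
      rw [mapCoeff, coeff_mk, coeff_smul, map_smul, coeff_smul, mapCoeff, coeff_mk]
    rw [e, mul_smul_comm, smul_mul_assoc]
    rfl

theorem conjAntipode_C (u v : A⟦X⟧) (a : A) :
    conjAntipode k A u v (C a) = u * C (HopfAlgebra.antipode k a) * v := by
  change u * mapCoeff (HopfAlgebra.antipode k) (C a) * v = _
  rw [mapCoeff_C]

/-- A Drinfeld twist, given by the inverse `G` of the twisting series `F`. The element
`m (id ⊗ S) F` and `m (S ⊗ id) G` are required to be inverse to each other. -/
structure IsTwist (F G : (A ⊗[k] A)⟦X⟧) : Prop where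
  mul_inv : F * G = 1
  inv_mul : G * F = 1
  cocycle : mapAlg (comulFst k A) G * mapAlg (legs12 k A) G =
    mapAlg (comulSnd k A) G * mapAlg (legs23 k A) G
  counit_fst : mapAlg (counitFst k A) G = 1
  counit_snd : mapAlg (counitSnd k A) G = 1
  antipode : bilin (antipodeActRight k A) 1 F * bilin (antipodeActLeft k A) 1 G = 1

theorem mapAlg_mul_eq_one {B D : Type*} [Ring B] [Algebra k B] [Ring D] [Algebra k D]
    (φ : B →ₐ[k] D) {u v : B⟦X⟧} (huv : u * v = 1) :
    mapAlg φ u * mapAlg φ v = 1 := by rw [← map_mul, huv, map_one]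

namespace IsTwist

variable {F G : (A ⊗[k] A)⟦X⟧}

/-- The two sides are a left and a right inverse of the same element, the common value in `cocycle`.
-/
theorem cocycle_inv (hT : IsTwist F G) : mapAlg (legs12 k A) F * mapAlg (comulFst k A) F =
    mapAlg (legs23 k A) F * mapAlg (comulSnd k A) F := by
  refine left_inv_eq_right_inv (a := mapAlg (comulFst k A) G * mapAlg (legs12 k A) G) ?_ ?_
  · rw [mul_assoc, ← mul_assoc (mapAlg (comulFst k A) F), mapAlg_mul_eq_one _ hT.mul_inv, one_mul,
      mapAlg_mul_eq_one _ hT.mul_inv]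
  · rw [hT.cocycle, mul_assoc, ← mul_assoc (mapAlg (legs23 k A) G),
      mapAlg_mul_eq_one _ hT.inv_mul, one_mul, mapAlg_mul_eq_one _ hT.inv_mul]

/-- The twisted coproduct. -/
def comul (hT : IsTwist F G) : A⟦X⟧ →ₐ[k] (A ⊗[k] A)⟦X⟧ :=
  conjAlg (Bialgebra.comulAlgHom k A) F G hT.mul_inv hT.inv_mul

theorem map_inv_eq_one {B : Type*} [Ring B] [Algebra k B] (hT : IsTwist F G)
    (φ : A ⊗[k] A →ₐ[k] B) (h1 : mapAlg φ G = 1) : mapAlg φ F = 1 := by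
  have := mapAlg_mul_eq_one φ hT.mul_inv
  rwa [h1, mul_one] at this

variable (hT : IsTwist F G)

theorem comul_apply (a : A⟦X⟧) :
    hT.comul a = F * mapAlg (Bialgebra.comulAlgHom k A) a * G := rfl

theorem comul_C (a : A) : hT.comul (C a) = F * C (Coalgebra.comul a) * G := by
  rw [comul_apply, mapAlg_C]
  rfl

/-- On a pure tensor `x ⊗ y` the factor `y` lies in the third leg and commutes with `G₁₂`, so the
conjugation defining the twisted coproduct of `x` extends over the whole expression. -/
theorem assoc_rTens_comul (z : (A ⊗[k] A)⟦X⟧) :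
    mapCoeff (TensorProduct.assoc k A A A).toLinearMap (rTens A hT.comul.toLinearMap z) =
      mapAlg (legs12 k A) F * mapAlg (comulFst k A) z * mapAlg (legs12 k A) G := by
  refine ((isXLinear_mapCoeff _).comp (isXLinear_rTens _)).ext_tmul
    (((isXLinear_mapAlg _).mul_left _).mul_right _) (fun x y => ?_) z
  have e : mapAlg (comulFst k A) (C (x ⊗ₜ y)) = mapAlg (legs12 k A) (C (Coalgebra.comul x)) *
      C ((1 : A) ⊗ₜ[k] ((1 : A) ⊗ₜ[k] y)) := by
    rw [mapAlg_C, mapAlg_C, ← map_mul]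
    congr 1
    change TensorProduct.assoc k A A A (Coalgebra.comul x ⊗ₜ y) = _
    generalize (Coalgebra.comul x : A ⊗[k] A) = w
    induction w using TensorProduct.induction_on with
    | zero => simp
    | tmul a b => simp [legs12]
    | add u v hu hv => rw [TensorProduct.add_tmul, map_add, map_add, add_mul, hu, hv]
  have hc : C ((1 : A) ⊗ₜ[k] ((1 : A) ⊗ₜ[k] y)) * mapAlg (legs12 k A) G =
      mapAlg (legs12 k A) G * C ((1 : A) ⊗ₜ[k] ((1 : A) ⊗ₜ[k] y)) := by
    refine ((isXLinear_mapAlg _).mul_left _).ext_tmul ((isXLinear_mapAlg _).mul_right _)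
      (fun a b => ?_) G
    rw [mapAlg_C, ← map_mul, ← map_mul]
    simp [legs12]
  rw [e, ← mul_assoc, mul_assoc _ _ (mapAlg (legs12 k A) G), hc, ← mul_assoc, ← map_mul, ← map_mul,
    ← comul_C]
  ext N
  rw [mapCoeff, coeff_mk, coeff_rTens_C, coeff_mul_C, LinearMap.rTensor_tmul]
  change TensorProduct.assoc k A A A (coeff N (hT.comul (C x)) ⊗ₜ y) =
    legs12 k A (coeff N (hT.comul (C x))) * _
  generalize coeff N (hT.comul (C x)) = w
  induction w using TensorProduct.induction_on with
  | zero => simp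
  | tmul a b => simp [legs12]
  | add u v hu hv => rw [TensorProduct.add_tmul, map_add, map_add, add_mul, hu, hv]

/-- The mirror image: `x` lies in the first leg and commutes with `F₂₃`. -/
theorem lTens_comul (z : (A ⊗[k] A)⟦X⟧) :
    lTens A hT.comul.toLinearMap z =
      mapAlg (legs23 k A) F * mapAlg (comulSnd k A) z * mapAlg (legs23 k A) G := by
  refine (isXLinear_lTens _).ext_tmul
    (((isXLinear_mapAlg _).mul_left _).mul_right _) (fun x y => ?_) z
  have e : mapAlg (comulSnd k A) (C (x ⊗ₜ y)) =
      C (x ⊗ₜ[k] ((1 : A) ⊗ₜ[k] (1 : A))) * mapAlg (legs23 k A) (C (Coalgebra.comul y)) := by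
    rw [mapAlg_C, mapAlg_C, ← map_mul, ← Algebra.TensorProduct.one_def]
    simp [comulSnd, legs23]
  have hc : mapAlg (legs23 k A) F * C (x ⊗ₜ[k] ((1 : A) ⊗ₜ[k] (1 : A))) =
      C (x ⊗ₜ[k] ((1 : A) ⊗ₜ[k] (1 : A))) * mapAlg (legs23 k A) F := by
    refine ((isXLinear_mapAlg _).mul_right _).ext_tmul ((isXLinear_mapAlg _).mul_left _)
      (fun a b => ?_) F
    rw [mapAlg_C, ← map_mul, ← map_mul]
    simp [legs23]
  rw [e, ← mul_assoc, hc, mul_assoc, mul_assoc, ← map_mul, ← map_mul, ← mul_assoc, ← comul_C]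
  ext N
  rw [coeff_lTens_C, coeff_C_mul, LinearMap.lTensor_tmul]
  change x ⊗ₜ coeff N (hT.comul (C y)) =
    x ⊗ₜ[k] ((1 : A) ⊗ₜ[k] (1 : A)) * legs23 k A (coeff N (hT.comul (C y)))
  rw [← Algebra.TensorProduct.one_def]
  simp [legs23]

/-- The two sides are the iterated untwisted coproduct, which is coassociative, conjugated by `F₁₂
(Δ ⊗ id)F` and by `F₂₃ (id ⊗ Δ)F`. The cocycle equation identifies these two. -/
theorem coassoc (a : A⟦X⟧) :
    mapCoeff (TensorProduct.assoc k A A A).toLinearMap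
        (rTens A hT.comul.toLinearMap (hT.comul a)) =
      lTens A hT.comul.toLinearMap (hT.comul a) := by
  have e : mapAlg (comulFst k A) (mapAlg (Bialgebra.comulAlgHom k A) a) =
      mapAlg (comulSnd k A) (mapAlg (Bialgebra.comulAlgHom k A) a) := by
    have h0 : (comulFst k A).comp (Bialgebra.comulAlgHom k A) =
        (comulSnd k A).comp (Bialgebra.comulAlgHom k A) :=
      AlgHom.ext fun x => Coalgebra.coassoc_apply x
    rw [mapAlg_comp, mapAlg_comp, h0]
  rw [assoc_rTens_comul, lTens_comul, comul_apply]
  simp only [map_mul, e]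
  rw [← mul_assoc, ← mul_assoc, ← mul_assoc, ← mul_assoc, hT.cocycle_inv, mul_assoc _ _
    (mapAlg (legs12 k A) G), hT.cocycle, ← mul_assoc]

theorem lid_rTens_counit (z : (A ⊗[k] A)⟦X⟧) :
    mapCoeff (TensorProduct.lid k A).toLinearMap
        (rTens A (mapAlg (Bialgebra.counitAlgHom k A)).toLinearMap z) =
      mapAlg (counitFst k A) z := by
  refine ((isXLinear_mapCoeff _).comp (isXLinear_rTens _)).ext_tmul
    (isXLinear_mapAlg _) (fun x y => ?_) z
  ext N
  rw [mapCoeff, coeff_mk, coeff_rTens_C, mapAlg_C, LinearMap.rTensor_tmul]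
  change TensorProduct.lid k A
    ((coeff N (mapAlg (Bialgebra.counitAlgHom k A) (C x))) ⊗ₜ y) = _
  rw [mapAlg_C, coeff_C, coeff_C]
  split_ifs
  · rfl
  · simp

theorem rid_lTens_counit (z : (A ⊗[k] A)⟦X⟧) :
    mapCoeff (TensorProduct.rid k A).toLinearMap
        (lTens A (mapAlg (Bialgebra.counitAlgHom k A)).toLinearMap z) =
      mapAlg (counitSnd k A) z := by
  refine ((isXLinear_mapCoeff _).comp (isXLinear_lTens _)).ext_tmul
    (isXLinear_mapAlg _) (fun x y => ?_) z
  ext N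
  rw [mapCoeff, coeff_mk, coeff_lTens_C, mapAlg_C, LinearMap.lTensor_tmul]
  change TensorProduct.rid k A
    (x ⊗ₜ (coeff N (mapAlg (Bialgebra.counitAlgHom k A) (C y)))) = _
  rw [mapAlg_C, coeff_C, coeff_C]
  split_ifs
  · rfl
  · simp

theorem counit_left (a : A⟦X⟧) :
    mapCoeff (TensorProduct.lid k A).toLinearMap
      (rTens A (mapAlg (Bialgebra.counitAlgHom k A)).toLinearMap (hT.comul a)) = a := by
  have e : (counitFst k A).comp (Bialgebra.comulAlgHom k A) = AlgHom.id k A := by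
    refine AlgHom.ext fun x => ?_
    change TensorProduct.lid k A (Coalgebra.counit.rTensor A (Coalgebra.comul x)) = x
    rw [Coalgebra.rTensor_counit_comul, TensorProduct.lid_tmul, one_smul]
  rw [lid_rTens_counit, comul_apply, map_mul, map_mul, hT.map_inv_eq_one _ hT.counit_fst,
    hT.counit_fst, mapAlg_comp, e, one_mul, mul_one]
  rfl

theorem counit_right (a : A⟦X⟧) :
    mapCoeff (TensorProduct.rid k A).toLinearMap
      (lTens A (mapAlg (Bialgebra.counitAlgHom k A)).toLinearMap (hT.comul a)) = a := by
  have e : (counitSnd k A).comp (Bialgebra.comulAlgHom k A) = AlgHom.id k A := by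
    refine AlgHom.ext fun x => ?_
    change TensorProduct.rid k A (Coalgebra.counit.lTensor A (Coalgebra.comul x)) = x
    rw [Coalgebra.lTensor_counit_comul, TensorProduct.rid_tmul, one_smul]
  rw [rid_lTens_counit, comul_apply, map_mul, map_mul, hT.map_inv_eq_one _ hT.counit_snd,
    hT.counit_snd, mapAlg_comp, e, one_mul, mul_one]
  rfl

theorem mul_rTens_antipode (u v : A⟦X⟧) (z : (A ⊗[k] A)⟦X⟧) :
    mapCoeff (LinearMap.mul' k A) (rTens A (conjAntipode k A u v) z) =
      u * bilin (antipodeActLeft k A) v z := by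
  refine ((isXLinear_mapCoeff _).comp (isXLinear_rTens _)).ext_tmul
    ((isXLinear_bilin_right _ _).mul_left _) (fun x y => ?_) z
  rw [bilin_antipodeActLeft_tmul, ← mul_assoc, ← mul_assoc, ← conjAntipode_C]
  ext N
  rw [mapCoeff, coeff_mk, coeff_rTens_C, LinearMap.rTensor_tmul, LinearMap.mul'_apply, coeff_mul_C]
  rfl

theorem mul_lTens_antipode (u v : A⟦X⟧) (z : (A ⊗[k] A)⟦X⟧) :
    mapCoeff (LinearMap.mul' k A) (lTens A (conjAntipode k A u v) z) =
      bilin (antipodeActRight k A) u z * v := by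
  refine ((isXLinear_mapCoeff _).comp (isXLinear_lTens _)).ext_tmul
    ((isXLinear_bilin_right _ _).mul_right _) (fun x y => ?_) z
  rw [bilin_antipodeActRight_tmul, mul_assoc, mul_assoc, ← mul_assoc u, ← conjAntipode_C]
  ext N
  rw [mapCoeff, coeff_mk, coeff_lTens_C, LinearMap.lTensor_tmul, LinearMap.mul'_apply, coeff_C_mul]
  rfl

/-- The topological Hopf algebra obtained from a Drinfeld twist. -/
def formalHopf : FormalHopf k A where
  comul := hT.comul
  counit := mapAlg (Bialgebra.counitAlgHom k A)
  antipode := conjAntipode k A (bilin (antipodeActRight k A) 1 F)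
    (bilin (antipodeActLeft k A) 1 G)
  comul_scalar c := by
    rw [comul_apply, mapAlg_scalar, ← scalar_mul_comm, mul_assoc, hT.mul_inv, mul_one]
  counit_scalar c := by
    rw [mapAlg_scalar]
    ext N
    simp [scalar]
  antipode_scalar c a := by
    have e : mapCoeff (HopfAlgebra.antipode k) (scalar k A c * a) =
        scalar k A c * mapCoeff (HopfAlgebra.antipode k) a := by
      revert c
      refine ((isXLinear_mapCoeff _).comp ((IsXLinear.map _).mul_right a)).ext
        ((IsXLinear.map _).mul_right _) fun r => ?_
      simp only [scalar, PowerSeries.map_C]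
      refine ((isXLinear_mapCoeff _).comp (IsXLinear.id.mul_left _)).ext
        ((isXLinear_mapCoeff _).mul_left _) (fun x => ?_) a
      rw [← map_mul, mapCoeff_C, mapCoeff_C, ← map_mul, ← Algebra.smul_def, map_smul,
        Algebra.smul_def]
    change _ * mapCoeff (HopfAlgebra.antipode k) (scalar k A c * a) * _ =
      _ * (_ * mapCoeff (HopfAlgebra.antipode k) a * _)
    rw [e, ← mul_assoc, ← scalar_mul_comm]
    simp only [mul_assoc]
  coassoc := hT.coassoc
  counit_left := hT.counit_left
  counit_right := hT.counit_right
  antipode_left a := by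
    -- `v` is `1` acted on by `G`. Acting by `F` returns `1`, then `Δ(a)` gives `ε(a)`, then `G`
    -- gives `ε(a) v`, and `u v = 1` finishes.
    rw [mul_rTens_antipode, comul_apply, bilin_antipodeActLeft_mul, bilin_antipodeActLeft_mul,
      ← bilin_antipodeActLeft_mul 1 G F, hT.inv_mul, bilin_antipodeActLeft_one_right,
      bilin_antipodeActLeft_comul, bilin_antipodeActLeft_scalar, ← mul_assoc, ← scalar_mul_comm,
      mul_assoc, hT.antipode, mul_one]
  antipode_right a := by
    -- Here `G` acts first and undoes the `F` inside `u`. Again `u v = 1` is the product needed,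
    -- never `v u = 1`.
    rw [mul_lTens_antipode, comul_apply, bilin_antipodeActRight_mul, bilin_antipodeActRight_mul,
      ← bilin_antipodeActRight_mul 1 G F, hT.inv_mul, bilin_antipodeActRight_one_right,
      bilin_antipodeActRight_comul, bilin_antipodeActRight_scalar, mul_assoc, hT.antipode, mul_one]

end IsTwist

end Twist

/-! ### Series identities for a pair with `[T, E] = E` -/

section Weights

variable {B : Type*} [Ring B] [Algebra ℂ B]

theorem weight_pow {τ ε : B} {c : ℂ} (h : τ * ε = ε * τ + c • ε) (l : ℕ) :
    τ * ε ^ l = ε ^ l * τ + ((l : ℂ) * c) • ε ^ l := by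
  induction l with
  | zero => simp
  | succ l ih =>
    rw [pow_succ, ← mul_assoc, ih, add_mul, mul_assoc, h, mul_add, smul_mul_assoc, mul_smul_comm,
      mul_assoc, add_assoc, ← add_smul]
    push_cast
    congr 2
    ring

theorem tSum_egf_right (a : ℕ → B) (b : ℕ → ℕ → B) :
    tSum (fun l => ((l.factorial : ℂ)⁻¹) • (egf (b l) * C (a l))) =
      egf fun N => ∑ x ∈ Finset.HasAntidiagonal.antidiagonal N,
        N.choose x.1 • (b x.1 x.2 * a x.1) := by
  have e := tSum_egf (fun _ => (1 : B)) fun l i => b l i * a l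
  simp only [map_one, one_mul] at e
  simp only [egf_mul_C]
  exact e

/-- The cocycle equation for `T₁ = T ⊗ 1 ⊗ 1`, `T₂ = 1 ⊗ T ⊗ 1`, `E₂ = 1 ⊗ E ⊗ 1`, `E₃ = 1 ⊗ 1 ⊗ E`.
Both sides are expanded in powers of `E₂` and compared term by term. -/
theorem negPow_cocycle {T₁ T₂ E₂ E₃ : B} (h12 : Commute T₁ T₂) (hT1E2 : Commute T₁ E₂)
    (hT1E3 : Commute T₁ E₃) (hT2E3 : Commute T₂ E₃) (hE : Commute E₂ E₃)
    (h : T₂ * E₂ = E₂ * T₂ + E₂) :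
    negPow (T₁ + T₂) E₃ * negPow T₁ E₂ = negPow T₁ (E₂ + E₃) * negPow T₂ E₃ := by
  have e : negPow T₁ E₂ = tSum fun l => ((l.factorial : ℂ)⁻¹) • C (rise T₁ 0 l * E₂ ^ l) := by
    have := negPow_add_right hT1E2 (Commute.zero_right E₂)
    rw [add_zero] at this
    rw [this]
    congr 1; funext l
    rw [negPow_zero_right, mul_one]
  rw [e, mul_tSum, negPow_add_right hT1E2 hE, tSum_mul]
  congr 1; funext l
  have hr : Commute (rise T₁ 0 l) T₂ := commute_rise h12 _ _
  -- The `l`-th Taylor coefficient commutes with `T₁` and has weight `l` under `T₂`. Moving it to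
  -- the left adds `l` to the exponent `T₁ + T₂`, which is the shift in the expansion around `E₃`.
  have hw : (T₁ + T₂) * (rise T₁ 0 l * E₂ ^ l) =
      (rise T₁ 0 l * E₂ ^ l) * (T₁ + T₂) + (l : ℂ) • (rise T₁ 0 l * E₂ ^ l) := by
    have h2 := weight_pow (c := 1) (by rw [h, one_smul]) l
    rw [mul_one] at h2
    have h1 : T₁ * (rise T₁ 0 l * E₂ ^ l) = rise T₁ 0 l * E₂ ^ l * T₁ :=
      ((commute_rise (Commute.refl T₁) 0 l).symm.mul_right (hT1E2.pow_right l)).eq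
    rw [add_mul, h1, ← mul_assoc T₂, ← hr.eq, mul_assoc (rise T₁ 0 l) T₂, h2, mul_add, mul_add,
      mul_smul_comm, ← mul_assoc, add_assoc]
  rw [mul_smul_comm, smul_mul_assoc, negPow_mul_C_of_weight hw
    ((commute_rise hT1E3 0 l).mul_left (hE.pow_left l)).symm, mul_assoc, ← negPow_add _ hT2E3,
    add_right_comm]
  exact h12.add_left (Algebra.commutes _ _)

/-- The inverse pair of series `∑_j E^j (T + 1) ⋯ (T + j) / j! t^j`,
`∑_j (-E)^j (T + 1 - r) ⋯ (T + j - r) / j! t^j`, up to `(1 - E t)^{-r}`. -/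
theorem egf_mul_egf_eq_negPow {T E : B} (h : T * E = E * T + E) (r : ℂ) :
    (egf fun j => E ^ j * rise T 1 j) * (egf fun j => (-E) ^ j * rise T (1 - r) j) =
      negPow (algebraMap ℂ B r) E := by
  rw [egf_mul_egf, negPow]
  congr 1; funext N
  have hneg : T * (-E) = (-E) * T + (1 : ℂ) • (-E) := by
    rw [mul_neg, h, one_smul, neg_mul, neg_add]
  -- Moving `(T + 1)^{<i>}` past `(-E)^{N-i}` gives `(T + 1 + N - i)^{<i>}`, which read backwards is
  -- `(-1)^i (-T - N)^{<i>}`. Its shift no longer depends on `i`, so Vandermonde applies and `T`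
  -- cancels.
  have key : ∀ x ∈ Finset.HasAntidiagonal.antidiagonal N,
      N.choose x.1 • (E ^ x.1 * rise T 1 x.1 * ((-E) ^ x.2 * rise T (1 - r) x.2)) =
        (-E) ^ N * (N.choose x.1 • (rise (-T) (-N) x.1 * rise T (1 - r) x.2)) := by
    intro x hx
    have hx := Finset.HasAntidiagonal.mem_antidiagonal.mp hx
    have h2 := weight_pow hneg x.2
    rw [mul_one] at h2
    have h3 := rise_neg T (1 + x.2) x.1
    rw [show (1 - (1 + (x.2 : ℂ)) - x.1) = -(N : ℂ) by rw [← hx]; push_cast; ring] at h3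
    rw [mul_smul_comm, h3, mul_assoc, ← mul_assoc (rise T 1 x.1), rise_mul_of_weight h2, ← hx,
      pow_add]
    congr 1
    rw [neg_pow E x.1, ← mul_assoc, ← mul_assoc, ← mul_assoc, ← mul_assoc,
      mul_assoc _ _ ((-1) ^ x.1), ((Commute.neg_one_left _).pow_left _ |>.symm.eq :
        (-E) ^ x.2 * (-1) ^ x.1 = (-1) ^ x.1 * (-E) ^ x.2), ← mul_assoc,
      mul_assoc _ _ ((-1 : B) ^ x.1), ((Commute.neg_one_left _).pow_left _ |>.symm.eq :
        E ^ x.1 * (-1) ^ x.1 = (-1) ^ x.1 * E ^ x.1), ← mul_assoc, ← pow_add,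
      Even.neg_one_pow ⟨x.1, rfl⟩, one_mul]
  rw [Finset.sum_congr rfl key, ← Finset.mul_sum,
    ← rise_add_add (Commute.refl T).neg_left, neg_add_cancel]
  -- The remaining scalar `(1 - r - N)^{<N>}` is reversed into `(-1)^N r^{<N>}`.
  have h4 := rise_neg (0 : B) r N
  rw [neg_zero, show 1 - r - (N : ℂ) = -N + (1 - r) by ring] at h4
  have h5 := rise_add_algebraMap (0 : B) 0 r N
  rw [zero_add, zero_add] at h5
  rw [h4, ← h5, rise_algebraMap, ← neg_one_smul_pow_mul, mul_smul_comm, ← Algebra.commutes,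
    ← Algebra.smul_def, ← Algebra.smul_def, neg_pow E, ← neg_one_smul_pow_mul (E ^ N), smul_smul,
    smul_smul]
  congr 1
  have e : ((-1 : ℂ) ^ N) * (-1) ^ N = 1 := by rw [← mul_pow]; simp
  linear_combination (rise r 0 N) * e

/-- The commutator with a fixed element. -/
def adBy (ε : B) : Module.End ℂ B := LinearMap.mulLeft ℂ ε - LinearMap.mulRight ℂ ε

theorem adBy_apply (ε y : B) : adBy ε y = ε * y - y * ε := rfl

/-- Right multiplication by `ε` is left multiplication minus `adBy ε`. These operators commute, so
the binomial theorem applies. -/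
theorem mul_pow_eq_sum (ε y : B) (N : ℕ) :
    y * ε ^ N = ∑ x ∈ Finset.HasAntidiagonal.antidiagonal N,
      N.choose x.1 • ((-1 : ℂ) ^ x.1 • (ε ^ x.2 * (adBy ε ^ x.1) y)) := by
  have hc : Commute (-adBy ε) (LinearMap.mulLeft ℂ ε) := by
    refine Commute.neg_left ((Commute.refl _).sub_left ?_)
    exact LinearMap.ext fun z => mul_assoc ε z ε
  have e : LinearMap.mulRight ℂ ε = -adBy ε + LinearMap.mulLeft ℂ ε := by
    rw [adBy]; abel
  have e2 := congrArg (fun φ : Module.End ℂ B => φ y) (congrArg (· ^ N) e)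
  simp only [hc.add_pow', LinearMap.pow_mulRight, LinearMap.mulRight_apply] at e2
  rw [e2, LinearMap.sum_apply]
  refine Finset.sum_congr rfl fun x _ => ?_
  rw [LinearMap.smul_apply]
  congr 1
  rw [(hc.pow_pow x.1 x.2).eq, Module.End.mul_apply, LinearMap.pow_mulLeft,
    LinearMap.mulLeft_apply, ← neg_one_smul ℂ (adBy ε), smul_pow, LinearMap.smul_apply,
    mul_smul_comm]

theorem adBy_pow_weight {T E y : B} {r : ℂ} (h : T * E = E * T + E) (hy : T * y = y * T + r • y)
    (l : ℕ) : T * (adBy E ^ l) y = (adBy E ^ l) y * T + (r + l) • (adBy E ^ l) y := by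
  induction l with
  | zero => simpa using hy
  | succ l ih =>
    rw [pow_succ', Module.End.mul_apply, adBy_apply]
    generalize (adBy E ^ l) y = z at ih
    have e1 : T * (E * z) = E * z * T + (r + l + 1) • (E * z) := by
      rw [← mul_assoc, h, add_mul, mul_assoc, ih, mul_add, mul_smul_comm, add_smul _ (1 : ℂ),
        one_smul, mul_assoc, add_assoc]
    have e2 : T * (z * E) = z * E * T + (r + l + 1) • (z * E) := by
      rw [← mul_assoc, ih, add_mul, mul_assoc, h, mul_add, smul_mul_assoc, add_smul _ (1 : ℂ),
        one_smul, mul_assoc, add_assoc, add_comm (z * E)]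
    rw [mul_sub, e1, e2, sub_mul, smul_sub]
    push_cast
    rw [← add_assoc]
    abel

/-- Reorders `y v` in `-u y v` so that a series in `T + 1 - r` comes first, where
`egf_mul_egf_eq_negPow` can absorb it into `u`. As `(ad E)^l(y)` has weight `r + l`, passing it
turns `1 - r` into `1 + l`, the tail of `T_1^{<l+i>}`. -/
theorem C_mul_egf_eq_tSum {T E y : B} {r : ℂ} (h : T * E = E * T + E)
    (hy : T * y = y * T + r • y) :
    C y * (egf fun j => (-E) ^ j * rise T 1 j) =
      tSum fun l => ((l.factorial : ℂ)⁻¹) •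
        ((egf fun j => (-E) ^ j * rise T (1 - r) j) * C ((adBy E ^ l) y * rise T 1 l)) := by
  rw [tSum_egf_right, C_mul_egf]
  congr 1; funext N
  rw [← mul_assoc, neg_pow, ← neg_one_smul_pow_mul, mul_smul_comm, mul_pow_eq_sum, smul_mul_assoc,
    Finset.sum_mul, Finset.smul_sum]
  refine Finset.sum_congr rfl fun x hx => ?_
  have hx := Finset.HasAntidiagonal.mem_antidiagonal.mp hx
  rw [smul_mul_assoc, smul_comm]
  congr 1
  have hw := rise_mul_of_weight (adBy_pow_weight h hy x.1) (1 - r) x.2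
  rw [show 1 - r + (r + (x.1 : ℂ)) = 1 + x.1 by ring] at hw
  rw [← hx, rise_add, smul_mul_assoc, smul_smul, mul_assoc ((-E) ^ x.2), ← mul_assoc (rise T _ _),
    hw, neg_pow E x.2, ← neg_one_smul_pow_mul (E ^ x.2), smul_mul_assoc, mul_assoc, mul_assoc,
    (commute_rise_rise (Commute.refl T) _ _ _ _).eq]
  have e : ((-1 : ℂ) ^ x.1) * (-1) ^ x.1 = 1 := by rw [← mul_pow]; simp
  rw [show (-1 : ℂ) ^ (x.1 + x.2) * (-1) ^ x.1 = (-1) ^ x.2 by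
    rw [pow_add]; linear_combination (-1) ^ x.2 * e]

end Weights

/-! ### The Jordanian twist -/

section Jordanian

variable {A : Type*} [Ring A] [HopfAlgebra ℂ A]

/-- Primitive elements of a Hopf algebra. -/
def IsPrimitive (y : A) : Prop := Coalgebra.comul (R := ℂ) y = y ⊗ₜ[ℂ] 1 + 1 ⊗ₜ[ℂ] y

theorem IsPrimitive.counit_eq_zero {y : A} (hy : IsPrimitive y) :
    Coalgebra.counit (R := ℂ) y = 0 := by
  have e := congrArg (TensorProduct.lid ℂ A) (Coalgebra.rTensor_counit_comul (R := ℂ) y)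
  rw [hy, map_add, LinearMap.rTensor_tmul, LinearMap.rTensor_tmul, map_add,
    TensorProduct.lid_tmul, TensorProduct.lid_tmul, TensorProduct.lid_tmul,
    Bialgebra.counit_one, one_smul, add_eq_right] at e
  -- So far `ε(y) • 1 = 0` in `A`; a second application of the counit makes this a scalar equation.
  have e2 := congrArg (Coalgebra.counit (R := ℂ)) e
  simpa using e2

theorem IsPrimitive.antipode_eq_neg {y : A} (hy : IsPrimitive y) :
    HopfAlgebra.antipode ℂ y = -y := by
  have e := HopfAlgebra.mul_antipode_rTensor_comul_apply (R := ℂ) y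
  rw [hy.counit_eq_zero, hy, map_add, LinearMap.rTensor_tmul, LinearMap.rTensor_tmul, map_add,
    LinearMap.mul'_apply, LinearMap.mul'_apply, HopfAlgebra.antipode_one, mul_one, one_mul,
    map_zero] at e
  exact eq_neg_of_add_eq_zero_left e

theorem antipode_pow (y : A) (j : ℕ) :
    HopfAlgebra.antipode ℂ (y ^ j) = (HopfAlgebra.antipode ℂ y) ^ j := by
  induction j with
  | zero => rw [pow_zero, pow_zero, HopfAlgebra.antipode_one]
  | succ j ih => rw [pow_succ, HopfAlgebra.antipode_mul_antidistrib, ih, pow_succ']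

theorem antipode_rise {T : A} (hT : IsPrimitive T) (j : ℕ) :
    HopfAlgebra.antipode ℂ (rise T 0 j) = rise (-T) 0 j := by
  induction j with
  | zero => exact HopfAlgebra.antipode_one
  | succ j ih =>
    have e : HopfAlgebra.antipode ℂ (algebraMap ℂ A (0 + j)) = algebraMap ℂ A (0 + j) := by
      rw [Algebra.algebraMap_eq_smul_one, map_smul, HopfAlgebra.antipode_one]
    rw [rise, HopfAlgebra.antipode_mul_antidistrib, ih, map_add, hT.antipode_eq_neg, e, rise]
    exact (commute_rise ((Commute.refl (-T)).add_right (Algebra.commutes _ _).symm) _ _).symm.eq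

/-- The twisting series `(1 - 1 ⊗ E t)^{T ⊗ 1}` of a pair `T, E`. -/
def jordanian (T E : A) : (A ⊗[ℂ] A)⟦X⟧ :=
  negPow (-(T ⊗ₜ[ℂ] (1 : A))) ((1 : A) ⊗ₜ[ℂ] E)

/-- The inverse `(1 - 1 ⊗ E t)^{-T ⊗ 1}` of the twisting series. -/
def jordanianInv (T E : A) : (A ⊗[ℂ] A)⟦X⟧ :=
  negPow (T ⊗ₜ[ℂ] (1 : A)) ((1 : A) ⊗ₜ[ℂ] E)

theorem commute_tmul (x y : A) : Commute (x ⊗ₜ[ℂ] (1 : A)) ((1 : A) ⊗ₜ[ℂ] y) := by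
  simp [Commute, SemiconjBy]

theorem rise_tmul_one (T : A) (a : ℂ) (j : ℕ) :
    rise (T ⊗ₜ[ℂ] (1 : A)) a j = rise T a j ⊗ₜ[ℂ] (1 : A) :=
  (map_rise (Algebra.TensorProduct.includeLeft : A →ₐ[ℂ] A ⊗[ℂ] A) T a j).symm

theorem bilin_one_left_egf {B D : Type*} [Ring B] [Algebra ℂ B] [Ring D] [Algebra ℂ D]
    (β : A →ₗ[ℂ] B →ₗ[ℂ] D) (p : ℕ → B) : bilin β 1 (egf p) = egf fun j => β 1 (p j) := by
  ext N
  rw [bilin, coeff_mk, Finset.sum_eq_single (0, N), coeff_egf, coeff_egf]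
  · simp
  · intro p hp hne
    have : p.1 ≠ 0 := fun h0 => hne (by
      have := Finset.HasAntidiagonal.mem_antidiagonal.mp hp
      ext <;> simp_all)
    rw [coeff_one, if_neg this, map_zero, LinearMap.zero_apply]
  · simp

/-- The origin of `T_1` in the antipode: `E^j` shifts `-T` by `-j`, and `(-T - j)^{<j>}` read
backwards is `(-1)^j (T + 1)^{<j>}`. -/
theorem rise_neg_mul_pow {T E : A} (h : T * E = E * T + E) (j : ℕ) :
    rise (-T) 0 j * E ^ j = (-E) ^ j * rise T 1 j := by
  have hw := weight_pow (c := 1) (by rw [h, one_smul]) j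
  rw [mul_one] at hw
  have hw2 : (-T) * E ^ j = E ^ j * (-T) + (-(j : ℂ)) • E ^ j := by
    rw [neg_mul, hw, mul_neg, neg_smul, neg_add]
  have e := rise_neg T 1 j
  rw [sub_self, zero_sub] at e
  rw [rise_mul_of_weight hw2, zero_add, e, neg_pow E, ← neg_one_smul_pow_mul,
    ← neg_one_smul_pow_mul, mul_smul_comm, smul_mul_assoc]

theorem bilin_antipodeActRight_jordanian {T E : A} (hE : IsPrimitive E)
    (h : T * E = E * T + E) :
    bilin (antipodeActRight ℂ A) 1 (jordanian T E) = egf fun j => E ^ j * rise T 1 j := by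
  rw [jordanian, negPow, bilin_one_left_egf]
  congr 1; funext j
  rw [← TensorProduct.neg_tmul, rise_tmul_one, Algebra.TensorProduct.tmul_pow, one_pow,
    Algebra.TensorProduct.tmul_mul_tmul, mul_one, one_mul, antipodeActRight_tmul, mul_one,
    antipode_pow, hE.antipode_eq_neg, neg_pow, ← neg_one_smul_pow_mul, mul_smul_comm,
    rise_neg_mul_pow h, neg_one_smul_pow_mul, ← mul_assoc,
    ← (Commute.neg_one_left (-E)).mul_pow, neg_one_mul, neg_neg]

theorem bilin_antipodeActLeft_jordanianInv {T E : A} (hT : IsPrimitive T)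
    (h : T * E = E * T + E) :
    bilin (antipodeActLeft ℂ A) 1 (jordanianInv T E) = egf fun j => (-E) ^ j * rise T 1 j := by
  rw [jordanianInv, negPow, bilin_one_left_egf]
  congr 1; funext j
  rw [rise_tmul_one, Algebra.TensorProduct.tmul_pow, one_pow,
    Algebra.TensorProduct.tmul_mul_tmul, mul_one, one_mul, antipodeActLeft_tmul, mul_one,
    antipode_rise hT, rise_neg_mul_pow h]

theorem isTwist_jordanian {T E : A} (hT : IsPrimitive T) (hE : IsPrimitive E)
    (h : T * E = E * T + E) : IsTwist (k := ℂ) (jordanian T E) (jordanianInv T E) where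
  mul_inv := by
    rw [jordanian, jordanianInv, ← negPow_add (Commute.refl _).neg_left (commute_tmul T E),
      neg_add_cancel, negPow_zero]
  inv_mul := by
    rw [jordanian, jordanianInv, ← negPow_add (Commute.refl _).neg_right
      (commute_tmul T E).neg_left, add_neg_cancel, negPow_zero]
  cocycle := by
    have hmap : ∀ φ : A ⊗[ℂ] A →ₐ[ℂ] A ⊗[ℂ] (A ⊗[ℂ] A), mapAlg φ (jordanianInv T E) =
        negPow (φ (T ⊗ₜ 1)) (φ (1 ⊗ₜ E)) := fun φ => map_negPow φ _ _
    have e1 : comulFst ℂ A (T ⊗ₜ 1) = T ⊗ₜ (1 ⊗ₜ 1) + 1 ⊗ₜ (T ⊗ₜ 1) := by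
      change TensorProduct.assoc ℂ A A A (Coalgebra.comul T ⊗ₜ 1) = _
      rw [hT, TensorProduct.add_tmul]
      rfl
    have e2 : comulFst ℂ A (1 ⊗ₜ E) = 1 ⊗ₜ (1 ⊗ₜ E) := by
      change TensorProduct.assoc ℂ A A A (Coalgebra.comul 1 ⊗ₜ E) = _
      rw [Bialgebra.comul_one]
      rfl
    have e3 : comulSnd ℂ A (T ⊗ₜ 1) = T ⊗ₜ (1 ⊗ₜ 1) := by
      change T ⊗ₜ (Coalgebra.comul 1) = _
      rw [Bialgebra.comul_one]
      rfl
    have e4 : comulSnd ℂ A (1 ⊗ₜ E) = 1 ⊗ₜ (E ⊗ₜ 1) + 1 ⊗ₜ (1 ⊗ₜ E) := by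
      change 1 ⊗ₜ (Coalgebra.comul E) = _
      rw [hE, TensorProduct.tmul_add]
    have e5 : legs12 ℂ A (T ⊗ₜ 1) = T ⊗ₜ (1 ⊗ₜ 1) := rfl
    have e6 : legs12 ℂ A (1 ⊗ₜ E) = 1 ⊗ₜ (E ⊗ₜ 1) := rfl
    have e7 : legs23 ℂ A (T ⊗ₜ 1) = 1 ⊗ₜ (T ⊗ₜ 1) := rfl
    have e8 : legs23 ℂ A (1 ⊗ₜ E) = 1 ⊗ₜ (1 ⊗ₜ E) := rfl
    rw [hmap, hmap, hmap, hmap, e1, e2, e3, e4, e5, e6, e7, e8]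
    refine negPow_cocycle ?_ ?_ ?_ ?_ ?_ ?_
    any_goals simp [Commute, SemiconjBy]
    rw [h, TensorProduct.add_tmul, TensorProduct.tmul_add]
  counit_fst := by
    have e : counitFst ℂ A (T ⊗ₜ 1) = 0 := by
      change TensorProduct.lid ℂ A (Coalgebra.counit T ⊗ₜ 1) = 0
      rw [hT.counit_eq_zero, TensorProduct.zero_tmul, map_zero]
    exact (map_negPow (counitFst ℂ A) _ _).trans (by rw [e, negPow_zero])
  counit_snd := by
    have e : counitSnd ℂ A (1 ⊗ₜ E) = 0 := by
      change TensorProduct.rid ℂ A (1 ⊗ₜ Coalgebra.counit E) = 0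
      rw [hE.counit_eq_zero, TensorProduct.tmul_zero, map_zero]
    exact (map_negPow (counitSnd ℂ A) _ _).trans (by rw [e, negPow_zero_right])
  antipode := by
    rw [bilin_antipodeActRight_jordanian hE h, bilin_antipodeActLeft_jordanianInv hT h]
    have e := egf_mul_egf_eq_negPow h 0
    rwa [map_zero, negPow_zero, sub_zero] at e

theorem tens_C_left (a : A) (v : A⟦X⟧) : tens ℂ (C a) v =
    C (a ⊗ₜ[ℂ] (1 : A)) * mapAlg (Algebra.TensorProduct.includeRight : A →ₐ[ℂ] A ⊗[ℂ] A) v := by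
  rw [tens, PowerSeries.map_C]
  rfl

theorem mapAlg_includeRight_oneSubPow (E : A) (r : ℂ) :
    mapAlg (Algebra.TensorProduct.includeRight : A →ₐ[ℂ] A ⊗[ℂ] A) (oneSubPow E r) =
      negPow (algebraMap ℂ _ (-r)) ((1 : A) ⊗ₜ[ℂ] E) := by
  rw [oneSubPow_eq_negPow]
  refine (map_negPow _ _ _).trans ?_
  rw [AlgHom.commutes]
  rfl

/-- Passing `y ⊗ 1` raises the exponent `T ⊗ 1` of `F` by `r`; after cancellation with `G` only the
scalar exponent `r` survives. -/
theorem jordanian_conj_left {T E y : A} {r : ℂ} (hy : T * y = y * T + r • y) :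
    jordanian T E * C (y ⊗ₜ[ℂ] (1 : A)) * jordanianInv T E = tens ℂ (C y) (oneSubPow E r) := by
  have hw : (-(T ⊗ₜ[ℂ] (1 : A))) * (y ⊗ₜ[ℂ] (1 : A)) =
      (y ⊗ₜ[ℂ] (1 : A)) * (-(T ⊗ₜ[ℂ] (1 : A))) + (-r) • (y ⊗ₜ[ℂ] (1 : A)) := by
    rw [neg_mul, mul_neg, Algebra.TensorProduct.tmul_mul_tmul, Algebra.TensorProduct.tmul_mul_tmul,
      hy, TensorProduct.add_tmul, neg_add, neg_smul, TensorProduct.smul_tmul', mul_one]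
  rw [jordanian, jordanianInv, negPow_mul_C_of_weight hw (commute_tmul y E).symm, mul_assoc,
    ← negPow_add _ (commute_tmul T E), neg_add_eq_sub, sub_add_cancel, tens_C_left,
    mapAlg_includeRight_oneSubPow]
  exact (Commute.refl _).neg_left.add_left (Algebra.commutes _ _)

/-- `1 ⊗ y` commutes with `T ⊗ 1` but not with the powers of `1 ⊗ E` in `G`. Passing them produces
`(ad E)^l(y)` next to the exponent `-(T + l)`, from which `F` removes `T`. No weight condition on
`y` is needed. -/
theorem jordanian_conj_right {T E y : A} :
    jordanian T E * C ((1 : A) ⊗ₜ[ℂ] y) * jordanianInv T E =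
      tSum fun l => ((-1) ^ l / (l.factorial : ℂ)) •
        tens ℂ (C (rise T 0 l)) (oneSubPow E (-(l : ℂ)) * C ((adBy E ^ l) y)) := by
  have e1 : C ((1 : A) ⊗ₜ[ℂ] y) * jordanianInv T E = tSum fun l => ((l.factorial : ℂ)⁻¹) •
      (C (rise (T ⊗ₜ[ℂ] (1 : A)) 0 l) *
        egf fun i => rise (T ⊗ₜ[ℂ] (1 : A)) l i * ((-1 : ℂ) ^ l •
          ((1 : A) ⊗ₜ[ℂ] E) ^ i * ((1 : A) ⊗ₜ[ℂ] (adBy E ^ l) y))) := by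
    rw [tSum_egf, jordanianInv, negPow, C_mul_egf]
    congr 1; funext N
    rw [← mul_assoc, ← (commute_rise (commute_tmul T y) 0 N).eq, mul_assoc,
      Algebra.TensorProduct.tmul_pow, Algebra.TensorProduct.tmul_mul_tmul, one_pow, one_mul,
      mul_pow_eq_sum, TensorProduct.tmul_sum, Finset.mul_sum]
    refine Finset.sum_congr rfl fun x hx => ?_
    have hx := Finset.HasAntidiagonal.mem_antidiagonal.mp hx
    rw [TensorProduct.tmul_smul, mul_smul_comm, ← hx, rise_add, zero_add,
      Algebra.TensorProduct.tmul_pow, one_pow, smul_mul_assoc,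
      Algebra.TensorProduct.tmul_mul_tmul, one_mul, TensorProduct.tmul_smul, mul_assoc]
  rw [mul_assoc, e1, mul_tSum]
  congr 1; funext l
  have hTT : (-(T ⊗ₜ[ℂ] (1 : A))) * rise (T ⊗ₜ[ℂ] (1 : A)) 0 l =
      rise (T ⊗ₜ[ℂ] (1 : A)) 0 l * (-(T ⊗ₜ[ℂ] (1 : A))) +
        (0 : ℂ) • rise (T ⊗ₜ[ℂ] (1 : A)) 0 l := by
    rw [zero_smul, add_zero]
    exact (commute_rise (Commute.refl _).neg_right 0 l).symm.eq
  have e2 : (egf fun i => rise (T ⊗ₜ[ℂ] (1 : A)) l i * ((-1 : ℂ) ^ l •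
      ((1 : A) ⊗ₜ[ℂ] E) ^ i * ((1 : A) ⊗ₜ[ℂ] (adBy E ^ l) y))) =
      ((-1 : ℂ) ^ l) • (negPow (T ⊗ₜ[ℂ] (1 : A) + algebraMap ℂ _ (l : ℂ)) ((1 : A) ⊗ₜ[ℂ] E) *
        C ((1 : A) ⊗ₜ[ℂ] (adBy E ^ l) y)) := by
    ext N
    rw [negPow, egf_mul_C, coeff_smul, coeff_egf, coeff_egf, rise_add_algebraMap, zero_add,
      smul_mul_assoc, mul_smul_comm, smul_comm, mul_assoc]
  have e3 : jordanian T E * C (rise (T ⊗ₜ[ℂ] (1 : A)) 0 l) =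
      C (rise (T ⊗ₜ[ℂ] (1 : A)) 0 l) * jordanian T E := by
    rw [jordanian, negPow_mul_C_of_weight hTT (commute_rise (commute_tmul T E) 0 l).symm, map_zero,
      add_zero]
  rw [mul_smul_comm, ← mul_assoc, e3, e2, mul_assoc, mul_smul_comm, mul_smul_comm, smul_smul,
    div_eq_inv_mul]
  congr 1
  rw [← mul_assoc (jordanian T E), jordanian, ← negPow_add, neg_add_cancel_left, tens_C_left,
    map_mul, mapAlg_includeRight_oneSubPow, neg_neg, mapAlg_C, rise_tmul_one]
  · rfl
  · exact (Commute.refl _).neg_left.add_right (Algebra.commutes _ _).symm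
  · exact (commute_tmul T E).add_left (Algebra.commutes _ _)

theorem formalHopf_jordanian_comul {T E y : A} {r : ℂ} (hT : IsPrimitive T) (hE : IsPrimitive E)
    (h : T * E = E * T + E) (hy : IsPrimitive y) (hw : T * y = y * T + r • y) :
    (isTwist_jordanian hT hE h).formalHopf.comul (C y) =
      tens ℂ (C y) (oneSubPow E r) + tSum fun l => ((-1) ^ l / (l.factorial : ℂ)) •
        tens ℂ (C (rise T 0 l)) (oneSubPow E (-(l : ℂ)) * C ((adBy E ^ l) y)) := by
  rw [← jordanian_conj_right, ← jordanian_conj_left hw]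
  refine ((isTwist_jordanian hT hE h).comul_C y).trans ?_
  rw [hy, map_add, mul_add, add_mul]

theorem formalHopf_jordanian_antipode {T E y : A} {r : ℂ} (hT : IsPrimitive T)
    (hE : IsPrimitive E) (h : T * E = E * T + E) (hy : IsPrimitive y)
    (hw : T * y = y * T + r • y) :
    (isTwist_jordanian hT hE h).formalHopf.antipode (C y) =
      -tSum fun l => ((l.factorial : ℂ)⁻¹) •
        (oneSubPow E (-r) * C ((adBy E ^ l) y) * C (rise T 1 l)) := by
  refine (conjAntipode_C _ _ y).trans ?_
  rw [bilin_antipodeActRight_jordanian hE h, bilin_antipodeActLeft_jordanianInv hT h,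
    hy.antipode_eq_neg, map_neg, mul_neg, neg_mul, mul_assoc, C_mul_egf_eq_tSum h hw, mul_tSum]
  congr 2; funext l
  rw [mul_smul_comm, ← mul_assoc, egf_mul_egf_eq_negPow h, oneSubPow_eq_negPow, neg_neg, map_mul,
    mul_assoc]

end Jordanian

/-! ### The Hopf algebra structure of an enveloping algebra -/

section Enveloping

attribute [local instance 100] LieRing.ofAssociativeRing

open UniversalEnvelopingAlgebra

/-- Makes the antipode axiom multiplicative: for an antihomomorphism the contribution of `w` ends up
innermost, where it is a central scalar. Hence the axiom need only be checked on generators. -/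
theorem mul_rTensor_mul_of_antihom {k A : Type*} [CommRing k] [Ring A] [Algebra k A]
    {S : A →ₗ[k] A} (hS : ∀ a b, S (a * b) = S b * S a) {w : A ⊗[k] A} {c : k}
    (hw : LinearMap.mul' k A (S.rTensor A w) = algebraMap k A c) (z : A ⊗[k] A) :
    LinearMap.mul' k A (S.rTensor A (w * z)) = c • LinearMap.mul' k A (S.rTensor A z) := by
  induction z using TensorProduct.induction_on with
  | zero => simp
  | tmul x y =>
    have e : LinearMap.mul' k A (S.rTensor A (w * x ⊗ₜ y)) =
        S x * LinearMap.mul' k A (S.rTensor A w) * y := by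
      clear hw
      induction w using TensorProduct.induction_on with
      | zero => simp
      | tmul a b => simp [hS, mul_assoc]
      | add u v hu hv => simp only [add_mul, map_add, mul_add, hu, hv]
    rw [e, hw, ← Algebra.commutes, mul_assoc, ← Algebra.smul_def]
    simp
  | add u v hu hv => simp only [mul_add, map_add, smul_add, hu, hv]

theorem mul_lTensor_mul_of_antihom {k A : Type*} [CommRing k] [Ring A] [Algebra k A]
    {S : A →ₗ[k] A} (hS : ∀ a b, S (a * b) = S b * S a) {z : A ⊗[k] A} {c : k}
    (hz : LinearMap.mul' k A (S.lTensor A z) = algebraMap k A c) (w : A ⊗[k] A) :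
    LinearMap.mul' k A (S.lTensor A (w * z)) = c • LinearMap.mul' k A (S.lTensor A w) := by
  induction w using TensorProduct.induction_on with
  | zero => simp
  | tmul x y =>
    have e : LinearMap.mul' k A (S.lTensor A (x ⊗ₜ y * z)) =
        x * LinearMap.mul' k A (S.lTensor A z) * S y := by
      clear hz
      induction z using TensorProduct.induction_on with
      | zero => simp
      | tmul a b => simp [hS, mul_assoc]
      | add u v hu hv => simp only [add_mul, map_add, mul_add, hu, hv]
    rw [e, hz, ← Algebra.commutes, mul_assoc, ← Algebra.smul_def]
    simp
  | add u v hu hv => simp only [add_mul, map_add, smul_add, hu, hv]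

variable (k L : Type*) [CommRing k] [LieRing L] [LieAlgebra k L]

variable {k L} in
/-- Induction principle for the universal enveloping algebra. -/
theorem enveloping_induction {p : UniversalEnvelopingAlgebra k L → Prop}
    (algebraMap : ∀ r, p (algebraMap k _ r)) (ι : ∀ x, p (ι k x))
    (mul : ∀ a b, p a → p b → p (a * b)) (add : ∀ a b, p a → p b → p (a + b))
    (a : UniversalEnvelopingAlgebra k L) : p a := by
  let K : Subalgebra k (UniversalEnvelopingAlgebra k L) :=
    { carrier := {a | p a}
      mul_mem' := fun {a b} ha hb => mul a b ha hb
      add_mem' := fun {a b} ha hb => add a b ha hb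
      algebraMap_mem' := algebraMap }
  let φ : L →ₗ⁅k⁆ K :=
    { toFun := fun x => ⟨UniversalEnvelopingAlgebra.ι k x, ι x⟩
      map_add' := fun x y => Subtype.ext (map_add _ x y)
      map_smul' := fun c x => Subtype.ext (map_smul _ c x)
      map_lie' := fun {x y} => Subtype.ext (LieHom.map_lie _ x y) }
  -- `K` contains the generators, so by the universal property the identity factors through `K`.
  have e : K.val.comp (lift k φ) = AlgHom.id k _ := by
    refine hom_ext k (LieHom.ext fun x => ?_)
    change ((lift k φ (UniversalEnvelopingAlgebra.ι k x) : K) : UniversalEnvelopingAlgebra k L) =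
      UniversalEnvelopingAlgebra.ι k x
    rw [lift_ι_apply]
    rfl
  have e2 := AlgHom.congr_fun e a
  rw [AlgHom.id_apply] at e2
  rw [← e2]
  exact (lift k φ a).2

variable {k L} in
theorem enveloping_algHom_ext {B : Type*} [Ring B] [Algebra k B]
    {φ ψ : UniversalEnvelopingAlgebra k L →ₐ[k] B} (hι : ∀ x, φ (ι k x) = ψ (ι k x)) : φ = ψ := by
  refine AlgHom.ext fun a => ?_
  induction a using enveloping_induction with
  | algebraMap r => rw [AlgHom.commutes, AlgHom.commutes]
  | ι x => exact hι x
  | mul a b ha hb => rw [map_mul, map_mul, ha, hb]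
  | add a b ha hb => rw [map_add, map_add, ha, hb]

/-- The coproduct of the universal enveloping algebra. -/
def envelopingComul : UniversalEnvelopingAlgebra k L →ₐ[k]
    UniversalEnvelopingAlgebra k L ⊗[k] UniversalEnvelopingAlgebra k L :=
  lift k
    { toFun := fun x => ι k x ⊗ₜ 1 + 1 ⊗ₜ ι k x
      map_add' := fun x y => by
        rw [map_add, TensorProduct.add_tmul, TensorProduct.tmul_add]; abel
      map_smul' := fun c x => by
        rw [map_smul, TensorProduct.tmul_smul, ← TensorProduct.smul_tmul', ← smul_add]; rfl
      map_lie' := fun {x y} => by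
        rw [LieHom.map_lie, LieRing.of_associative_ring_bracket,
          LieRing.of_associative_ring_bracket]
        simp only [add_mul, mul_add, Algebra.TensorProduct.tmul_mul_tmul, one_mul, mul_one,
          TensorProduct.sub_tmul, TensorProduct.tmul_sub]
        abel }

/-- The counit of the universal enveloping algebra. -/
def envelopingCounit : UniversalEnvelopingAlgebra k L →ₐ[k] k := lift k (0 : L →ₗ⁅k⁆ k)

/-- The antipode of the universal enveloping algebra, with values in the opposite algebra. -/
def envelopingAntipode : UniversalEnvelopingAlgebra k L →ₐ[k] (UniversalEnvelopingAlgebra k L)ᵐᵒᵖ :=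
  lift k
    { toFun := fun x => MulOpposite.op (-ι k x)
      map_add' := fun x y => by rw [map_add, neg_add, MulOpposite.op_add]
      map_smul' := fun c x => by rw [map_smul, ← smul_neg, MulOpposite.op_smul]; rfl
      map_lie' := fun {x y} => by
        rw [LieHom.map_lie, LieRing.of_associative_ring_bracket,
          LieRing.of_associative_ring_bracket, ← MulOpposite.op_mul, ← MulOpposite.op_mul,
          ← MulOpposite.op_sub]
        congr 1
        noncomm_ring }

variable {k L}

theorem envelopingComul_ι (x : L) :
    envelopingComul k L (ι k x) = ι k x ⊗ₜ 1 + 1 ⊗ₜ ι k x := lift_ι_apply _ _ _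

theorem envelopingCounit_ι (x : L) : envelopingCounit k L (ι k x) = 0 := lift_ι_apply _ _ _

theorem envelopingAntipode_ι (x : L) :
    envelopingAntipode k L (ι k x) = MulOpposite.op (-ι k x) := lift_ι_apply _ _ _

instance : Bialgebra k (UniversalEnvelopingAlgebra k L) :=
  Bialgebra.ofAlgHom (envelopingComul k L) (envelopingCounit k L)
    (by
      refine enveloping_algHom_ext fun x => ?_
      simp [-ι_apply, envelopingComul_ι, TensorProduct.add_tmul, TensorProduct.tmul_add, add_assoc,
        Algebra.TensorProduct.one_def])
    (by
      refine enveloping_algHom_ext fun x => ?_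
      simp [-ι_apply, envelopingComul_ι, envelopingCounit_ι])
    (by
      refine enveloping_algHom_ext fun x => ?_
      simp [-ι_apply, envelopingComul_ι, envelopingCounit_ι])

instance : HopfAlgebra k (UniversalEnvelopingAlgebra k L) :=
  let S : UniversalEnvelopingAlgebra k L →ₗ[k] UniversalEnvelopingAlgebra k L :=
    (MulOpposite.opLinearEquiv k).symm.toLinearMap ∘ₗ (envelopingAntipode k L).toLinearMap
  have hS : ∀ a b, S (a * b) = S b * S a := fun a b => by
    change MulOpposite.unop (envelopingAntipode k L (a * b)) = _
    rw [map_mul]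
    rfl
  have hS1 : S 1 = 1 := by
    change MulOpposite.unop (envelopingAntipode k L 1) = _
    rw [map_one]
    rfl
  have hι : ∀ x, S (ι k x) = -ι k x := fun x => by
    change MulOpposite.unop (envelopingAntipode k L (ι k x)) = _
    rw [envelopingAntipode_ι]
    rfl
  { antipode := S
    mul_antipode_rTensor_comul := by
      refine LinearMap.ext fun a => ?_
      change LinearMap.mul' k _ (S.rTensor _ (envelopingComul k L a)) =
        algebraMap k _ (envelopingCounit k L a)
      induction a using enveloping_induction with
      | algebraMap r =>
        rw [AlgHom.commutes, AlgHom.commutes, Algebra.algebraMap_eq_smul_one,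
          Algebra.TensorProduct.one_def, map_smul, map_smul, LinearMap.rTensor_tmul, hS1,
          LinearMap.mul'_apply, mul_one, ← Algebra.algebraMap_eq_smul_one]
        rfl
      | ι x =>
        rw [envelopingComul_ι, envelopingCounit_ι]
        simp [hS1, hι, -ι_apply]
      | mul a b ha hb =>
        rw [map_mul, mul_rTensor_mul_of_antihom hS ha, hb, map_mul, map_mul, Algebra.smul_def]
      | add a b ha hb => simp only [map_add, ha, hb]
    mul_antipode_lTensor_comul := by
      refine LinearMap.ext fun a => ?_
      change LinearMap.mul' k _ (S.lTensor _ (envelopingComul k L a)) =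
        algebraMap k _ (envelopingCounit k L a)
      induction a using enveloping_induction with
      | algebraMap r =>
        rw [AlgHom.commutes, AlgHom.commutes, Algebra.algebraMap_eq_smul_one,
          Algebra.TensorProduct.one_def, map_smul, map_smul, LinearMap.lTensor_tmul, hS1,
          LinearMap.mul'_apply, mul_one, ← Algebra.algebraMap_eq_smul_one]
        rfl
      | ι x =>
        rw [envelopingComul_ι, envelopingCounit_ι]
        simp [hS1, hι, -ι_apply]
      | mul a b ha hb =>
        rw [map_mul, mul_lTensor_mul_of_antihom hS hb, ha, map_mul, map_mul, Algebra.smul_def,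
          Algebra.commutes]
      | add a b ha hb => simp only [map_add, ha, hb] }

theorem isPrimitive_ι {L : Type*} [LieRing L] [LieAlgebra ℂ L] (x : L) :
    IsPrimitive (ι ℂ x) := envelopingComul_ι x

end Enveloping

/-! ### Brackets in the extended affine Lie algebra -/

section Brackets

attribute [local instance 100] LieRing.ofAssociativeRing

open QTorus

variable {q : ℂˣ}

theorem mono_mul_mono (m m' : Fin 2 → ℤ) :
    mono q m * mono q m' = qp q (m 1 * m' 0) • mono q (m + m') := mulLin_mono m m'

theorem deg_mono (a : Fin 2 → ℂ) (m : Fin 2 → ℤ) :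
    deg q a (mono q m) = (∑ i, a i * (m i : ℂ)) • mono q m := lin_mono _ _

theorem deg_one (a : Fin 2 → ℂ) : deg q a 1 = 0 := by
  rw [one_def, deg_mono]; simp

/-- The matrix part of an element of the extended affine Lie algebra. -/
def matrixPart (q : ℂˣ) : ESL q →ₗ[ℂ] Matrix (Fin 2) (Fin 2) (QTorus q) where
  toFun z := z.left.1
  map_add' _ _ := rfl
  map_smul' _ _ := rfl

/-- The degree derivation part of an element of the extended affine Lie algebra. -/
def degreePart (q : ℂˣ) : ESL q →ₗ[ℂ] (Fin 2 → ℂ) where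
  toFun z := z.right
  map_add' _ _ := rfl
  map_smul' _ _ := rfl

/-- Bracket formulas reduce to matrix identities this way, because the degree part of every bracket
vanishes. -/
theorem esl_ext {a b : ESL q} (h1 : matrixPart q a = matrixPart q b)
    (h2 : degreePart q a = degreePart q b) : a = b :=
  LieAlgebra.SemiDirectSum.ext (Subtype.ext h1) h2

theorem matrixPart_lie (a b : ESL q) : matrixPart q ⁅a, b⁆ =
    matrixPart q a * matrixPart q b - matrixPart q b * matrixPart q a +
      (matrixPart q b).map (deg q (degreePart q a)) -
      (matrixPart q a).map (deg q (degreePart q b)) := rfl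

theorem degreePart_lie (a b : ESL q) : degreePart q ⁅a, b⁆ = 0 :=
  funext fun _ => sub_eq_zero.mpr (mul_comm _ _)

theorem degreePart_e (m : Fin 2 → ℤ) : degreePart q (e q m) = 0 := rfl
theorem degreePart_f (m : Fin 2 → ℤ) : degreePart q (f q m) = 0 := rfl
theorem degreePart_d : degreePart q (d q) = 0 := rfl
theorem degreePart_dd (i : Fin 2) : degreePart q (dd q i) = Pi.single i 1 := rfl
theorem degreePart_g (m : Fin 2 → ℤ) : degreePart q (g q m) = 0 := by
  rw [g]; split_ifs <;> rfl
theorem degreePart_h (m : Fin 2 → ℤ) : degreePart q (h q m) = 0 := by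
  rw [h]; split_ifs <;> rfl

theorem matrixPart_e (m : Fin 2 → ℤ) : matrixPart q (e q m) = !![0, mono q m; 0, 0] := rfl
theorem matrixPart_f (m : Fin 2 → ℤ) : matrixPart q (f q m) = !![0, 0; mono q m, 0] := rfl
theorem matrixPart_d : matrixPart q (d q) = !![1, 0; 0, -1] := rfl
theorem matrixPart_dd (i : Fin 2) : matrixPart q (dd q i) = 0 := rfl
theorem matrixPart_g {m : Fin 2 → ℤ} (hm : m ≠ 0) :
    matrixPart q (g q m) = !![mono q m, 0; 0, 0] := by
  rw [g, dif_neg hm]; rfl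
theorem matrixPart_h {m : Fin 2 → ℤ} (hm : m ≠ 0) :
    matrixPart q (h q m) = !![0, 0; 0, mono q m] := by
  rw [h, dif_neg hm]; rfl

theorem g_zero : g q 0 = 0 := dif_pos rfl
theorem h_zero : h q 0 = 0 := dif_pos rfl

theorem map_deg_zero (A : Matrix (Fin 2) (Fin 2) (QTorus q)) : A.map (deg q 0) = 0 := by
  have e : deg q 0 = 0 := by
    have := deg_smul (q := q) 0 0
    rwa [zero_smul, zero_smul] at this
  rw [e]; rfl

theorem matrixPart_lie_of_degreePart_eq_zero {a b : ESL q} (ha : degreePart q a = 0)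
    (hb : degreePart q b = 0) : matrixPart q ⁅a, b⁆ =
      matrixPart q a * matrixPart q b - matrixPart q b * matrixPart q a := by
  rw [matrixPart_lie, ha, hb, map_deg_zero, map_deg_zero, add_zero, sub_zero]

theorem lie_f_f (n m : Fin 2 → ℤ) : ⁅f q n, f q m⁆ = 0 := by
  refine esl_ext ?_ (degreePart_lie _ _)
  rw [matrixPart_lie_of_degreePart_eq_zero (degreePart_f n) (degreePart_f m), map_zero,
    matrixPart_f, matrixPart_f]
  simp

theorem lie_f_g (n m : Fin 2 → ℤ) (hm : m ≠ 0) :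
    ⁅f q n, g q m⁆ = qp q (m 0 * n 1) • f q (m + n) := by
  refine esl_ext ?_ ?_
  · rw [matrixPart_lie_of_degreePart_eq_zero (degreePart_f n) (degreePart_g m), map_smul,
      matrixPart_f, matrixPart_f, matrixPart_g hm]
    simp [mono_mul_mono, add_comm n m, mul_comm (n 1)]
  · rw [degreePart_lie, map_smul, degreePart_f, smul_zero]

theorem lie_f_h (n m : Fin 2 → ℤ) (hm : m ≠ 0) :
    ⁅f q n, h q m⁆ = -(qp q (m 1 * n 0) • f q (m + n)) := by
  refine esl_ext ?_ ?_
  · rw [matrixPart_lie_of_degreePart_eq_zero (degreePart_f n) (degreePart_h m), map_neg, map_smul,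
      matrixPart_f, matrixPart_f, matrixPart_h hm]
    ext i j
    fin_cases i <;> fin_cases j <;> simp [mono_mul_mono]
  · rw [degreePart_lie, map_neg, map_smul, degreePart_f, smul_zero, neg_zero]

theorem lie_f_e (n m : Fin 2 → ℤ) (hm : m + n ≠ 0) :
    ⁅f q n, e q m⁆ = qp q (m 0 * n 1) • h q (m + n) - qp q (m 1 * n 0) • g q (m + n) := by
  refine esl_ext ?_ ?_
  · rw [matrixPart_lie_of_degreePart_eq_zero (degreePart_f n) (degreePart_e m), map_sub, map_smul,
      map_smul, matrixPart_f, matrixPart_e, matrixPart_h hm, matrixPart_g hm]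
    simp [mono_mul_mono, add_comm n m, mul_comm (n 1)]
  · rw [degreePart_lie, map_sub, map_smul, map_smul, degreePart_g, degreePart_h, smul_zero,
      smul_zero, sub_zero]

/-- The two diagonal entries are constants, which the convention `g_0 = h_0 = 0` would lose. They
have equal coefficients up to sign and so combine into a multiple of `d`. -/
theorem lie_f_e_neg (n : Fin 2 → ℤ) :
    ⁅f q n, e q (-n)⁆ = -(qp q (-(n 1 * n 0)) • d q) := by
  refine esl_ext ?_ ?_
  · rw [matrixPart_lie_of_degreePart_eq_zero (degreePart_f n) (degreePart_e _), map_neg, map_smul,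
      matrixPart_f, matrixPart_e, matrixPart_d]
    simp [mono_mul_mono, one_def]
  · rw [degreePart_lie, map_neg, map_smul, degreePart_d, smul_zero, neg_zero]

theorem lie_f_d (n : Fin 2 → ℤ) : ⁅f q n, d q⁆ = (2 : ℂ) • f q n := by
  refine esl_ext ?_ ?_
  · rw [matrixPart_lie_of_degreePart_eq_zero (degreePart_f n) degreePart_d, map_smul,
      matrixPart_f, matrixPart_d]
    ext i j
    fin_cases i <;> fin_cases j <;> simp [two_smul ℂ]
  · rw [degreePart_lie, map_smul, degreePart_f, smul_zero]

theorem lie_h_f (n m : Fin 2 → ℤ) (hn : n ≠ 0) :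
    ⁅h q n, f q m⁆ = qp q (n 1 * m 0) • f q (m + n) := by
  rw [← lie_skew, lie_f_h m n hn, neg_neg, add_comm]

theorem lie_h_e (n m : Fin 2 → ℤ) (hn : n ≠ 0) :
    ⁅h q n, e q m⁆ = -(qp q (n 0 * m 1) • e q (m + n)) := by
  refine esl_ext ?_ ?_
  · rw [matrixPart_lie_of_degreePart_eq_zero (degreePart_h n) (degreePart_e m), map_neg, map_smul,
      matrixPart_e, matrixPart_e, matrixPart_h hn]
    ext i j
    fin_cases i <;> fin_cases j <;> simp [mono_mul_mono, mul_comm (n 0)]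
  · rw [degreePart_lie, map_neg, map_smul, degreePart_e, smul_zero, neg_zero]

theorem lie_h_g (n m : Fin 2 → ℤ) (hn : n ≠ 0) (hm : m ≠ 0) : ⁅h q n, g q m⁆ = 0 := by
  refine esl_ext ?_ (degreePart_lie _ _)
  rw [matrixPart_lie_of_degreePart_eq_zero (degreePart_h n) (degreePart_g m), map_zero,
    matrixPart_g hm, matrixPart_h hn]
  ext i j
  fin_cases i <;> fin_cases j <;> simp

theorem lie_h_d (n : Fin 2 → ℤ) (hn : n ≠ 0) : ⁅h q n, d q⁆ = 0 := by
  refine esl_ext ?_ (degreePart_lie _ _)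
  rw [matrixPart_lie_of_degreePart_eq_zero (degreePart_h n) degreePart_d, map_zero,
    matrixPart_d, matrixPart_h hn]
  ext i j
  fin_cases i <;> fin_cases j <;> simp

/-- The coefficient vanishes at `m = 0` and at `m = -n`, so the convention `h_0 = 0` is harmless and
the formula can be iterated through index `0`. -/
theorem lie_h_h (n m : Fin 2 → ℤ) (hn : n ≠ 0) :
    ⁅h q n, h q m⁆ = (qp q (n 1 * m 0) - qp q (n 0 * m 1)) • h q (m + n) := by
  by_cases hm : m = 0
  · subst hm
    rw [h_zero, lie_zero]
    simp only [Pi.zero_apply, mul_zero, sub_self, zero_smul]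
  refine esl_ext ?_ ?_
  · rw [matrixPart_lie_of_degreePart_eq_zero (degreePart_h n) (degreePart_h m), map_smul,
      matrixPart_h hm, matrixPart_h hn]
    by_cases hmn : m + n = 0
    · have hm' : m = -n := eq_neg_of_add_eq_zero_left hmn
      rw [hmn, h_zero, map_zero, smul_zero, hm']
      ext i j
      fin_cases i <;> fin_cases j <;> simp [mono_mul_mono]
    · rw [matrixPart_h hmn]
      ext i j
      fin_cases i <;> fin_cases j <;>
        simp [mono_mul_mono, mul_comm (n 0), sub_smul, add_comm n m]
  · rw [degreePart_lie, map_smul, degreePart_h, smul_zero]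

/-- The degree derivation with coefficients `x`. -/
theorem degreePart_sum_dd (x : Fin 2 → ℂ) : degreePart q (∑ i, x i • dd q i) = x := by
  rw [map_sum]
  simp only [map_smul, degreePart_dd]
  funext i
  fin_cases i <;> simp

theorem matrixPart_sum_dd (x : Fin 2 → ℂ) : matrixPart q (∑ i, x i • dd q i) = 0 := by
  rw [map_sum]
  simp only [map_smul, matrixPart_dd, smul_zero, Finset.sum_const_zero]

theorem lie_sum_dd_d (x : Fin 2 → ℂ) : ⁅∑ i, x i • dd q i, d q⁆ = 0 := by
  refine esl_ext ?_ (degreePart_lie _ _)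
  rw [matrixPart_lie, degreePart_sum_dd, matrixPart_sum_dd, matrixPart_d, map_zero]
  ext i j
  fin_cases i <;> fin_cases j <;> simp [deg_one]

theorem lie_sum_dd_dd (x : Fin 2 → ℂ) (i : Fin 2) : ⁅∑ i, x i • dd q i, dd q i⁆ = 0 := by
  refine esl_ext ?_ (degreePart_lie _ _)
  rw [matrixPart_lie, matrixPart_sum_dd, matrixPart_dd, map_zero]
  ext i j
  simp

theorem lie_sum_dd_letter (x : Fin 2 → ℂ) (y : Letter) (m : Fin 2 → ℤ) :
    ⁅∑ i, x i • dd q i, y.elt q m⁆ = (∑ i, x i * (m i : ℂ)) • y.elt q m := by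
  cases y with
  | e =>
    refine esl_ext ?_ (by rw [degreePart_lie, map_smul, Letter.elt, degreePart_e, smul_zero])
    rw [matrixPart_lie, degreePart_sum_dd, matrixPart_sum_dd, map_smul, Letter.elt, matrixPart_e]
    ext i j
    fin_cases i <;> fin_cases j <;> simp [deg_mono]
  | f =>
    refine esl_ext ?_ (by rw [degreePart_lie, map_smul, Letter.elt, degreePart_f, smul_zero])
    rw [matrixPart_lie, degreePart_sum_dd, matrixPart_sum_dd, map_smul, Letter.elt, matrixPart_f]
    ext i j
    fin_cases i <;> fin_cases j <;> simp [deg_mono]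
  | g =>
    by_cases hm : m = 0
    · rw [Letter.elt, hm, g_zero, lie_zero, smul_zero]
    refine esl_ext ?_ (by rw [degreePart_lie, map_smul, Letter.elt, degreePart_g, smul_zero])
    rw [matrixPart_lie, degreePart_sum_dd, matrixPart_sum_dd, map_smul, Letter.elt, matrixPart_g hm]
    ext i j
    fin_cases i <;> fin_cases j <;> simp [deg_mono]
  | h =>
    by_cases hm : m = 0
    · rw [Letter.elt, hm, h_zero, lie_zero, smul_zero]
    refine esl_ext ?_ (by rw [degreePart_lie, map_smul, Letter.elt, degreePart_h, smul_zero])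
    rw [matrixPart_lie, degreePart_sum_dd, matrixPart_sum_dd, map_smul, Letter.elt, matrixPart_h hm]
    ext i j
    fin_cases i <;> fin_cases j <;> simp [deg_mono]

theorem lie_letter_dd (y : Letter) (m : Fin 2 → ℤ) (i : Fin 2) :
    ⁅y.elt q m, dd q i⁆ = (-(m i : ℂ)) • y.elt q m := by
  have e := lie_sum_dd_letter (q := q) (Pi.single i 1) y m
  have e1 : ∑ j, (Pi.single i 1 : Fin 2 → ℂ) j • dd q j = dd q i := by
    fin_cases i <;> simp
  have e2 : ∑ j, (Pi.single i 1 : Fin 2 → ℂ) j * (m j : ℂ) = m i := by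
    fin_cases i <;> simp
  rw [← lie_skew, ← e1, e, e2, neg_smul]

theorem lie_d_e (m : Fin 2 → ℤ) : ⁅d q, e q m⁆ = (2 : ℂ) • e q m := by
  refine esl_ext ?_ ?_
  · rw [matrixPart_lie_of_degreePart_eq_zero degreePart_d (degreePart_e m), map_smul,
      matrixPart_e, matrixPart_d]
    ext i j
    fin_cases i <;> fin_cases j <;> simp [two_smul ℂ]
  · rw [degreePart_lie, map_smul, degreePart_e, smul_zero]

theorem lie_d_f (m : Fin 2 → ℤ) : ⁅d q, f q m⁆ = (-2 : ℂ) • f q m := by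
  rw [← lie_skew, lie_f_d, neg_smul]

theorem lie_d_g (m : Fin 2 → ℤ) : ⁅d q, g q m⁆ = 0 := by
  by_cases hm : m = 0
  · rw [hm, g_zero, lie_zero]
  refine esl_ext ?_ (degreePart_lie _ _)
  rw [matrixPart_lie_of_degreePart_eq_zero degreePart_d (degreePart_g m), map_zero,
    matrixPart_d, matrixPart_g hm]
  ext i j
  fin_cases i <;> fin_cases j <;> simp

theorem lie_d_h (m : Fin 2 → ℤ) : ⁅d q, h q m⁆ = 0 := by
  by_cases hm : m = 0
  · rw [hm, h_zero, lie_zero]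
  rw [← lie_skew, lie_h_d m hm, neg_zero]

theorem lie_d_dd (i : Fin 2) : ⁅d q, dd q i⁆ = 0 := by
  have e := lie_sum_dd_d (q := q) (Pi.single i 1)
  have e1 : ∑ j, (Pi.single i 1 : Fin 2 → ℂ) j • dd q j = dd q i := by
    fin_cases i <;> simp
  rw [← lie_skew, ← e1, e, neg_zero]

theorem mono_ne_zero (m : Fin 2 → ℤ) : mono q m ≠ 0 :=
  Finsupp.single_ne_zero.mpr one_ne_zero

theorem f_ne_zero (n : Fin 2 → ℤ) : f q n ≠ 0 := fun h0 => by
  have e := congrArg (fun z => matrixPart q z 1 0) h0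
  exact mono_ne_zero n e

theorem h_ne_zero {n : Fin 2 → ℤ} (hn : n ≠ 0) : h q n ≠ 0 := fun h0 => by
  have e := congrArg (fun z => matrixPart q z 1 1) h0
  simp only [matrixPart_h hn] at e
  exact mono_ne_zero n e

end Brackets

/-! ### Twisting the enveloping algebra of the extended affine Lie algebra -/

section TwistedEnveloping

attribute [local instance 100] LieRing.ofAssociativeRing

variable {q : ℂˣ}

theorem toU_lie (a b : ESL q) : toU ⁅a, b⁆ = toU a * toU b - toU b * toU a :=
  LieHom.map_lie (UniversalEnvelopingAlgebra.ι ℂ) a b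

theorem toU_smul (c : ℂ) (a : ESL q) : toU (c • a) = c • toU a := map_smul _ c a

theorem toU_add (a b : ESL q) : toU (a + b) = toU a + toU b := map_add _ a b

theorem toU_zero : toU (0 : ESL q) = 0 := map_zero (UniversalEnvelopingAlgebra.ι ℂ)

theorem C_smul_eq (c : ℂ) (a : U q) : (C (c • a) : (U q)⟦X⟧) = c • C a := by
  ext N
  rw [coeff_smul, coeff_C, coeff_C]
  split_ifs
  · rfl
  · rw [smul_zero]

theorem emb_smul (c : ℂ) (a : ESL q) : emb (c • a) = c • emb a := by
  rw [emb, toU_smul, C_smul_eq, emb]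

theorem emb_add (a b : ESL q) : emb (a + b) = emb a + emb b := by
  rw [emb, toU_add, map_add, emb, emb]

theorem emb_neg (a : ESL q) : emb (-a) = -emb a := by
  rw [← neg_one_smul ℂ a, emb_smul, neg_one_smul]

theorem emb_sub (a b : ESL q) : emb (a - b) = emb a - emb b := by
  rw [sub_eq_add_neg, emb_add, emb_neg, sub_eq_add_neg]

theorem emb_zero : emb (0 : ESL q) = 0 := by
  rw [emb, toU_zero, map_zero]

theorem adBy_toU_pow (E y : ESL q) (l : ℕ) :
    (adBy (toU E) ^ l) (toU y) = toU (((LieAlgebra.ad ℂ (ESL q) E) ^ l) y) := by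
  induction l with
  | zero => rfl
  | succ l ih =>
    rw [pow_succ', Module.End.mul_apply, ih, pow_succ', Module.End.mul_apply, LieAlgebra.ad_apply,
      toU_lie, adBy_apply]

theorem C_rise (T : U q) (a : ℂ) (j : ℕ) : (C (rise T a j) : (U q)⟦X⟧) = rise (C T) a j := by
  induction j with
  | zero => exact map_one C
  | succ j ih => rw [rise, map_mul, ih, map_add, rise, PowerSeries.algebraMap_apply]

theorem rise_emb (T : ESL q) (a : ℂ) (j : ℕ) : rise (emb T) a j = C (rise (toU T) a j) :=
  (C_rise _ _ _).symm

theorem toU_mul_of_lie_eq_smul {T y : ESL q} {r : ℂ} (hy : ⁅T, y⁆ = r • y) :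
    toU T * toU y = toU y * toU T + r • toU y := by
  rw [← toU_smul, ← hy, toU_lie]; abel

/-- The adjoint representation as a representation of the enveloping algebra. -/
def adjointRep (q : ℂˣ) : U q →ₐ[ℂ] Module.End ℂ (ESL q) :=
  UniversalEnvelopingAlgebra.lift ℂ (LieAlgebra.ad ℂ (ESL q))

theorem adjointRep_toU (a b : ESL q) : adjointRep q (toU a) b = ⁅a, b⁆ := by
  rw [adjointRep, toU, UniversalEnvelopingAlgebra.lift_ι_apply, LieAlgebra.ad_apply]

/-- The adjoint representation detects `E`, since `ad E` sends `T` to `-E`. -/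
theorem toU_ne_zero {T E : ESL q} (h : ⁅T, E⁆ = E) (hE : E ≠ 0) : toU E ≠ 0 := fun h0 => by
  have e := adjointRep_toU E T
  rw [h0, map_zero, LinearMap.zero_apply, ← lie_skew, h] at e
  exact hE (neg_eq_zero.mp e.symm)

/-- Acting on `E` in the adjoint representation sends `T` to `E` and `E` to `0`. Applied to the
first leg and followed by a functional with value `1` at `E`, it leaves `E` on one side and `0` on
the other. -/
theorem tmul_toU_ne {T E : ESL q} (h : ⁅T, E⁆ = E) (hE : E ≠ 0) :
    toU T ⊗ₜ[ℂ] toU E ≠ toU E ⊗ₜ[ℂ] toU T := fun h0 => by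
  let φ : U q →ₗ[ℂ] ESL q := LinearMap.applyₗ E ∘ₗ (adjointRep q).toLinearMap
  have hT : φ (toU T) = E := (adjointRep_toU T E).trans h
  have hE0 : φ (toU E) = 0 := (adjointRep_toU E E).trans (lie_self E)
  obtain ⟨ψ, hψ⟩ := Module.Projective.exists_dual_eq_one ℂ hE
  have e := congrArg (fun w => TensorProduct.lid ℂ (U q) ((ψ ∘ₗ φ).rTensor (U q) w)) h0
  simp only [LinearMap.rTensor_tmul, LinearMap.comp_apply, hT, hE0, hψ, map_zero,
    TensorProduct.lid_tmul, one_smul, zero_smul] at e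
  exact toU_ne_zero h hE e

/-- `⊠` binds more weakly than `*`, so on the left the variable belongs to the second tensor factor.
-/
theorem ot_mul_X (u v : (U q)⟦X⟧) : u ⊠ v * X = (u ⊠ v) * X := by
  rw [ot, ot, tens, tens, map_mul, map_X, mul_assoc]

theorem ot_mul_X_pow (u v : (U q)⟦X⟧) (k : ℕ) : u ⊠ v * X ^ k = (u ⊠ v) * X ^ k := by
  rw [ot, ot, tens, tens, map_mul, map_pow, map_X, mul_assoc]

theorem ot_smul (c : ℂ) (u v : (U q)⟦X⟧) : u ⊠ (c • v) = c • (u ⊠ v) := by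
  have e : PowerSeries.map (Algebra.TensorProduct.includeRight :
      U q →ₐ[ℂ] U q ⊗[ℂ] U q).toRingHom (c • v) =
      c • PowerSeries.map (Algebra.TensorProduct.includeRight :
      U q →ₐ[ℂ] U q ⊗[ℂ] U q).toRingHom v := by
    ext N
    simp
  rw [ot, ot, tens, tens, e, mul_smul_comm]

theorem ot_sub (u v w : (U q)⟦X⟧) : u ⊠ (v - w) = u ⊠ v - u ⊠ w := by
  rw [ot, ot, ot, tens, tens, tens, map_sub, mul_sub]

theorem ot_zero (u : (U q)⟦X⟧) : u ⊠ 0 = 0 := by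
  rw [ot, tens, map_zero, mul_zero]

theorem ot_neg (u v : (U q)⟦X⟧) : u ⊠ (-v) = -(u ⊠ v) := by
  rw [ot, ot, tens, tens, map_neg, mul_neg]

theorem pw_zero (E : ESL q) : pw E 0 = 1 := by
  rw [pw, oneSubPow_eq_negPow, neg_zero, map_zero, negPow_zero]

/-- `(1 - E t)^{-1} E t = (1 - E t)^{-1} - 1`. -/
theorem pw_neg_one_mul (E : ESL q) : pw E (-1) * emb E * X = pw E (-1) - 1 := by
  have hc : ∀ j : ℕ, coeff j (pw E (-1)) = (toU E) ^ j := fun j => by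
    -- The factorial cancels the denominator, leaving the geometric series.
    have e : rise (1 : ℂ) 0 j = j.factorial := by
      induction j with
      | zero => simp [rise]
      | succ j ih => rw [rise, ih, Nat.factorial_succ]; simp; ring
    rw [pw, oneSubPow_eq_negPow, neg_neg, negPow, coeff_egf, rise_algebraMap, e,
      ← Algebra.smul_def, smul_smul, inv_mul_cancel₀ (by exact_mod_cast j.factorial_ne_zero),
      one_smul]
  ext N
  cases N with
  | zero => rw [coeff_zero_mul_X, map_sub, hc, pow_zero, coeff_zero_one, sub_self]
  | succ N =>
    rw [coeff_succ_mul_X, emb, coeff_mul_C, hc, map_sub, hc, coeff_one, if_neg N.succ_ne_zero,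
      sub_zero, pow_succ]

theorem tSum_eq_of_three {B : Type*} [Ring B] {F : ℕ → B⟦X⟧} (hF : ∀ j, F (j + 3) = 0) :
    tSum F = F 0 + F 1 * X + F 2 * X ^ 2 := by
  have h0 : tSum (fun j => F (j + 1 + 1 + 1)) = 0 := by
    ext N
    rw [tSum, coeff_mk]
    refine Finset.sum_eq_zero fun p _ => ?_
    rw [show F (p.1 + 1 + 1 + 1) = 0 from hF p.1, map_zero]
  rw [tSum_eq, tSum_eq fun j => F (j + 1), tSum_eq fun j => F (j + 1 + 1), h0, zero_mul, add_zero,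
    add_mul, mul_assoc, ← pow_two, add_assoc, add_assoc, zero_add, zero_add]

theorem pow_ad_add_three {E y z₁ z₂ : ESL q} (h1 : ⁅E, y⁆ = z₁) (h2 : ⁅E, z₁⁆ = z₂)
    (h3 : ⁅E, z₂⁆ = 0) (j : ℕ) : ((LieAlgebra.ad ℂ (ESL q) E) ^ (j + 3)) y = 0 := by
  rw [pow_add, Module.End.mul_apply]
  have e : ((LieAlgebra.ad ℂ (ESL q) E) ^ 3) y = 0 := by
    change ⁅E, ⁅E, ⁅E, y⁆⁆⁆ = 0
    rw [h1, h2, h3]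
  rw [e, map_zero]

theorem tSum_comul_eq {T E y z₁ z₂ : ESL q} (h1 : ⁅E, y⁆ = z₁) (h2 : ⁅E, z₁⁆ = z₂)
    (h3 : ⁅E, z₂⁆ = 0) :
    tSum (fun l => ((-1) ^ l / (l.factorial : ℂ)) •
      (rise (emb T) 0 l ⊠ pw E (-(l : ℂ)) * emb (((LieAlgebra.ad ℂ (ESL q) E) ^ l) y))) =
      1 ⊠ emb y - emb T ⊠ pw E (-1) * emb z₁ * X +
        (1 / 2 : ℂ) • (rise (emb T) 0 2 ⊠ pw E (-2) * emb z₂ * X ^ 2) := by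
  have e1 : ((LieAlgebra.ad ℂ (ESL q) E) ^ 1) y = z₁ := h1
  have e2 : ((LieAlgebra.ad ℂ (ESL q) E) ^ 2) y = z₂ := by
    change ⁅E, ⁅E, y⁆⁆ = z₂
    rw [h1, h2]
  rw [tSum_eq_of_three fun j => by
    rw [pow_ad_add_three h1 h2 h3, emb_zero, mul_zero, ot_zero, smul_zero], e1, e2, ot_mul_X, ot_mul_X_pow,
    ← smul_mul_assoc, pow_zero (LieAlgebra.ad ℂ (ESL q) E), Module.End.one_apply, rise_one, map_zero, add_zero, sub_eq_add_neg]
  congr 1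
  · congr 1
    · rw [Nat.factorial_zero, pow_zero, Nat.cast_one, div_one, one_smul, Nat.cast_zero, neg_zero,
        pw_zero, one_mul]
      rfl
    · rw [Nat.factorial_one, pow_one, Nat.cast_one, div_one, neg_one_smul, neg_mul]
  · norm_num

theorem tSum_antipode_eq {T E y z₁ z₂ : ESL q} {r : ℂ} (h1 : ⁅E, y⁆ = z₁) (h2 : ⁅E, z₁⁆ = z₂)
    (h3 : ⁅E, z₂⁆ = 0) :
    tSum (fun l => ((l.factorial : ℂ)⁻¹) •
      (pw E (-r) * emb (((LieAlgebra.ad ℂ (ESL q) E) ^ l) y) * rise (emb T) 1 l)) =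
      pw E (-r) * emb y + pw E (-r) * emb z₁ * rise (emb T) 1 1 * X +
        (1 / 2 : ℂ) • (pw E (-r) * emb z₂ * rise (emb T) 1 2 * X ^ 2) := by
  have e1 : ((LieAlgebra.ad ℂ (ESL q) E) ^ 1) y = z₁ := h1
  have e2 : ((LieAlgebra.ad ℂ (ESL q) E) ^ 2) y = z₂ := by
    change ⁅E, ⁅E, y⁆⁆ = z₂
    rw [h1, h2]
  rw [tSum_eq_of_three fun j => by
    rw [pow_ad_add_three h1 h2 h3, emb_zero, mul_zero, zero_mul, smul_zero], e1, e2, pow_zero,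
    Module.End.one_apply, ← smul_mul_assoc]
  congr 1
  · congr 1
    · rw [Nat.factorial_zero, Nat.cast_one, inv_one, one_smul, rise, mul_one]
    · rw [Nat.factorial_one, Nat.cast_one, inv_one, one_smul]
  · norm_num

/-- The Jordanian twist of the enveloping algebra by a pair with `[T, E] = E`: the coproduct and
the antipode of an eigenvector of `ad T`. -/
theorem exists_formalHopf {T E : ESL q} (h : ⁅T, E⁆ = E) (hE : E ≠ 0) :
    ∃ H : FormalHopf ℂ (U q), H.Noncommutative ∧ H.Noncocommutative ∧
      (∀ a, H.counit a = PowerSeries.map (counitU q).toRingHom a) ∧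
      ∀ (y : ESL q) (r : ℂ), ⁅T, y⁆ = r • y →
        H.comul (emb y) = emb y ⊠ pw E r + tSum (fun l => ((-1) ^ l / (l.factorial : ℂ)) •
          (rise (emb T) 0 l ⊠ pw E (-(l : ℂ)) * emb (((LieAlgebra.ad ℂ (ESL q) E) ^ l) y))) ∧
        H.antipode (emb y) = -tSum (fun l => ((l.factorial : ℂ)⁻¹) •
          (pw E (-r) * emb (((LieAlgebra.ad ℂ (ESL q) E) ^ l) y) * rise (emb T) 1 l)) := by
  have hTE : toU T * toU E = toU E * toU T + toU E := by
    have := toU_mul_of_lie_eq_smul (r := 1) (by rw [h, one_smul])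
    rwa [one_smul] at this
  have hp : ∀ z : ESL q, IsPrimitive (toU z) := isPrimitive_ι
  have hcomul : ∀ (y : ESL q) (r : ℂ), ⁅T, y⁆ = r • y →
      (isTwist_jordanian (hp T) (hp E) hTE).formalHopf.comul (emb y) = emb y ⊠ pw E r +
        tSum (fun l => ((-1) ^ l / (l.factorial : ℂ)) •
          (rise (emb T) 0 l ⊠ pw E (-(l : ℂ)) *
            emb (((LieAlgebra.ad ℂ (ESL q) E) ^ l) y))) := fun y r hy => by
    refine (formalHopf_jordanian_comul (hp T) (hp E) hTE (hp y)
      (toU_mul_of_lie_eq_smul hy)).trans ?_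
    congr 2; funext l
    rw [rise_emb, adBy_toU_pow]
    rfl
  refine ⟨(isTwist_jordanian (hp T) (hp E) hTE).formalHopf, ⟨emb T, emb E, fun h0 => ?_⟩,
    ⟨emb T, fun h0 => ?_⟩, fun a => rfl, fun y r hy => ⟨hcomul y r hy, ?_⟩⟩
  · rw [emb, emb, ← map_mul, ← map_mul, hTE] at h0
    have e := PowerSeries.C_injective h0
    rw [add_eq_left] at e
    exact toU_ne_zero h hE e
  -- Noncocommutativity is already visible at first order in `t` on `T` itself, because `[E, T] =
  -- -E`.
  · have hc : coeff 1 ((isTwist_jordanian (hp T) (hp E) hTE).formalHopf.comul (emb T)) =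
        toU T ⊗ₜ[ℂ] toU E := by
      have e1 : coeff 1 (pw E (-1)) = toU E := by
        rw [pw, oneSubPow, coeff_mk]; simp
      rw [hcomul T 0 (by rw [lie_self, zero_smul]), pw_zero,
        tSum_comul_eq (z₁ := -E) (z₂ := 0) (by rw [← lie_skew, h]) (by rw [lie_neg, lie_self, neg_zero])
          (lie_zero E), emb_neg, mul_neg, neg_mul, ot_neg, pw_neg_one_mul, ot_sub, emb_zero,
        mul_zero, zero_mul, ot_zero, smul_zero]
      simp only [map_add, map_sub, map_neg, map_zero]
      simp only [ot, emb, tens, PowerSeries.map_C, map_one, one_mul, mul_one, coeff_C, coeff_C_mul,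
        coeff_map, e1]
      simp
    have e := congrArg (coeff 1) h0
    rw [mapCoeff, coeff_mk, hc] at e
    exact tmul_toU_ne h hE e.symm
  · refine (formalHopf_jordanian_antipode (hp T) (hp E) hTE (hp y)
      (toU_mul_of_lie_eq_smul hy)).trans ?_
    congr 2; funext l
    rw [rise_emb, adBy_toU_pow]
    rfl

end TwistedEnveloping

/-! ### Explicit coproducts and antipodes for the chosen pairs -/

section TwistedFormulas

attribute [local instance 100] LieRing.ofAssociativeRing

variable {q : ℂˣ}

/-- The coproduct and the antipode of `H` on the eigenvectors of `ad T` are those of the Jordanian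
twist by the pair `T, E`. -/
def IsJordanian (H : FormalHopf ℂ (U q)) (T E : ESL q) : Prop :=
  ∀ (y : ESL q) (r : ℂ), ⁅T, y⁆ = r • y →
    H.comul (emb y) = emb y ⊠ pw E r + tSum (fun l => ((-1) ^ l / (l.factorial : ℂ)) •
      (rise (emb T) 0 l ⊠ pw E (-(l : ℂ)) * emb (((LieAlgebra.ad ℂ (ESL q) E) ^ l) y))) ∧
    H.antipode (emb y) = -tSum (fun l => ((l.factorial : ℂ)⁻¹) •
      (pw E (-r) * emb (((LieAlgebra.ad ℂ (ESL q) E) ^ l) y) * rise (emb T) 1 l))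

theorem tSum_neg {B : Type*} [Ring B] (F : ℕ → B⟦X⟧) : -tSum F = tSum fun j => -F j := by
  have e := mul_tSum F (-1)
  simpa only [neg_one_mul] using e

theorem qp_mul (a b : ℤ) : qp q a * qp q b = qp q (a + b) := by
  rw [qp, qp, qp, ← Units.val_mul, zpow_add]

/-- The sign is separated because the twist series carries its own `(-1)^j`; the two cancel and
leave exactly `η`. -/
theorem pow_ad_h {n : Fin 2 → ℤ} (hn : n ≠ 0) (y : Letter) (m : Fin 2 → ℤ) (hy : y.Index m)
    (j : ℕ) : ((LieAlgebra.ad ℂ (ESL q) (h q n)) ^ j) (y.elt q m) =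
      ((-1) ^ j * eta q n m y j) • y.elt q (m + j • n) := by
  have hs : ∀ j : ℕ, ((-1 : ℂ) ^ j) * (-1) ^ j = 1 := fun j => by rw [← mul_pow]; simp
  have hadd : ∀ j : ℕ, m + j • n + n = m + (j + 1) • n := fun j => by
    rw [add_smul, one_smul, add_assoc]
  have hcoord : ∀ (j : ℕ) (i : Fin 2), (m + j • n) i = m i + j * n i := fun j i => by simp
  induction j with
  | zero => cases y <;> simp only [eta, pow_zero, Finset.range_zero, Finset.prod_empty, mul_one,
      one_smul, zero_smul, add_zero, Module.End.one_apply]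
  | succ j ih =>
    rw [pow_succ', Module.End.mul_apply, ih, map_smul, LieAlgebra.ad_apply]
    cases y with
    | e =>
      rw [Letter.elt, lie_h_e _ _ hn, hadd, hcoord, eta, eta, Finset.prod_range_succ, pow_succ,
        ← neg_smul, smul_smul]
      congr 1
      ring
    | f =>
      rw [Letter.elt, lie_h_f _ _ hn, hadd, hcoord, smul_smul, eta, eta, Finset.prod_range_succ,
        ← mul_assoc, ← mul_assoc, hs, hs, one_mul, one_mul]
    | g =>
      rw [eta, mul_zero, zero_smul]
      -- For `g` the first bracket already vanishes; afterwards the inductive coefficient is zero.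
      cases j with
      | zero => rw [zero_smul, add_zero, Letter.elt, lie_h_g _ _ hn hy, smul_zero]
      | succ j => rw [eta, mul_zero, zero_smul]
    | h =>
      rw [Letter.elt, lie_h_h _ _ hn, hadd, hcoord, hcoord, smul_smul, eta, eta,
        Finset.prod_range_succ, ← mul_assoc, ← mul_assoc, hs, hs, one_mul, one_mul]

theorem lie_f_letter (n m : Fin 2 → ℤ) (y : Letter) (hye : y ≠ Letter.e) (hy : y.Index m) :
    ⁅f q n, y.elt q m⁆ = (-beta q n m y) • f q (m + n) := by
  cases y with
  | e => exact absurd rfl hye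
  | f => rw [Letter.elt, lie_f_f, beta, neg_zero, zero_smul]
  | g => rw [Letter.elt, lie_f_g _ _ hy, beta, neg_neg]
  | h => rw [Letter.elt, lie_f_h _ _ hy, beta, neg_smul]

/-- Both inner terms contribute `-s_m` times the same vector; the resulting `2` cancels the `1/2!`
of the series. -/
theorem lie_f_lie_f_e (n m : Fin 2 → ℤ) (hm : m + n ≠ 0) :
    ⁅f q n, qp q (m 0 * n 1) • h q (m + n) - qp q (m 1 * n 0) • g q (m + n)⁆ =
      (-2 * sCoef q n m) • f q (m + 2 • n) := by
  have e : m + n + n = m + 2 • n := by rw [two_smul, add_assoc]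
  rw [lie_sub, lie_smul, lie_smul, lie_f_h _ _ hm, lie_f_g _ _ hm, e, smul_neg, smul_smul,
    smul_smul, qp_mul, qp_mul, Pi.add_apply, Pi.add_apply, sCoef,
    show m 0 * n 1 + (m 1 + n 1) * n 0 = n 1 * m 0 + n 0 * m 1 + n 0 * n 1 by ring,
    show m 1 * n 0 + (m 0 + n 0) * n 1 = n 1 * m 0 + n 0 * m 1 + n 0 * n 1 by ring]
  module

theorem emb_mul_rise_one_one {T E : ESL q} (h : ⁅T, E⁆ = E) :
    emb E * rise (emb T) 1 1 = emb T * emb E := by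
  have e : toU T * toU E = toU E * toU T + toU E := by
    have := toU_mul_of_lie_eq_smul (r := 1) (by rw [h, one_smul])
    rwa [one_smul] at this
  rw [rise_one, map_one, mul_add, mul_one, emb, emb, ← map_mul, ← map_mul, e, map_add]

theorem commute_rise_emb {T y : ESL q} (h : ⁅T, y⁆ = 0) (a : ℂ) (j : ℕ) :
    Commute (rise (emb T) a j) (emb y) := by
  refine commute_rise ?_ a j
  have e := toU_mul_of_lie_eq_smul (r := 0) (by rw [h, zero_smul])
  rw [zero_smul, add_zero] at e
  rw [Commute, SemiconjBy, emb, emb, ← map_mul, ← map_mul, e]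

namespace IsJordanian

variable {H : FormalHopf ℂ (U q)} {T E : ESL q} (hH : IsJordanian H T E)

include hH

theorem comul_of_three {y z₁ z₂ : ESL q} {r : ℂ} (hy : ⁅T, y⁆ = r • y) (h1 : ⁅E, y⁆ = z₁)
    (h2 : ⁅E, z₁⁆ = z₂) (h3 : ⁅E, z₂⁆ = 0) :
    H.comul (emb y) = emb y ⊠ pw E r + (1 ⊠ emb y - emb T ⊠ pw E (-1) * emb z₁ * X +
        (1 / 2 : ℂ) • (rise (emb T) 0 2 ⊠ pw E (-2) * emb z₂ * X ^ 2)) := by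
  rw [(hH y r hy).1, tSum_comul_eq h1 h2 h3]

theorem antipode_of_three {y z₁ z₂ : ESL q} {r : ℂ} (hy : ⁅T, y⁆ = r • y) (h1 : ⁅E, y⁆ = z₁)
    (h2 : ⁅E, z₁⁆ = z₂) (h3 : ⁅E, z₂⁆ = 0) :
    H.antipode (emb y) = -(pw E (-r) * emb y + pw E (-r) * emb z₁ * rise (emb T) 1 1 * X +
        (1 / 2 : ℂ) • (pw E (-r) * emb z₂ * rise (emb T) 1 2 * X ^ 2)) := by
  rw [(hH y r hy).2, tSum_antipode_eq h1 h2 h3]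

theorem comul_of_two {y z : ESL q} {r : ℂ} (hy : ⁅T, y⁆ = r • y) (h1 : ⁅E, y⁆ = z)
    (h2 : ⁅E, z⁆ = 0) :
    H.comul (emb y) = emb y ⊠ pw E r + 1 ⊠ emb y - emb T ⊠ pw E (-1) * emb z * X := by
  rw [hH.comul_of_three hy h1 h2 (lie_zero E), emb_zero, mul_zero, zero_mul, ot_zero, smul_zero,
    add_zero, add_sub_assoc]

theorem antipode_of_two {y z : ESL q} {r : ℂ} (hy : ⁅T, y⁆ = r • y) (h1 : ⁅E, y⁆ = z)
    (h2 : ⁅E, z⁆ = 0) :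
    H.antipode (emb y) = -(pw E (-r) * emb y) - pw E (-r) * emb z * rise (emb T) 1 1 * X := by
  rw [hH.antipode_of_three hy h1 h2 (lie_zero E), emb_zero, mul_zero, zero_mul, zero_mul, smul_zero,
    add_zero, neg_add, sub_eq_add_neg]

/-- `pw_neg_one_mul` trades `(1 - E t)^{-1} E t` for `(1 - E t)^{-1} - 1`, which accounts for the
two separate terms in `T`. -/
theorem comul_derivation {y : ESL q} {c : ℂ} (hy : ⁅T, y⁆ = 0) (h1 : ⁅E, y⁆ = (-c) • E) :
    H.comul (emb y) =
      emb y ⊠ 1 + 1 ⊠ emb y - c • (emb T ⊠ 1) + c • (emb T ⊠ pw E (-1)) := by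
  rw [hH.comul_of_two (r := 0) (by rw [hy, zero_smul]) h1 (by rw [lie_smul, lie_self, smul_zero]),
    pw_zero, emb_smul, mul_smul_comm, smul_mul_assoc, pw_neg_one_mul, ot_smul, ot_sub]
  module

theorem antipode_derivation {y : ESL q} {c : ℂ} (h : ⁅T, E⁆ = E) (hy : ⁅T, y⁆ = 0)
    (h1 : ⁅E, y⁆ = (-c) • E) :
    H.antipode (emb y) = -emb y + c • (emb T * emb E * X) := by
  rw [hH.antipode_of_two (r := 0) (by rw [hy, zero_smul]) h1
    (by rw [lie_smul, lie_self, smul_zero]), neg_zero, pw_zero, one_mul, one_mul, emb_smul,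
    smul_mul_assoc, emb_mul_rise_one_one h, smul_mul_assoc]
  module

theorem comul_cartan {y : ESL q} (hy : ⁅T, y⁆ = 0) (h1 : ⁅E, y⁆ = (2 : ℂ) • E) :
    H.comul (emb y) =
      emb y ⊠ 1 + 1 ⊠ emb y - (2 : ℂ) • (emb T ⊠ pw E (-1) * emb E * X) := by
  rw [hH.comul_of_two (r := 0) (by rw [hy, zero_smul]) h1 (by rw [lie_smul, lie_self, smul_zero]),
    pw_zero, emb_smul, mul_smul_comm, smul_mul_assoc, ot_smul]

theorem antipode_cartan {y : ESL q} (hy : ⁅T, y⁆ = 0) (h1 : ⁅E, y⁆ = (2 : ℂ) • E) :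
    H.antipode (emb y) = -emb y - (2 : ℂ) • (emb E * rise (emb T) 1 1 * X) := by
  rw [hH.antipode_of_two (r := 0) (by rw [hy, zero_smul]) h1
    (by rw [lie_smul, lie_self, smul_zero]), neg_zero, pw_zero, one_mul, one_mul, emb_smul,
    smul_mul_assoc, smul_mul_assoc]

end IsJordanian

/-! ### Twists with `E = f_n`, for any admissible `T` -/

section LoweringTwist

variable {H : FormalHopf ℂ (U q)} {T : ESL q} {n : Fin 2 → ℤ} (hH : IsJordanian H T (f q n))

include hH

theorem comul_letter_lowering {y : Letter} {m : Fin 2 → ℤ} {r : ℂ} (hye : y ≠ Letter.e)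
    (hy : y.Index m) (hr : ⁅T, y.elt q m⁆ = r • y.elt q m) :
    H.comul (emb (y.elt q m)) =
      emb (y.elt q m) ⊠ pw (f q n) r + 1 ⊠ emb (y.elt q m)
        + beta q n m y • (emb T ⊠ pw (f q n) (-1) * emb (f q (m + n)) * X) := by
  rw [hH.comul_of_two hr (lie_f_letter n m y hye hy) (by rw [lie_smul, lie_f_f, smul_zero]),
    emb_smul, mul_smul_comm, smul_mul_assoc, ot_smul]
  module

theorem antipode_letter_lowering {y : Letter} {m : Fin 2 → ℤ} {r : ℂ} (hye : y ≠ Letter.e)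
    (hy : y.Index m) (hr : ⁅T, y.elt q m⁆ = r • y.elt q m) :
    H.antipode (emb (y.elt q m)) = -(pw (f q n) (-r) * emb (y.elt q m))
      + beta q n m y • (pw (f q n) (-r) * emb (f q (m + n)) * rise (emb T) 1 1 * X) := by
  rw [hH.antipode_of_two hr (lie_f_letter n m y hye hy) (by rw [lie_smul, lie_f_f, smul_zero]),
    emb_smul, mul_smul_comm, smul_mul_assoc, smul_mul_assoc]
  module

theorem comul_e_lowering {m : Fin 2 → ℤ} {r : ℂ} (hm : m + n ≠ 0)
    (hr : ⁅T, e q m⁆ = r • e q m) :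
    H.comul (emb (e q m)) =
      qp q (m 1 * n 0) • (emb T ⊠ pw (f q n) (-1) * emb (g q (m + n)) * X)
        - qp q (m 0 * n 1) • (emb T ⊠ pw (f q n) (-1) * emb (h q (m + n)) * X)
        + emb (e q m) ⊠ pw (f q n) r + 1 ⊠ emb (e q m)
        - sCoef q n m • (rise (emb T) 0 2 ⊠
          pw (f q n) (-2) * emb (f q (m + 2 • n)) * X ^ 2) := by
  rw [hH.comul_of_three hr (lie_f_e n m hm) (lie_f_lie_f_e n m hm)
    (by rw [lie_smul, lie_f_f, smul_zero])]
  simp only [emb_smul, emb_sub, mul_smul_comm, smul_mul_assoc, mul_sub, sub_mul, ot_smul, ot_sub]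
  module

theorem antipode_e_lowering {m : Fin 2 → ℤ} {r : ℂ} (hm : m + n ≠ 0)
    (hr : ⁅T, e q m⁆ = r • e q m) :
    H.antipode (emb (e q m)) =
      qp q (m 1 * n 0) • (pw (f q n) (-r) * emb (g q (m + n)) * rise (emb T) 1 1 * X)
        - qp q (m 0 * n 1) • (pw (f q n) (-r) * emb (h q (m + n)) * rise (emb T) 1 1 * X)
        - pw (f q n) (-r) * emb (e q m)
        + sCoef q n m • (pw (f q n) (-r) * emb (f q (m + 2 • n)) *
          rise (emb T) 1 2 * X ^ 2) := by
  rw [hH.antipode_of_three hr (lie_f_e n m hm) (lie_f_lie_f_e n m hm)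
    (by rw [lie_smul, lie_f_f, smul_zero])]
  simp only [emb_smul, emb_sub, mul_smul_comm, smul_mul_assoc, mul_sub, sub_mul]
  module

theorem comul_e_neg_lowering (hr : ⁅T, e q (-n)⁆ = (-1 : ℂ) • e q (-n)) :
    H.comul (emb (e q (-n))) =
      emb (e q (-n)) ⊠ pw (f q n) (-1) + 1 ⊠ emb (e q (-n))
        + qp q (-(n 1 * n 0)) • (emb T ⊠ pw (f q n) (-1) * emb (d q) * X)
        - qp q (-(n 0 * n 1)) • (rise (emb T) 0 2 ⊠
          pw (f q n) (-2) * emb (f q n) * X ^ 2) := by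
  rw [hH.comul_of_three hr (lie_f_e_neg n) (by rw [lie_neg, lie_smul, lie_f_d, smul_smul])
    (by rw [lie_neg, lie_smul, lie_self, smul_zero, neg_zero]), mul_comm (n 0)]
  simp only [emb_smul, emb_neg, mul_smul_comm, smul_mul_assoc, mul_neg, neg_mul, ot_smul, ot_neg]
  module

theorem antipode_e_neg_lowering (hr : ⁅T, e q (-n)⁆ = (-1 : ℂ) • e q (-n)) :
    H.antipode (emb (e q (-n))) =
      qp q (-(n 0 * n 1)) • (pw (f q n) 1 * emb (f q n) * rise (emb T) 1 2 * X ^ 2)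
        - pw (f q n) 1 * emb (e q (-n))
        + qp q (-(n 0 * n 1)) • (pw (f q n) 1 * emb (d q) * rise (emb T) 1 1 * X) := by
  rw [hH.antipode_of_three hr (lie_f_e_neg n) (by rw [lie_neg, lie_smul, lie_f_d, smul_smul])
    (by rw [lie_neg, lie_smul, lie_self, smul_zero, neg_zero]), mul_comm (n 0), neg_neg]
  simp only [emb_smul, emb_neg, mul_smul_comm, smul_mul_assoc, mul_neg, neg_mul]
  module

end LoweringTwist

theorem deltaF_g : deltaF Letter.g = 0 := rfl

theorem deltaF_h : deltaF Letter.h = 0 := rfl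

theorem lie_half_d_letter (y : Letter) (hye : y ≠ Letter.e) (m : Fin 2 → ℤ) :
    ⁅(-(1 / 2) : ℂ) • d q, y.elt q m⁆ = deltaF y • y.elt q m := by
  cases y with
  | e => exact absurd rfl hye
  | f =>
    rw [Letter.elt, smul_lie, lie_d_f, smul_smul, deltaF]
    norm_num
  | g => rw [Letter.elt, smul_lie, lie_d_g, smul_zero, deltaF_g, zero_smul]
  | h => rw [Letter.elt, smul_lie, lie_d_h, smul_zero, deltaF_h, zero_smul]

theorem lie_half_d_e (m : Fin 2 → ℤ) : ⁅(-(1 / 2) : ℂ) • d q, e q m⁆ = (-1 : ℂ) • e q m := by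
  rw [smul_lie, lie_d_e, smul_smul]
  norm_num

end TwistedFormulas

end EALA

end

/-! ### The three families of Hopf algebra structures -/

open EALA
theorem corollary1p2 (q : ℂˣ) :
    -- `T = x₁ d₁ + x₂ d₂`, `E = h_n`
    (∀ (n : Fin 2 → ℤ) (x : Fin 2 → ℂ) (T E : ESL q), n ≠ 0 →
      T = ∑ i, x i • dd q i → E = h q n → ⁅T, E⁆ = E →
      ∃ H : FormalHopf ℂ (U q),
        H.Noncommutative ∧ H.Noncocommutative ∧
        (∀ a, H.counit a = PowerSeries.map (counitU q).toRingHom a) ∧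
        (∀ (y : Letter) (m : Fin 2 → ℤ) (r : ℂ), y.Index m → r = ∑ i, x i * (m i : ℂ) →
          H.comul (emb (y.elt q m)) =
            emb (y.elt q m) ⊠ pw E r +
              tSum (fun j => (eta q n m y j / (j.factorial : ℂ)) •
                (rise (emb T) 0 j ⊠
                  pw E (-(j : ℂ)) * emb (y.elt q (m + j • n)))) ∧
          H.antipode (emb (y.elt q m)) =
            tSum (fun j => ((-1) ^ (j + 1) * eta q n m y j / (j.factorial : ℂ)) •
              (pw E (-r) * emb (y.elt q (m + j • n)) *
                rise (emb T) 1 j))) ∧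
        (∀ i : Fin 2,
          H.comul (emb (dd q i)) =
            emb (dd q i) ⊠ 1 + 1 ⊠ emb (dd q i)
              - (n i : ℂ) • (emb T ⊠ 1) + (n i : ℂ) • (emb T ⊠ pw E (-1)) ∧
          H.antipode (emb (dd q i)) =
            -emb (dd q i) + (n i : ℂ) • (emb T * emb E * X)) ∧
        H.comul (emb (d q)) = emb (d q) ⊠ 1 + 1 ⊠ emb (d q) ∧
        H.antipode (emb (d q)) = -emb (d q)) ∧
    -- `T = x₁ d₁ + x₂ d₂`, `E = f_n`
    (∀ (n : Fin 2 → ℤ) (x : Fin 2 → ℂ) (T E : ESL q),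
      T = ∑ i, x i • dd q i → E = f q n → ⁅T, E⁆ = E →
      ∃ H : FormalHopf ℂ (U q),
        H.Noncommutative ∧ H.Noncocommutative ∧
        (∀ a, H.counit a = PowerSeries.map (counitU q).toRingHom a) ∧
        (∀ (y : Letter) (m : Fin 2 → ℤ) (r : ℂ), y ≠ Letter.e → y.Index m →
          r = ∑ i, x i * (m i : ℂ) →
          H.comul (emb (y.elt q m)) =
            emb (y.elt q m) ⊠ pw E r + 1 ⊠ emb (y.elt q m)
              + beta q n m y •
                (emb T ⊠ pw E (-1) * emb (f q (m + n)) * X) ∧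
          H.antipode (emb (y.elt q m)) =
            -(pw E (-r) * emb (y.elt q m))
              + beta q n m y • (pw E (-r) * emb (f q (m + n)) *
                rise (emb T) 1 1 * X)) ∧
        (∀ (m : Fin 2 → ℤ) (r : ℂ), m + n ≠ 0 → r = ∑ i, x i * (m i : ℂ) →
          H.comul (emb (e q m)) =
            qp q (m 1 * n 0) •
                (emb T ⊠ pw E (-1) * emb (g q (m + n)) * X)
              - qp q (m 0 * n 1) •
                (emb T ⊠ pw E (-1) * emb (h q (m + n)) * X)
              + emb (e q m) ⊠ pw E r + 1 ⊠ emb (e q m)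
              - sCoef q n m • (rise (emb T) 0 2 ⊠
                pw E (-2) * emb (f q (m + 2 • n)) * X ^ 2) ∧
          H.antipode (emb (e q m)) =
            qp q (m 1 * n 0) • (pw E (-r) * emb (g q (m + n)) *
                rise (emb T) 1 1 * X)
              - qp q (m 0 * n 1) • (pw E (-r) * emb (h q (m + n)) *
                rise (emb T) 1 1 * X)
              - pw E (-r) * emb (e q m)
              + sCoef q n m • (pw E (-r) * emb (f q (m + 2 • n)) *
                rise (emb T) 1 2 * X ^ 2)) ∧
        H.comul (emb (e q (-n))) =
          emb (e q (-n)) ⊠ pw E (-1) + 1 ⊠ emb (e q (-n))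
            + qp q (-(n 1 * n 0)) •
              (emb T ⊠ pw E (-1) * emb (d q) * X)
            - qp q (-(n 0 * n 1)) • (rise (emb T) 0 2 ⊠
              pw E (-2) * emb E * X ^ 2) ∧
        H.antipode (emb (e q (-n))) =
          qp q (-(n 0 * n 1)) • (pw E 1 * emb E *
              rise (emb T) 1 2 * X ^ 2)
            - pw E 1 * emb (e q (-n))
            + qp q (-(n 0 * n 1)) • (pw E 1 * emb (d q) *
              rise (emb T) 1 1 * X) ∧
        H.comul (emb (d q)) =
          emb (d q) ⊠ 1 + 1 ⊠ emb (d q)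
            - (2 : ℂ) • (emb T ⊠ pw E (-1) * emb E * X) ∧
        H.antipode (emb (d q)) =
          -emb (d q)
            - (2 : ℂ) • (emb E * rise (emb T) 1 1 * X) ∧
        (∀ i : Fin 2,
          H.comul (emb (dd q i)) =
            emb (dd q i) ⊠ 1 + 1 ⊠ emb (dd q i)
              - (n i : ℂ) • (emb T ⊠ 1) + (n i : ℂ) • (emb T ⊠ pw E (-1)) ∧
          H.antipode (emb (dd q i)) =
            -emb (dd q i) + (n i : ℂ) • (emb T * emb E * X))) ∧
    -- `T = -d / 2`, `E = f_n`
    (∀ (n : Fin 2 → ℤ) (T E : ESL q),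
      T = (-(1 / 2) : ℂ) • d q → E = f q n →
      ∃ H : FormalHopf ℂ (U q),
        H.Noncommutative ∧ H.Noncocommutative ∧
        (∀ a, H.counit a = PowerSeries.map (counitU q).toRingHom a) ∧
        (∀ (y : Letter) (m : Fin 2 → ℤ), y ≠ Letter.e → y.Index m →
          H.comul (emb (y.elt q m)) =
            emb (y.elt q m) ⊠ pw E (deltaF y) + 1 ⊠ emb (y.elt q m)
              + beta q n m y •
                (emb T ⊠ pw E (-1) * emb (f q (m + n)) * X) ∧
          H.antipode (emb (y.elt q m)) =
            -(pw E (-deltaF y) * emb (y.elt q m))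
              + beta q n m y • (emb (f q (m + n)) *
                rise (emb T) 1 1 * X)) ∧
        (∀ m : Fin 2 → ℤ, m + n ≠ 0 →
          H.comul (emb (e q m)) =
            qp q (m 1 * n 0) •
                (emb T ⊠ pw E (-1) * emb (g q (m + n)) * X)
              - qp q (m 0 * n 1) •
                (emb T ⊠ pw E (-1) * emb (h q (m + n)) * X)
              + emb (e q m) ⊠ pw E (-1) + 1 ⊠ emb (e q m)
              - sCoef q n m • (rise (emb T) 0 2 ⊠
                pw E (-2) * emb (f q (m + 2 • n)) * X ^ 2) ∧
          H.antipode (emb (e q m)) =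
            qp q (m 1 * n 0) • (pw E 1 * emb (g q (m + n)) *
                rise (emb T) 1 1 * X)
              - qp q (m 0 * n 1) • (pw E 1 * rise (emb T) 1 1 *
                emb (h q (m + n)) * X)
              - pw E 1 * emb (e q m)
              + sCoef q n m • (pw E 1 * emb (f q (m + 2 • n)) *
                rise (emb T) 1 2 * X ^ 2)) ∧
        H.comul (emb (e q (-n))) =
          emb (e q (-n)) ⊠ pw E (-1)
            + qp q (-(n 1 * n 0)) •
              (emb T ⊠ pw E (-1) * emb (d q) * X)
            + 1 ⊠ emb (e q (-n))
            - qp q (-(n 0 * n 1)) • (rise (emb T) 0 2 ⊠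
              pw E (-2) * emb E * X ^ 2) ∧
        H.antipode (emb (e q (-n))) =
          qp q (-(n 0 * n 1)) • (pw E 1 * emb E *
              rise (emb T) 1 2 * X ^ 2)
            - pw E 1 * emb (e q (-n))
            + qp q (-(n 0 * n 1)) • (pw E 1 * emb (d q) *
              rise (emb T) 1 1 * X) ∧
        H.comul (emb (d q)) =
          emb (d q) ⊠ 1 + 1 ⊠ emb (d q)
            - (2 : ℂ) • (emb T ⊠ pw E (-1) * emb E * X) ∧
        H.antipode (emb (d q)) =
          -emb (d q)
            - (2 : ℂ) • (emb E * rise (emb T) 1 1 * X) ∧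
        (∀ i : Fin 2,
          H.comul (emb (dd q i)) =
            emb (dd q i) ⊠ 1 + 1 ⊠ emb (dd q i)
              + (n i : ℂ) • (emb T ⊠ pw E (-1)) - (n i : ℂ) • (emb T ⊠ 1) ∧
          H.antipode (emb (dd q i)) =
            -emb (dd q i) + (n i : ℂ) • (emb T * emb E * X))) := by
  refine ⟨?_, ?_, ?_⟩
  · rintro n x T E hn rfl rfl hTE
    obtain ⟨H, h1, h2, h3, hH⟩ := exists_formalHopf hTE (h_ne_zero hn)
    have hJ : IsJordanian H _ _ := hH
    have hdd : ∀ i : Fin 2, ⁅h q n, dd q i⁆ = (-(n i : ℂ)) • h q n := lie_letter_dd Letter.h n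
    refine ⟨H, h1, h2, h3, ?_, fun i => ⟨hJ.comul_derivation (lie_sum_dd_dd x i) (hdd i),
      hJ.antipode_derivation hTE (lie_sum_dd_dd x i) (hdd i)⟩, ?_, ?_⟩
    · rintro y m r hy rfl
      have hw := hJ _ _ (lie_sum_dd_letter x y m)
      simp only [pow_ad_h hn y m hy, emb_smul, mul_smul_comm, smul_mul_assoc, ot_smul,
        smul_smul] at hw
      -- Cancels the sign of the twist series against the one in `pow_ad_h`.
      have hs : ∀ j : ℕ, ((-1 : ℂ) ^ j) * (-1) ^ j = 1 := fun j => by rw [← mul_pow]; simp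
      refine ⟨hw.1.trans ?_, hw.2.trans ?_⟩
      · congr 2; funext j
        congr 1
        linear_combination (eta q n m y j / (j.factorial : ℂ)) * hs j
      · rw [tSum_neg]
        congr 1; funext j
        rw [← neg_smul]
        congr 1
        ring
    · rw [hJ.comul_of_two (r := 0) (by rw [lie_sum_dd_d, zero_smul]) (lie_h_d n hn) (lie_zero _),
        pw_zero, emb_zero, mul_zero, zero_mul, ot_zero, sub_zero]
    · rw [hJ.antipode_of_two (r := 0) (by rw [lie_sum_dd_d, zero_smul]) (lie_h_d n hn)
        (lie_zero _), neg_zero, pw_zero, emb_zero, mul_zero, zero_mul, zero_mul, sub_zero, one_mul]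
  · rintro n x T E rfl rfl hTE
    obtain ⟨H, h1, h2, h3, hH⟩ := exists_formalHopf hTE (f_ne_zero n)
    have hJ : IsJordanian H _ _ := hH
    have hdd : ∀ i : Fin 2, ⁅f q n, dd q i⁆ = (-(n i : ℂ)) • f q n := lie_letter_dd Letter.f n
    -- `[T, f_n] = f_n` fixes the weight of degree `n`, so `e_{-n}` has weight `-1` whatever `x` is.
    have hx : ∑ i, x i * (n i : ℂ) = 1 := by
      have e1 := (lie_sum_dd_letter x Letter.f n).symm.trans hTE
      have e2 : (∑ i, x i * (n i : ℂ) - 1) • f q n = 0 := by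
        rw [sub_smul, one_smul, sub_eq_zero]
        exact e1
      exact sub_eq_zero.mp ((smul_eq_zero.mp e2).resolve_right (f_ne_zero n))
    have he : ⁅∑ i, x i • dd q i, e q (-n)⁆ = (-1 : ℂ) • e q (-n) := by
      refine (lie_sum_dd_letter x Letter.e (-n)).trans ?_
      have e1 : ∑ i, x i * (((-n) i : ℤ) : ℂ) = -1 := by
        rw [← hx, ← Finset.sum_neg_distrib]
        refine Finset.sum_congr rfl fun i _ => ?_
        rw [Pi.neg_apply, Int.cast_neg, mul_neg]
      rw [e1]
      rfl
    refine ⟨H, h1, h2, h3, ?_, ?_, comul_e_neg_lowering hJ he, antipode_e_neg_lowering hJ he,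
      hJ.comul_cartan (lie_sum_dd_d x) (lie_f_d n), hJ.antipode_cartan (lie_sum_dd_d x) (lie_f_d n),
      fun i => ⟨hJ.comul_derivation (lie_sum_dd_dd x i) (hdd i),
        hJ.antipode_derivation hTE (lie_sum_dd_dd x i) (hdd i)⟩⟩
    · rintro y m r hye hy rfl
      exact ⟨comul_letter_lowering hJ hye hy (lie_sum_dd_letter x y m),
        antipode_letter_lowering hJ hye hy (lie_sum_dd_letter x y m)⟩
    · rintro m r hm rfl
      exact ⟨comul_e_lowering hJ hm (lie_sum_dd_letter x Letter.e m),
        antipode_e_lowering hJ hm (lie_sum_dd_letter x Letter.e m)⟩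
  · rintro n T E rfl rfl
    have hTE : ⁅(-(1 / 2) : ℂ) • d q, f q n⁆ = f q n := by
      have := lie_half_d_letter (q := q) Letter.f (by simp) n
      rwa [deltaF, one_smul] at this
    obtain ⟨H, h1, h2, h3, hH⟩ := exists_formalHopf hTE (f_ne_zero n)
    have hJ : IsJordanian H _ _ := hH
    have hdd : ∀ i : Fin 2, ⁅f q n, dd q i⁆ = (-(n i : ℂ)) • f q n := lie_letter_dd Letter.f n
    have hTd : ⁅(-(1 / 2) : ℂ) • d q, d q⁆ = 0 := by rw [smul_lie, lie_self, smul_zero]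
    have hTdd : ∀ i, ⁅(-(1 / 2) : ℂ) • d q, dd q i⁆ = 0 := fun i => by
      rw [smul_lie, lie_d_dd, smul_zero]
    refine ⟨H, h1, h2, h3, ?_, ?_, ?_, antipode_e_neg_lowering hJ (lie_half_d_e _),
      hJ.comul_cartan hTd (lie_f_d n), hJ.antipode_cartan hTd (lie_f_d n),
      fun i => ⟨?_, hJ.antipode_derivation hTE (hTdd i) (hdd i)⟩⟩
    · rintro y m hye hy
      refine ⟨comul_letter_lowering hJ hye hy (lie_half_d_letter y hye m),
        (antipode_letter_lowering hJ hye hy (lie_half_d_letter y hye m)).trans ?_⟩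
      -- The general formula has a factor `(1 - E t)^{-δ}` in the `β` term. It may be dropped, since
      -- `δ` is nonzero only for `f`, where `β` vanishes.
      cases y with
      | e => exact absurd rfl hye
      | f => rw [beta, zero_smul, zero_smul]
      | g => rw [deltaF_g, neg_zero, pw_zero, one_mul, one_mul]
      | h => rw [deltaF_h, neg_zero, pw_zero, one_mul, one_mul]
    · rintro m hm
      refine ⟨comul_e_lowering hJ hm (lie_half_d_e m),
        (antipode_e_lowering hJ hm (lie_half_d_e m)).trans ?_⟩
      -- The formula to be proved has `T_1` to the left of `h_{m+n}`; this is harmless because `d`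
      -- commutes with every `h`.
      have hc : Commute (rise (emb ((-(1 / 2) : ℂ) • d q)) 1 1) (emb (h q (m + n))) :=
        commute_rise_emb (by rw [smul_lie, lie_d_h, smul_zero]) 1 1
      rw [neg_neg, mul_assoc (pw (f q n) 1) (rise _ _ _), hc.eq, ← mul_assoc]
    · rw [comul_e_neg_lowering hJ (lie_half_d_e _), add_right_comm]
    · rw [hJ.comul_derivation (hTdd i) (hdd i), sub_add_eq_add_sub]
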